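/- Let $\Sigma=\{0,1\}$ and let $\prec_{\rm lex}$, $\le_{\rm lex}$ denote lexicographical successor and lexicographical order on $\Sigma^*$ (shorter strings first). An NPTM is a nondeterministic polynomial-time Turing machine whose nondeterministic steps are binary guesses; its computation paths on an input are named by their guess strings, and ${\rm acc}_M(x)$ is the set of accepting paths of $M$ on $x$. For a polynomial $p$ (with natural-number values on $\mathbb N$), $M$ is $p$-balanced if on each input $x$ the set of guess strings of its computation paths is exactly $\{0,1\}^{p(|x|)}$. Let $p$ be a polynomial, $M$ a $p$-balanced NPTM, ${\prec}$ a polynomial-time computable 3-argument predicate on $\Sigma^*$, and $f:\Sigma^*\to\mathbb N$. We say that $f$ is computed by $p,M,{\prec}$ in the free model if for every $x$ there is a bijection $h_x$ of $\{0,1\}^{p(|x|)}$ onto itself such that (1) for all $y,z\in\{0,1\}^{p(|x|)}$: ${\prec}(x,y,z)\iff h_x(y)\prec_{\rm lex}h_x(z)$; (2) if $f(x)\ne0$, then there are $\ell,u\in\{0,1\}^{p(|x|)}$ with ${\rm acc}_M(x)=\{w\in\{0,1\}^{p(|x|)} : h_x(\ell)\le_{\rm lex}h_x(w)\le_{\rm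 lex}h_x(u)\}$; (3) $f(x)=\|{\rm acc}_M(x)\|$. We say that $f$ is computed by $p,M,{\prec}$ in the circular model if the same holds with (1) replaced by: for all $y,z\in\{0,1\}^{p(|x|)}$, ${\prec}(x,y,z)\iff \big(h_x(y)\prec_{\rm lex}h_x(z)$ or $(h_x(y)=1^{p(|x|)}$ and $h_x(z)=0^{p(|x|)})\big)$. The function $f$ is in ${\rm CLU\#P}$ if it is computed by some $p,M,{\prec}$ in the free model with bijections $h_x$ for which there are total polynomial-time computable functions $b,\top:\Sigma^*\to\Sigma^*$ with $|b(x)|=|\top(x)|=p(|x|)$, $h_x(b(x))=0^{p(|x|)}$ and $h_x(\top(x))=1^{p(|x|)}$ for all $x$. The partial functions ${\it greatest}_{p,M,\prec}$ and ${\it least}_{p,M,\prec}$ are undefined at $x$ if $f(x)=0$. In the free model, if $f(x)\neq0$, ${\it greatest}_{p,M,\prec}(x)$ (respectively ${\it least}_{p,M,\prec}(x)$) is the unique $z\in{\rm acc}_M(x)$ such that no $w\in{\rm acc}_M(x)$ satisfies ${\prec}(x,z,w)$ (respectively ${\prec}(x,w,z)$). In the circular model they are defined in the same way if $0<f(x)<2^{p(|x|)}$;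 if $f(x)=2^{p(|x|)}$, then ${\it greatest}_{p,M,\prec}(x)=1^{p(|x|)}$, and ${\it least}_{p,M,\prec}(x)$ is the empty string if $p(|x|)=0$ and otherwise the unique $z\in\{0,1\}^{p(|x|)}$ with ${\prec}(x,1^{p(|x|)},z)$. A partial function $g:\Sigma^*\to\Sigma^*$ is in ${\rm UPSV_p}$ if there is an NPTM that on each input $x$ has at most one accepting path, has one exactly if $g(x)$ is defined, and then outputs $g(x)$ on that path. Theorem. (i) Let $f$ be computed by $p,M,{\prec}$ in the free model. If ${\it greatest}_{p,M,\prec}\in{\rm UPSV_p}$ and ${\it least}_{p,M,\prec}\in{\rm UPSV_p}$ (free-model definitions), then $f\in{\rm CLU\#P}$. (ii) Let $f$ be computed by $p,M,{\prec}$ in the circular model. If ${\it greatest}_{p,M,\prec}\in{\rm UPSV_p}$ and ${\it least}_{p,M,\prec}\in{\rm UPSV_p}$ (circular-model definitions), then $f\in{\rm CLU\#P}$. -/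

import Mathlib

namespace ClusterComputing

/-- Strings over the alphabet `{0,1}` (`false` is `0`, `true` is `1`). -/
abbrev Str : Type := List Bool

/-- The set `{0,1}^n`. -/
abbrev BitStr (n : ℕ) : Type := {w : Str // w.length = n}

/-- `p` is given by a polynomial that takes natural-number values at natural numbers. -/
def IsPoly (p : ℕ → ℕ) : Prop :=
  ∃ P : Polynomial ℝ, ∀ n : ℕ, P.eval (n : ℝ) = (p n : ℝ)

/-! ### Lexicographical order (shorter strings come first) -/

/-- Strict lexicographical order on `Σ*`: by length, then by the first differing bit. -/
def LexLT (a b : Str) : Prop := List.Shortlex (· < ·) a b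

/-- Lexicographical order on `Σ*`. -/
def LexLE (a b : Str) : Prop := a = b ∨ LexLT a b

/-- `b` is the lexicographical successor of `a`. -/
def LexSucc (a b : Str) : Prop := LexLT a b ∧ ∀ c, ¬ (LexLT a c ∧ LexLT c b)

/-! ### Deterministic polynomial time -/

/-- The total polynomial-time computable functions from strings to strings. -/
def FPt (g : Str → Str) : Prop :=
  Nonempty (Turing.TM2ComputableInPolyTime
    (Computability.encodingList Bool).encode (Computability.encodingList Bool).encode g)

/-- Encoding of triples of strings: the three strings are concatenated, every symbol being tagged
with the component it belongs to. -/
def encodingTriple : Computability.Encoding (Str × Str × Str) (Bool ⊕ (Bool ⊕ Bool)) :=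
  Computability.encodingProd (Computability.encodingList Bool)
    (Computability.encodingProd (Computability.encodingList Bool)
      (Computability.encodingList Bool))

/-- Polynomial-time computable 3-argument predicates on strings. -/
def PolyTimePred (prec : Str → Str → Str → Bool) : Prop :=
  Nonempty (Turing.TM2ComputableInPolyTime
    encodingTriple.encode Computability.encodeBool
    (fun a : Str × Str × Str => prec a.1 a.2.1 a.2.2))

/-! ### Nondeterministic machines -/

/-- A nondeterministic multi-stack Turing machine with binary input and output alphabets, whose
nondeterministic steps are binary guesses: at a label `l` with `alt l = none` the machine
executes the statement `tm.m l`; at a label `l` with `alt l = some s` it guesses a bit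
and executes `tm.m l` if the bit is `0` and `s` if the bit is `1`. When it halts, it accepts
or rejects according to its internal state. -/
structure NTM extends Turing.TM2ComputableAux Bool Bool where
  /-- the alternative statement, at the labels at which a guess is made -/
  alt : tm.Λ → Option (Turing.TM2.Stmt tm.Γ tm.Λ tm.σ)
  /-- the internal states in which halting means accepting -/
  accept : tm.σ → Bool

namespace NTM

variable (M : NTM)

/-- Configurations; a configuration is halting if its label is `none`. -/
abbrev Cfg : Type := Turing.TM2.Cfg M.tm.Γ M.tm.Λ M.tm.σ

/-- The initial configuration on input `x`. -/
def init (x : Str) : M.Cfg := Turing.initList M.tm (x.map M.inputAlphabet.symm)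

/-- `M.Run c w t c'`: from `c`, the machine can reach `c'` in exactly `t` steps, where `w` is the
sequence of the bits guessed in these steps. -/
inductive Run : M.Cfg → Str → ℕ → M.Cfg → Prop
  | refl (c : M.Cfg) : Run c [] 0 c
  | det {l : M.tm.Λ} {v : M.tm.σ} {S : ∀ k, List (M.tm.Γ k)} {w : Str} {t : ℕ} {c : M.Cfg} :
      M.alt l = none → Run (Turing.TM2.stepAux (M.tm.m l) v S) w t c →
      Run ⟨some l, v, S⟩ w (t + 1) c
  | guess_zero {l : M.tm.Λ} {s : Turing.TM2.Stmt M.tm.Γ M.tm.Λ M.tm.σ}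
      {v : M.tm.σ} {S : ∀ k, List (M.tm.Γ k)} {w : Str} {t : ℕ} {c : M.Cfg} :
      M.alt l = some s → Run (Turing.TM2.stepAux (M.tm.m l) v S) w t c →
      Run ⟨some l, v, S⟩ (false :: w) (t + 1) c
  | guess_one {l : M.tm.Λ} {s : Turing.TM2.Stmt M.tm.Γ M.tm.Λ M.tm.σ}
      {v : M.tm.σ} {S : ∀ k, List (M.tm.Γ k)} {w : Str} {t : ℕ} {c : M.Cfg} :
      M.alt l = some s → Run (Turing.TM2.stepAux s v S) w t c →
      Run ⟨some l, v, S⟩ (true :: w) (t + 1) c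

/-- `M` is a nondeterministic polynomial-time Turing machine: on each input, the number of steps
along every nondeterministic computation is polynomially bounded in the length of the input. -/
def IsNPTM : Prop :=
  ∃ P : Polynomial ℕ, ∀ (x w : Str) (t : ℕ) (c : M.Cfg),
    M.Run (M.init x) w t c → t ≤ P.eval x.length

/-- The computation paths of `M` on `x`, each one named by its guesses. -/
def paths (x : Str) : Set Str :=
  {w | ∃ (t : ℕ) (c : M.Cfg), M.Run (M.init x) w t c ∧ c.l = none}

/-- `w` is an accepting path of `M` on `x`, and `y` is on the output stack when `M` halts. -/
def AcceptsWith (x w y : Str) : Prop :=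
  ∃ (t : ℕ) (c : M.Cfg), M.Run (M.init x) w t c ∧ c.l = none ∧ M.accept c.var = true ∧
    (c.stk M.tm.k₁).map M.outputAlphabet = y

/-- The accepting paths of `M` on `x`. -/
def acc (x : Str) : Set Str := {w | ∃ y, M.AcceptsWith x w y}

/-- The number of accepting paths of `M` on `x`. -/
noncomputable def numAcc (x : Str) : ℕ := (M.acc x).ncard

/-- `M` is `p`-balanced: on each input `x`, the guess sequences along the computation
paths are precisely the strings of length `p |x|`. -/
def Balanced (p : ℕ → ℕ) : Prop := ∀ x : Str, M.paths x = {w | w.length = p x.length}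

end NTM

/-- A partial function from strings to strings is in `UPSV_p` if some nondeterministic
polynomial-time machine has at most one accepting path on each input, outputs the value on that
path if there is one, and has an accepting path whenever the function is defined. -/
def UPSVp (g : Str →. Str) : Prop :=
  ∃ M : NTM, M.IsNPTM ∧ ∀ x : Str,
    (M.acc x).Subsingleton ∧
    (∀ w y, M.AcceptsWith x w y → y ∈ g x) ∧
    (M.acc x = ∅ → ¬ (g x).Dom)

/-! ### The three cluster models -/

/-- The accepting paths on `x`, if there are any, form an interval with respect to the order on
`{0,1}^n` that is transported by `h` from the lexicographical order. -/
def Clustered (M : NTM) (x : Str) {n : ℕ} (h : BitStr n ≃ BitStr n) : Prop :=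
  ∃ l u : BitStr n, M.acc x =
    {w | ∃ hw : w.length = n, LexLE (h l).1 (h ⟨w, hw⟩).1 ∧ LexLE (h ⟨w, hw⟩).1 (h u).1}

/-- `f` is computed by `p`, `M`, `prec`, with bottom function `b` and top function `top`. -/
structure Computes (p : ℕ → ℕ) (M : NTM) (b top : Str → Str) (prec : Str → Str → Str → Bool)
    (f : Str → ℕ) : Prop where
  poly : IsPoly p
  nptm : M.IsNPTM
  balanced : M.Balanced p
  bot_fp : FPt b
  top_fp : FPt top
  prec_poly : PolyTimePred prec
  order : ∀ x : Str, ∃ h : BitStr (p x.length) ≃ BitStr (p x.length),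
    (∃ (hb : (b x).length = p x.length) (ht : (top x).length = p x.length),
      (h ⟨b x, hb⟩).1 = List.replicate (p x.length) false ∧
      (h ⟨top x, ht⟩).1 = List.replicate (p x.length) true) ∧
    (∀ y z : BitStr (p x.length), prec x y.1 z.1 = true ↔ LexSucc (h y).1 (h z).1) ∧
    (f x ≠ 0 → Clustered M x h) ∧
    f x = M.numAcc x

/-- The class `CLU#P`. -/
def CLUSharpP (f : Str → ℕ) : Prop :=
  ∃ (p : ℕ → ℕ) (M : NTM) (b top : Str → Str) (prec : Str → Str → Str → Bool),
    Computes p M b top prec f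

/-- `f` is computed by `p`, `M`, `prec` in the free model. -/
structure ComputesFree (p : ℕ → ℕ) (M : NTM) (prec : Str → Str → Str → Bool)
    (f : Str → ℕ) : Prop where
  poly : IsPoly p
  nptm : M.IsNPTM
  balanced : M.Balanced p
  prec_poly : PolyTimePred prec
  order : ∀ x : Str, ∃ h : BitStr (p x.length) ≃ BitStr (p x.length),
    (∀ y z : BitStr (p x.length), prec x y.1 z.1 = true ↔ LexSucc (h y).1 (h z).1) ∧
    (f x ≠ 0 → Clustered M x h) ∧
    f x = M.numAcc x

/-- `f` is computed by `p`, `M`, `prec` in the circular model. -/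
structure ComputesCircular (p : ℕ → ℕ) (M : NTM) (prec : Str → Str → Str → Bool)
    (f : Str → ℕ) : Prop where
  poly : IsPoly p
  nptm : M.IsNPTM
  balanced : M.Balanced p
  prec_poly : PolyTimePred prec
  order : ∀ x : Str, ∃ h : BitStr (p x.length) ≃ BitStr (p x.length),
    (∀ y z : BitStr (p x.length), prec x y.1 z.1 = true ↔
      (LexSucc (h y).1 (h z).1 ∨
        ((h y).1 = List.replicate (p x.length) true ∧
          (h z).1 = List.replicate (p x.length) false))) ∧
    (f x ≠ 0 → Clustered M x h) ∧
    f x = M.numAcc x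

/-! ### Greatest and least accepting paths -/

/-- The unique string satisfying `P`, undefined if there is not exactly one such string. -/
noncomputable def theUnique (P : Str → Prop) : Part Str := ⟨∃! z, P z, fun h => h.choose⟩

/-- `z` is an accepting path to which no accepting path is right-adjacent. -/
def NoRight (p : ℕ → ℕ) (M : NTM) (prec : Str → Str → Str → Bool) (x z : Str) : Prop :=
  z.length = p x.length ∧ z ∈ M.acc x ∧
    ∀ w : Str, w.length = p x.length → w ∈ M.acc x → ¬ prec x z w = true

/-- `z` is an accepting path to which no accepting path is left-adjacent. -/
def NoLeft (p : ℕ → ℕ) (M : NTM) (prec : Str → Str → Str → Bool) (x z : Str) : Prop :=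
  z.length = p x.length ∧ z ∈ M.acc x ∧
    ∀ w : Str, w.length = p x.length → w ∈ M.acc x → ¬ prec x w z = true

/-- The greatest accepting path in the free model (undefined if there is no accepting path). -/
noncomputable def greatestFree (p : ℕ → ℕ) (M : NTM) (prec : Str → Str → Str → Bool) :
    Str →. Str :=
  fun x => theUnique (NoRight p M prec x)

/-- The least accepting path in the free model (undefined if there is no accepting path). -/
noncomputable def leastFree (p : ℕ → ℕ) (M : NTM) (prec : Str → Str → Str → Bool) :
    Str →. Str :=
  fun x => theUnique (NoLeft p M prec x)

/-- The greatest accepting path in the circular model: `1^{p(|x|)}` if all paths accept,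
otherwise as in the free model. -/
noncomputable def greatestCircular (p : ℕ → ℕ) (M : NTM) (prec : Str → Str → Str → Bool) :
    Str →. Str :=
  fun x =>
    if M.numAcc x = 2 ^ p x.length then Part.some (List.replicate (p x.length) true)
    else theUnique (NoRight p M prec x)

/-- The least accepting path in the circular model: if all paths accept, then the path that is
right-adjacent to `1^{p(|x|)}` (the empty string if `p(|x|) = 0`), otherwise as in the free
model. -/
noncomputable def leastCircular (p : ℕ → ℕ) (M : NTM) (prec : Str → Str → Str → Bool) :
    Str →. Str :=
  fun x =>
    if M.numAcc x = 2 ^ p x.length then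
      if p x.length = 0 then Part.some []
      else theUnique
        (fun z => z.length = p x.length ∧ prec x (List.replicate (p x.length) true) z = true)
    else theUnique (NoLeft p M prec x)

end ClusterComputing

/-! The old order is discarded outside the cluster. What remains of it is placed inside an order of
longer strings whose ends are `0...0` and `1...1`, so that the bottom and top functions become
trivial. The least and the greatest accepting path, which are needed to attach the cluster to the
new order, are only known to unambiguous nondeterministic machines. Therefore the new guess strings
carry the computations that find them.

Fix `x` with accepting paths. Let `v₁` and `v₂` be the unique accepting paths of the machines for
the greatest and for the least element. The new guess strings are `c :: t` with a bit `c` and `|t| =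
n`. Call `t` special if `t = v₁ v₂ w 1...1` with `w` an accepting path of `M`, and call `v₁ v₂
0...0` the anchor. Deterministic simulation along `t` decides both properties in polynomial time and
yields the two extreme elements from `v₁` and `v₂`. Since `v₁` and `v₂` are unique, each `w` has
exactly one code, so accepting precisely the strings `0 :: t` with `t` special preserves the number
of accepting paths.

For the order, start with binary counting, least significant bit first: it consists of blocks `0 ::
t`, `1 :: t`. Remove the special strings `0 :: t` and insert them, in the order given by `prec`,
directly behind `0 :: a`, where `a` is the anchor. The successor relation is still decidable in
polynomial time: every block keeps `1 :: t`, so that at most one removed string has to be skipped at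
a time; the anchor is followed by the code of the least element; a special string is followed
according to `prec`, except that the code of the greatest element is followed by `1 :: a`. That
exception is what cuts the cycle in the circular model when all paths accept. If no path of `M`
accepts, there are no special strings and no anchor, and plain counting remains.

The combinatorial core is `exists_equiv_insertion`, applied in `Stages.exists_equiv`. The lemmas
`ComputesFree.cluster` and `ComputesCircular.cluster` present the cluster in both models as a list
with the required ends. The complexity part is a small calculus of programs on stacks (`Frag`,
`PolyOp`, `PT`) in which nondeterministic machines can be simulated on given guesses
(`NTM.IsNPTM.exists_simulation`) and from which balanced machines are built (`exists_balanced`). -/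

namespace ClusterComputing

open Turing Turing.TM2 Function

/-! ### Runs of multi-stack machines -/

/-- The contents of a family of stacks. -/
abbrev Stk {K : Type} (Γ : K → Type) : Type := ∀ k, List (Γ k)

/-- The total number of symbols on the stacks. -/
def Stk.size {K : Type} [Fintype K] {Γ : K → Type} (S : Stk Γ) : ℕ := ∑ k, (S k).length

/-- `Steps m c t c'`: the machine with program `m` moves from `c` to `c'` in exactly `t` steps. -/
inductive Steps {K : Type} [DecidableEq K] {Γ : K → Type} {Λ σ : Type} (m : Λ → Stmt Γ Λ σ) :
    Cfg Γ Λ σ → ℕ → Cfg Γ Λ σ → Prop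
  | refl (c) : Steps m c 0 c
  | head {l v S t c} : Steps m (stepAux (m l) v S) t c → Steps m ⟨some l, v, S⟩ (t + 1) c

theorem Steps.trans {K : Type} [DecidableEq K] {Γ : K → Type} {Λ σ : Type}
    {m : Λ → Stmt Γ Λ σ} {c c' c'' : Cfg Γ Λ σ} {t t' : ℕ} (h : Steps m c t c')
    (h' : Steps m c' t' c'') : Steps m c (t + t') c'' := by
  induction h with
  | refl => simpa using h'
  | head _ ih => rw [Nat.add_right_comm]; exact .head (ih h')

/-- The number of symbols that a statement can push. -/
def pushes {K : Type} {Γ : K → Type} {Λ σ : Type} : Stmt Γ Λ σ → ℕ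
  | .push _ _ q => pushes q + 1
  | .peek _ _ q => pushes q
  | .pop _ _ q => pushes q
  | .load _ q => pushes q
  | .branch _ q q' => pushes q + pushes q'
  | .goto _ => 0
  | .halt => 0

/-! ### Growth of the stack contents -/

section size

variable {K : Type} [DecidableEq K] [Fintype K] {Γ : K → Type}

/-- Stated additively so that no truncated subtraction occurs. -/
theorem size_update (S : Stk Γ) (k : K) (w : List (Γ k)) :
    Stk.size (update S k w) + (S k).length = S.size + w.length := by
  unfold Stk.size
  rw [← Finset.add_sum_erase _ _ (Finset.mem_univ k), ← Finset.add_sum_erase (a := k) _ (fun k => (S k).length) (Finset.mem_univ k),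
    Finset.sum_congr rfl (g := fun k => (S k).length)]
  · simp; omega
  · intro x hx
    rw [update_of_ne (Finset.ne_of_mem_erase hx)]

omit [DecidableEq K] in
theorem length_le_size (S : Stk Γ) (k : K) : (S k).length ≤ S.size :=
  Finset.single_le_sum (f := fun k => (S k).length) (fun _ _ => Nat.zero_le _) (Finset.mem_univ k)

theorem size_stepAux_le {Λ σ : Type} (s : Stmt Γ Λ σ) (v : σ) (S : Stk Γ) :
    Stk.size (stepAux s v S).stk ≤ S.size + pushes s := by
  induction s generalizing v S with
  | push k f q ih =>
    have h := size_update S k (f v :: S k)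
    refine (ih _ _).trans ?_
    simp only [pushes, List.length_cons] at *
    omega
  | pop k f q ih =>
    have h := size_update S k (S k).tail
    refine (ih _ _).trans ?_
    simp only [pushes, List.length_tail] at *
    omega
  | peek k f q ih => exact ih _ _
  | load f q ih => exact ih _ _
  | branch f q q' ih ih' =>
    simp only [stepAux, pushes]
    cases f v
    · exact (ih' _ _).trans (by omega)
    · exact (ih _ _).trans (by omega)
  | goto => simp [pushes]
  | halt => simp [pushes]

/-- Space is bounded linearly in time. This is what keeps running times polynomial when programs are
composed. -/
theorem Steps.size_le {Λ σ : Type} [Fintype Λ] {m : Λ → Stmt Γ Λ σ} {c c' : Cfg Γ Λ σ} {t : ℕ}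
    (h : Steps m c t c') :
    Stk.size c'.stk ≤ Stk.size c.stk + (∑ l, pushes (m l)) * t := by
  induction h with
  | refl => simp
  | @head l v S t c _ ih =>
    have h1 := size_stepAux_le (m l) v S
    have h2 := Finset.single_le_sum (f := fun l => pushes (m l)) (fun _ _ => Nat.zero_le _)
      (Finset.mem_univ l)
    rw [Nat.mul_add, Nat.mul_one]
    change _ ≤ Stk.size S + _
    omega

end size

/-! ### Embedding a machine into a larger one -/

/-- An embedding of a family of stacks and of internal states into larger ones. -/
structure Embed {K K' : Type} (Γ : K → Type) (Γ' : K' → Type) (σ σ' : Type) where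
  ι : K → K'
  en : ∀ k, Γ k → Γ' (ι k)
  de : ∀ k, Γ' (ι k) → Γ k
  de_en : ∀ k a, de k (en k a) = a
  get : σ' → σ
  st : σ → σ'
  get_st : ∀ v, get (st v) = v

namespace Embed

variable {K K' : Type} {Γ : K → Type} {Γ' : K' → Type} {σ σ' Λ Λ' : Type} (E : Embed Γ Γ' σ σ')

/-- The translation of a statement, where halting is replaced by `ex`. -/
def lift (fl : Λ → Λ') (ex : Stmt Γ' Λ' σ') : Stmt Γ Λ σ → Stmt Γ' Λ' σ'
  | .push k f q => .push (E.ι k) (fun v => E.en k (f (E.get v))) (lift fl ex q)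
  | .peek k f q => .peek (E.ι k) (fun v o => E.st (f (E.get v) (o.map (E.de k)))) (lift fl ex q)
  | .pop k f q => .pop (E.ι k) (fun v o => E.st (f (E.get v) (o.map (E.de k)))) (lift fl ex q)
  | .load f q => .load (fun v => E.st (f (E.get v))) (lift fl ex q)
  | .branch f q q' => .branch (fun v => f (E.get v)) (lift fl ex q) (lift fl ex q')
  | .goto f => .goto (fun v => fl (f (E.get v)))
  | .halt => ex

variable [DecidableEq K] [DecidableEq K']

/-- `L` embeds stack contents in a way that is compatible with updates. -/
structure Compat (L : Stk Γ → Stk Γ') : Prop where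
  get : ∀ S k, L S (E.ι k) = (S k).map (E.en k)
  upd : ∀ S k w, L (update S k w) = update (L S) (E.ι k) (w.map (E.en k))

/-- The translation of a configuration. -/
def liftCfg (fl : Λ → Λ') (ex : Stmt Γ' Λ' σ') (L : Stk Γ → Stk Γ') (c : Cfg Γ Λ σ) :
    Cfg Γ' Λ' σ' :=
  match c.l with
  | some l => ⟨some (fl l), E.st c.var, L c.stk⟩
  | none => stepAux ex (E.st c.var) (L c.stk)

variable {E}

/-- The two programs differ in form only where the small one halts, and there `liftCfg` is defined
as the result of `ex`. Symbols read from the stacks agree because decoding inverts encoding. -/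
theorem stepAux_lift {L : Stk Γ → Stk Γ'} (hL : E.Compat L) (fl : Λ → Λ') (ex : Stmt Γ' Λ' σ')
    (s : Stmt Γ Λ σ) (v : σ) (S : Stk Γ) :
    stepAux (E.lift fl ex s) (E.st v) (L S) = E.liftCfg fl ex L (stepAux s v S) := by
  have hm : ∀ k (w : List (Γ k)), (w.map (E.en k)).head?.map (E.de k) = w.head? := by
    intro k w; cases w <;> simp [E.de_en]
  induction s generalizing v S with
  | push k f q ih =>
    simp only [lift, stepAux, ← ih, hL.upd, hL.get, E.get_st, List.map_cons]
  | pop k f q ih =>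
    simp only [lift, stepAux, ← ih, hL.upd, hL.get, E.get_st, List.map_tail, hm]
  | peek k f q ih => simp only [lift, stepAux, ← ih, hL.get, E.get_st, hm]
  | load f q ih => simp only [lift, stepAux, ← ih, E.get_st]
  | branch f q q' ih ih' =>
    simp only [lift, stepAux, E.get_st]
    cases f v
    · exact ih' _ _
    · exact ih _ _
  | goto f => simp [lift, liftCfg, E.get_st]
  | halt => simp [lift, liftCfg]

/-- The step count is the same on both sides: `ex` is part of the last statement and needs no step
of its own. -/
theorem steps_lift {L : Stk Γ → Stk Γ'} (hL : E.Compat L) {fl : Λ → Λ'} {ex : Stmt Γ' Λ' σ'}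
    {m : Λ → Stmt Γ Λ σ} {m' : Λ' → Stmt Γ' Λ' σ'} (hm : ∀ l, m' (fl l) = E.lift fl ex (m l))
    {c c' : Cfg Γ Λ σ} {t : ℕ} (h : Steps m c t c') :
    Steps m' (E.liftCfg fl ex L c) t (E.liftCfg fl ex L c') := by
  induction h with
  | refl => exact .refl _
  | head _ ih =>
    refine .head ?_
    rw [hm, stepAux_lift hL]
    exact ih

end Embed

/-! ### Program fragments -/

/-- Two families of alphabets, put together. -/
abbrev SumFam {V H : Type} (Γ : V → Type) (Δ : H → Type) : V ⊕ H → Type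
  | .inl v => Γ v
  | .inr h => Δ h

/-- The contents of two families of stacks, put together. -/
def Stk.join {V H : Type} {Γ : V ⊕ H → Type} (S : Stk fun v => Γ (.inl v))
    (T : Stk fun h => Γ (.inr h)) : Stk Γ
  | .inl v => S v
  | .inr h => T h

@[simp] theorem Stk.join_inl {V H : Type} {Γ : V ⊕ H → Type} (S : Stk fun v => Γ (.inl v))
    (T : Stk fun h => Γ (.inr h)) (v : V) :
    Stk.join S T (.inl v) = S v := rfl

@[simp] theorem Stk.join_inr {V H : Type} {Γ : V ⊕ H → Type} (S : Stk fun v => Γ (.inl v))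
    (T : Stk fun h => Γ (.inr h)) (h : H) :
    Stk.join S T (.inr h) = T h := rfl

/-- Empty stacks. -/
def Stk.nil {K : Type} {Γ : K → Type} : Stk Γ := fun _ => []

@[simp] theorem Stk.nil_apply {K : Type} {Γ : K → Type} (k : K) : (Stk.nil : Stk Γ) k = [] := rfl

@[simp] theorem size_nil {K : Type} [Fintype K] {Γ : K → Type} : (Stk.nil : Stk Γ).size = 0 := by
  simp [Stk.size]

@[simp] theorem size_join {V H : Type} [Fintype V] [Fintype H] {Γ : V ⊕ H → Type} (S : Stk fun v => Γ (.inl v))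
    (T : Stk fun h => Γ (.inr h)) : (Stk.join S T).size = S.size + T.size := by
  simp [Stk.size]

theorem join_update_left {V H : Type} [DecidableEq V] [DecidableEq H] {Γ : V ⊕ H → Type}
    (S : Stk fun v => Γ (.inl v)) (T : Stk fun h => Γ (.inr h)) (v : V) (w : List (Γ (.inl v))) :
    Stk.join (update S v w) T = update (Stk.join S T) (.inl v) w := by
  refine eq_update_iff.2 ⟨update_self .., fun k hk => ?_⟩
  rcases k with k | k
  · exact update_of_ne (fun h => hk (congrArg _ h)) _ _
  · rfl

theorem join_update_right {V H : Type} [DecidableEq V] [DecidableEq H] {Γ : V ⊕ H → Type}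
    (S : Stk fun v => Γ (.inl v)) (T : Stk fun h => Γ (.inr h)) (v : H) (w : List (Γ (.inr v))) :
    Stk.join S (update T v w) = update (Stk.join S T) (.inr v) w := by
  refine eq_update_iff.2 ⟨update_self .., fun k hk => ?_⟩
  rcases k with k | k
  · rfl
  · exact update_of_ne (fun h => hk (congrArg _ h)) _ _

/-- A program fragment: a machine with visible stacks `Γ`, and with further stacks that are empty
at the beginning and at the end. -/
structure Frag {V : Type} (Γ : V → Type) where
  H : Type
  [decH : DecidableEq H]
  [finH : Fintype H]
  Δ : H → Type
  Λ : Type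
  [finΛ : Fintype Λ]
  main : Λ
  σ : Type
  [finσ : Fintype σ]
  v₀ : σ
  m : Λ → Stmt (SumFam Γ Δ) Λ σ

namespace Frag

attribute [instance] Frag.decH Frag.finH Frag.finΛ Frag.finσ

variable {V : Type} [DecidableEq V] {Γ : V → Type}

/-- The fragment transforms the visible stacks from `S` to `S'` in `t` steps. -/
def Runs (A : Frag Γ) (t : ℕ) (S S' : Stk Γ) : Prop :=
  Steps A.m ⟨some A.main, A.v₀, Stk.join S Stk.nil⟩ t ⟨none, A.v₀, Stk.join S' Stk.nil⟩

theorem Runs.size_le [Fintype V] {A : Frag Γ} {t : ℕ} {S S' : Stk Γ} (h : A.Runs t S S') :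
    S'.size ≤ S.size + (∑ l, pushes (A.m l)) * t := by
  simpa using Steps.size_le h

/-- The fragment that does nothing. -/
def skip (Γ : V → Type) : Frag Γ where
  H := Empty
  Δ := fun _ => Empty
  Λ := Unit
  main := ()
  σ := Unit
  v₀ := ()
  m := fun _ => .halt

/-- The fragment with a single statement. -/
def single (σ : Type) [Fintype σ] (v₀ : σ) (s : Stmt (SumFam Γ (fun _ : Empty => Empty)) Unit σ) :
    Frag Γ where
  H := Empty
  Δ := fun _ => Empty
  Λ := Unit
  main := ()
  σ := σ
  v₀ := v₀
  m := fun _ => s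

variable (A B : Frag Γ)

/-- The stacks of the first of two combined fragments. -/
def embL : Embed (SumFam Γ A.Δ) (SumFam Γ (SumFam A.Δ B.Δ)) A.σ (A.σ × B.σ × Bool) where
  ι := Sum.map id .inl
  en | .inl _, a => a
     | .inr _, a => a
  de | .inl _, a => a
     | .inr _, a => a
  de_en k a := by cases k <;> rfl
  get := fun v => v.1
  st := fun v => (v, B.v₀, false)
  get_st _ := rfl

/-- The stacks of the second of two combined fragments. -/
def embR : Embed (SumFam Γ B.Δ) (SumFam Γ (SumFam A.Δ B.Δ)) B.σ (A.σ × B.σ × Bool) where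
  ι := Sum.map id .inr
  en | .inl _, a => a
     | .inr _, a => a
  de | .inl _, a => a
     | .inr _, a => a
  de_en k a := by cases k <;> rfl
  get := fun v => v.2.1
  st := fun v => (A.v₀, v, false)
  get_st _ := rfl

/-- Stack contents of the first fragment within the combined one. -/
def stkL (S : Stk (SumFam Γ A.Δ)) : Stk (SumFam Γ (SumFam A.Δ B.Δ))
  | .inl v => S (.inl v)
  | .inr (.inl h) => S (.inr h)
  | .inr (.inr _) => []

/-- Stack contents of the second fragment within the combined one. -/
def stkR (S : Stk (SumFam Γ B.Δ)) : Stk (SumFam Γ (SumFam A.Δ B.Δ))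
  | .inl v => S (.inl v)
  | .inr (.inl _) => []
  | .inr (.inr h) => S (.inr h)

theorem compatL : (embL A B).Compat (stkL A B) where
  get S k := by
    rcases k with k | k <;> exact (List.map_id _).symm
  upd S k w := by
    rcases k with k | k <;> refine eq_update_iff.2 ⟨?_, fun k' hk => ?_⟩
    · exact (update_self (f := S) _ _).trans (List.map_id w).symm
    · rcases k' with k' | k' | k'
      · exact update_of_ne (f := S) (fun h => hk (by cases h; rfl)) _
      · exact update_of_ne (f := S) (fun h => by cases h) _
      · rfl
    · exact (update_self (f := S) _ _).trans (List.map_id w).symm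
    · rcases k' with k' | k' | k'
      · exact update_of_ne (f := S) (fun h => by cases h) _
      · exact update_of_ne (f := S) (fun h => hk (by cases h; rfl)) _
      · rfl

theorem compatR : (embR A B).Compat (stkR A B) where
  get S k := by
    rcases k with k | k <;> exact (List.map_id _).symm
  upd S k w := by
    rcases k with k | k <;> refine eq_update_iff.2 ⟨?_, fun k' hk => ?_⟩
    · exact (update_self (f := S) _ _).trans (List.map_id w).symm
    · rcases k' with k' | k' | k'
      · exact update_of_ne (f := S) (fun h => hk (by cases h; rfl)) _
      · rfl
      · exact update_of_ne (f := S) (fun h => by cases h) _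
    · exact (update_self (f := S) _ _).trans (List.map_id w).symm
    · rcases k' with k' | k' | k'
      · exact update_of_ne (f := S) (fun h => by cases h) _
      · rfl
      · exact update_of_ne (f := S) (fun h => hk (by cases h; rfl)) _

omit [DecidableEq V] in
theorem stkL_join (S : Stk Γ) : stkL A B (Stk.join S Stk.nil) = Stk.join S Stk.nil := by
  funext k; rcases k with k | k | k <;> rfl

omit [DecidableEq V] in
theorem stkR_join (S : Stk Γ) : stkR A B (Stk.join S Stk.nil) = Stk.join S Stk.nil := by
  funext k; rcases k with k | k | k <;> rfl

/-- The label of a combined fragment at which a stack is inspected is `none`. -/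
abbrev CombLabel : Type := Option (A.Λ ⊕ B.Λ)

/-- The statements of a combined fragment. -/
abbrev CombStmt : Type :=
  Stmt (SumFam Γ (SumFam A.Δ B.Δ)) (CombLabel A B) (A.σ × B.σ × Bool)

/-- The combination of two fragments, with header statement `hd`, and with statement `ex` executed
at the end of the first fragment. -/
def comb (main : CombLabel A B) (hd ex : CombStmt A B) : Frag Γ where
  H := A.H ⊕ B.H
  Δ := SumFam A.Δ B.Δ
  Λ := CombLabel A B
  main := main
  σ := A.σ × B.σ × Bool
  v₀ := (A.v₀, B.v₀, false)
  m | none => hd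
    | some (.inl l) => (embL A B).lift (fun l => some (.inl l)) ex (A.m l)
    | some (.inr l) => (embR A B).lift (fun l => some (.inr l)) .halt (B.m l)

variable {A B} {main : CombLabel A B} {hd ex : CombStmt A B}

/-- A run of a fragment ends in its initial internal state and with empty hidden stacks. Hence `ex`
starts from a clean configuration, and the same fragment can be entered again later, as in a loop.
-/
theorem comb_left {t : ℕ} {S S' : Stk Γ} (h : A.Runs t S S') :
    Steps (comb A B main hd ex).m
      ⟨some (some (.inl A.main)), (A.v₀, B.v₀, false), Stk.join S Stk.nil⟩ t
      (stepAux ex (A.v₀, B.v₀, false) (Stk.join S' Stk.nil)) := by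
  have := Embed.steps_lift (compatL A B) (fl := fun l => some (.inl l)) (ex := ex)
    (m' := (comb A B main hd ex).m) (fun l => rfl) h
  simp only [Embed.liftCfg, stkL_join] at this
  exact this

theorem comb_right {t : ℕ} {S S' : Stk Γ} (h : B.Runs t S S') :
    Steps (comb A B main hd ex).m
      ⟨some (some (.inr B.main)), (A.v₀, B.v₀, false), Stk.join S Stk.nil⟩ t
      ⟨none, (A.v₀, B.v₀, false), Stk.join S' Stk.nil⟩ := by
  have := Embed.steps_lift (compatR A B) (fl := fun l => some (.inr l)) (ex := .halt)
    (m' := (comb A B main hd ex).m) (fun l => rfl) h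
  simp only [Embed.liftCfg, stkR_join] at this
  exact this

/-- Sequential composition. -/
def seq (A B : Frag Γ) : Frag Γ :=
  comb A B (some (.inl A.main)) .halt (.goto fun _ => some (.inr B.main))

theorem Runs.seq {t t' : ℕ} {S S' S'' : Stk Γ} (h : A.Runs t S S') (h' : B.Runs t' S' S'') :
    (A.seq B).Runs (t + t') S S'' :=
  (comb_left h).trans (comb_right h')

/-- A header statement that inspects stack `k`. -/
def test (A B : Frag Γ) (k : V) (c : Option (Γ k) → Bool) (q : CombStmt A B) : CombStmt A B :=
  .peek (.inl k) (fun v o => (v.1, v.2.1, c o)) <| .branch (fun v => v.2.2)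
    (.load (fun v => (v.1, v.2.1, false)) (.goto fun _ => some (.inl A.main)))
    (.load (fun v => (v.1, v.2.1, false)) q)

/-- The flag that stores the outcome is reset after branching, so that the test leaves no trace. -/
theorem stepAux_test_true {k : V} {c : Option (Γ k) → Bool} {q : CombStmt A B} {S : Stk Γ}
    (hc : c (S k).head? = true) :
    stepAux (test A B k c q) (A.v₀, B.v₀, false) (Stk.join S Stk.nil) =
      ⟨some (some (.inl A.main)), (A.v₀, B.v₀, false), Stk.join S Stk.nil⟩ := by
  simp [test, hc]

theorem stepAux_test_false {k : V} {c : Option (Γ k) → Bool} {q : CombStmt A B} {S : Stk Γ}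
    (hc : c (S k).head? = false) :
    stepAux (test A B k c q) (A.v₀, B.v₀, false) (Stk.join S Stk.nil) =
      stepAux q (A.v₀, B.v₀, false) (Stk.join S Stk.nil) := by
  simp [test, hc]

/-- Case distinction on the topmost symbol of a stack. -/
def ite (A B : Frag Γ) (k : V) (c : Option (Γ k) → Bool) : Frag Γ :=
  comb A B none (test A B k c (.goto fun _ => some (.inr B.main))) .halt

theorem Runs.ite_true {k : V} {c : Option (Γ k) → Bool} {t : ℕ} {S S' : Stk Γ}
    (hc : c (S k).head? = true) (h : A.Runs t S S') : (A.ite B k c).Runs (t + 1) S S' := by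
  refine .head (l := none) ?_
  exact (stepAux_test_true (B := B) hc).symm ▸ comb_left h

theorem Runs.ite_false {k : V} {c : Option (Γ k) → Bool} {t : ℕ} {S S' : Stk Γ}
    (hc : c (S k).head? = false) (h : B.Runs t S S') : (A.ite B k c).Runs (t + 1) S S' := by
  refine .head (l := none) ?_
  exact (stepAux_test_false (A := A) hc).symm ▸ comb_right h

/-- Iteration as long as the topmost symbol of a stack satisfies a condition. -/
def loop (A : Frag Γ) (k : V) (c : Option (Γ k) → Bool) : Frag Γ :=
  comb A (skip Γ) none (test A (skip Γ) k c .halt) (.goto fun _ => none)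

theorem Runs.loop_false {k : V} {c : Option (Γ k) → Bool} {S : Stk Γ}
    (hc : c (S k).head? = false) : (A.loop k c).Runs 1 S S := by
  refine .head (l := none) ?_
  exact (stepAux_test_false (A := A) (B := skip Γ) hc).symm ▸ .refl _

/-- At the end of the body the control returns to the header, from which the remaining iterations
are again a run of the loop. -/
theorem Runs.loop_true {k : V} {c : Option (Γ k) → Bool} {t t' : ℕ} {S S' S'' : Stk Γ}
    (hc : c (S k).head? = true) (h : A.Runs t S S') (h' : (A.loop k c).Runs t' S' S'') :
    (A.loop k c).Runs (t + 1 + t') S S'' := by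
  rw [Nat.add_right_comm]
  refine .head (l := none) ?_
  exact (stepAux_test_true (A := A) (B := skip Γ) hc).symm ▸ (comb_left h).trans h'

end Frag

/-! ### Adding and hiding stacks -/

namespace Frag

variable {V : Type} [DecidableEq V] {W : Type} [DecidableEq W]

section

variable {Γ : W ⊕ V → Type}

/-- The stacks of a fragment that runs next to further stacks. -/
def embFrame (A : Frag fun v => Γ (.inr v)) :
    Embed (SumFam (fun v => Γ (.inr v)) A.Δ) (SumFam Γ A.Δ) A.σ A.σ where
  ι := Sum.map .inr id
  en | .inl _, a => a
     | .inr _, a => a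
  de | .inl _, a => a
     | .inr _, a => a
  de_en k a := by cases k <;> rfl
  get := id
  st := id
  get_st _ := rfl

/-- The contents of the stacks of a fragment that runs next to further stacks. -/
def stkFrame (A : Frag fun v => Γ (.inr v)) (T : Stk fun w => Γ (.inl w))
    (S : Stk (SumFam (fun v => Γ (.inr v)) A.Δ)) : Stk (SumFam Γ A.Δ)
  | .inl (.inl w) => T w
  | .inl (.inr v) => S (.inl v)
  | .inr h => S (.inr h)

theorem compatFrame (A : Frag fun v => Γ (.inr v)) (T : Stk fun w => Γ (.inl w)) :
    (embFrame A).Compat (stkFrame A T) where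
  get S k := by
    rcases k with k | k <;> exact (List.map_id _).symm
  upd S k w := by
    rcases k with k | k <;> refine eq_update_iff.2 ⟨?_, fun k' hk => ?_⟩
    · exact (update_self (f := S) _ _).trans (List.map_id w).symm
    · rcases k' with (k' | k') | k'
      · rfl
      · exact update_of_ne (f := S) (fun h => hk (by cases h; rfl)) _
      · exact update_of_ne (f := S) (fun h => by cases h) _
    · exact (update_self (f := S) _ _).trans (List.map_id w).symm
    · rcases k' with (k' | k') | k'
      · rfl
      · exact update_of_ne (f := S) (fun h => by cases h) _
      · exact update_of_ne (f := S) (fun h => hk (by cases h; rfl)) _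

/-- A fragment that runs next to further stacks. -/
def frame (A : Frag fun v => Γ (.inr v)) : Frag Γ where
  H := A.H
  Δ := A.Δ
  Λ := A.Λ
  main := A.main
  σ := A.σ
  v₀ := A.v₀
  m l := (embFrame A).lift id .halt (A.m l)

theorem Runs.frame {A : Frag fun v => Γ (.inr v)} {t : ℕ} {S S' : Stk fun v => Γ (.inr v)}
    (h : A.Runs t S S') (T : Stk fun w => Γ (.inl w)) :
    (A.frame).Runs t (Stk.join T S) (Stk.join T S') := by
  have hj : ∀ S : Stk fun v => Γ (.inr v), stkFrame A T (Stk.join S Stk.nil) = Stk.join (Stk.join T S) Stk.nil := by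
    intro S; funext k; rcases k with (k | k) | k <;> rfl
  have := Embed.steps_lift (compatFrame A T) (fl := id) (ex := .halt)
    (m' := (A.frame).m) (fun l => rfl) h
  simp only [Embed.liftCfg, hj] at this
  exact this

end

section

variable {Γ : V ⊕ W → Type}

/-- The stacks of a fragment some of whose visible stacks become hidden. -/
def embHide (A : Frag Γ) :
    Embed (SumFam Γ A.Δ) (SumFam (fun v => Γ (.inl v)) (SumFam (fun w => Γ (.inr w)) A.Δ)) A.σ A.σ where
  ι | .inl (.inl v) => .inl v
    | .inl (.inr w) => .inr (.inl w)
    | .inr h => .inr (.inr h)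
  en | .inl (.inl _), a => a
     | .inl (.inr _), a => a
     | .inr _, a => a
  de | .inl (.inl _), a => a
     | .inl (.inr _), a => a
     | .inr _, a => a
  de_en k a := by rcases k with (k | k) | k <;> rfl
  get := id
  st := id
  get_st _ := rfl

/-- The contents of the stacks of a fragment some of whose visible stacks become hidden. -/
def stkHide (A : Frag Γ) (S : Stk (SumFam Γ A.Δ)) :
    Stk (SumFam (fun v => Γ (.inl v)) (SumFam (fun w => Γ (.inr w)) A.Δ))
  | .inl v => S (.inl (.inl v))
  | .inr (.inl w) => S (.inl (.inr w))
  | .inr (.inr h) => S (.inr h)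

theorem compatHide (A : Frag Γ) : (embHide A).Compat (stkHide A) where
  get S k := by
    rcases k with (k | k) | k <;> exact (List.map_id _).symm
  upd S k w := by
    rcases k with (k | k) | k <;> refine eq_update_iff.2 ⟨?_, fun k' hk => ?_⟩
    all_goals first
      | exact (update_self (f := S) _ _).trans (List.map_id w).symm
      | rcases k' with k' | k' | k'
        all_goals exact update_of_ne (f := S) (fun h => by cases h <;> exact hk rfl) _

/-- The fragment obtained by hiding stacks. -/
def hide (A : Frag Γ) [Fintype W] : Frag fun v => Γ (.inl v) where
  H := W ⊕ A.H
  Δ := SumFam (fun w => Γ (.inr w)) A.Δ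
  Λ := A.Λ
  main := A.main
  σ := A.σ
  v₀ := A.v₀
  m l := (embHide A).lift id .halt (A.m l)

theorem Runs.hide [Fintype W] {A : Frag Γ} {t : ℕ} {S S' : Stk fun v => Γ (.inl v)}
    (h : A.Runs t (Stk.join S Stk.nil) (Stk.join S' Stk.nil)) : A.hide.Runs t S S' := by
  have hj : ∀ S : Stk fun v => Γ (.inl v), stkHide A (Stk.join (Stk.join S Stk.nil) Stk.nil) =
      Stk.join (Γ := SumFam (fun v => Γ (.inl v)) (SumFam (fun w => Γ (.inr w)) A.Δ))
        S Stk.nil := by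
    intro S; funext k; rcases k with k | k | k <;> rfl
  have := Embed.steps_lift (compatHide A) (fl := id) (ex := .halt)
    (m' := A.hide.m) (fun l => rfl) h
  simp only [Embed.liftCfg, hj] at this
  exact this

end

end Frag

/-! ### Polynomial-time operations on stacks -/

theorem eval_mono (P : Polynomial ℕ) {m n : ℕ} (h : m ≤ n) : P.eval m ≤ P.eval n := by
  induction P using Polynomial.induction_on' with
  | add p q hp hq => simp only [Polynomial.eval_add]; omega
  | monomial d a =>
    simp only [Polynomial.eval_monomial]
    exact Nat.mul_le_mul_left _ (Nat.pow_le_pow_left h _)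

section PolyOp

variable {V : Type} [DecidableEq V] [Fintype V] {Γ : V → Type} {α β : Type}

/-- There is a program fragment that transforms `e a` into `e' a`, for all `a`, within a number of
steps that is polynomial in the size of `e a`. -/
def PolyOp (e e' : α → Stk Γ) : Prop :=
  ∃ (A : Frag Γ) (P : Polynomial ℕ), ∀ a, ∃ t ≤ P.eval (e a).size, A.Runs t (e a) (e' a)

namespace PolyOp

theorem congr {e e' f f' : α → Stk Γ} (h : PolyOp e e') (he : ∀ a, e a = f a)
    (he' : ∀ a, e' a = f' a) : PolyOp f f' := by
  rwa [← funext he, ← funext he']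

theorem reindex {e e' : α → Stk Γ} (h : PolyOp e e') (r : β → α) :
    PolyOp (fun b => e (r b)) (fun b => e' (r b)) :=
  h.imp fun _ => .imp fun _ h b => h (r b)

/-- An operation on all stack contents can be applied to any family of stack contents. -/
theorem apply {F : Stk Γ → Stk Γ} (h : PolyOp id F) (e : α → Stk Γ) :
    PolyOp e (fun a => F (e a)) :=
  h.reindex e

theorem skip (e : α → Stk Γ) : PolyOp e e :=
  ⟨.skip Γ, 1, fun _ => ⟨1, by simp, .head (.refl _)⟩⟩

theorem of_stmt {e e' : α → Stk Γ} (σ : Type) [Fintype σ] (v₀ : σ)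
    (s : Stmt (SumFam Γ (fun _ : Empty => Empty)) Unit σ)
    (h : ∀ a, stepAux s v₀ (Stk.join (e a) Stk.nil) = ⟨none, v₀, Stk.join (e' a) Stk.nil⟩) :
    PolyOp e e' := by
  refine ⟨.single σ v₀ s, 1, fun a => ⟨1, by simp, .head ?_⟩⟩
  exact (h a).symm ▸ .refl _

theorem push (e : α → Stk Γ) (k : V) (b : Γ k) :
    PolyOp e (fun a => update (e a) k (b :: e a k)) :=
  of_stmt Unit () (.push (.inl k) (fun _ => b) .halt) fun a => by
    rw [stepAux, stepAux, join_update_left]; rfl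

theorem pop (e : α → Stk Γ) (k : V) :
    PolyOp e (fun a => update (e a) k (e a k).tail) :=
  of_stmt Unit () (.pop (.inl k) (fun _ _ => ()) .halt) fun a => by
    rw [stepAux, stepAux, join_update_left]; rfl

/-- The second program runs on stacks that the first one may have enlarged. By `Runs.size_le` their
size is at most `X + C * P`, and the second time bound is composed with this polynomial. -/
theorem seq {e e' e'' : α → Stk Γ} (h : PolyOp e e') (h' : PolyOp e' e'') : PolyOp e e'' := by
  obtain ⟨A, P, hA⟩ := h
  obtain ⟨B, Q, hB⟩ := h'
  refine ⟨A.seq B, P + Q.comp (.X + .C (∑ l, pushes (A.m l)) * P), fun a => ?_⟩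
  obtain ⟨t, ht, h⟩ := hA a
  obtain ⟨t', ht', h'⟩ := hB a
  refine ⟨t + t', ?_, h.seq h'⟩
  simp only [Polynomial.eval_add, Polynomial.eval_comp, Polynomial.eval_mul, Polynomial.eval_X,
    Polynomial.eval_C]
  refine Nat.add_le_add ht (ht'.trans (eval_mono _ (h.size_le.trans ?_)))
  exact Nat.add_le_add_left (Nat.mul_le_mul_left _ ht) _

/-- Each branch has to be correct only on the arguments that lead to it, hence the subtypes. -/
theorem ite {e e' : α → Stk Γ} (k : V) (c : Option (Γ k) → Bool)
    (h : PolyOp (fun a : {a // c (e a k).head? = true} => e a) (fun a => e' a))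
    (h' : PolyOp (fun a : {a // c (e a k).head? = false} => e a) (fun a => e' a)) :
    PolyOp e e' := by
  obtain ⟨A, P, hA⟩ := h
  obtain ⟨B, Q, hB⟩ := h'
  refine ⟨A.ite B k c, P + Q + 1, fun a => ?_⟩
  simp only [Polynomial.eval_add, Polynomial.eval_one]
  cases hc : c (e a k).head? with
  | true =>
    obtain ⟨t, ht, h⟩ := hA ⟨a, hc⟩
    exact ⟨t + 1, by simp only at ht; omega, h.ite_true hc⟩
  | false =>
    obtain ⟨t, ht, h⟩ := hB ⟨a, hc⟩
    exact ⟨t + 1, by simp only at ht; omega, h.ite_false hc⟩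

/-- Iteration. The number of iterations is bounded by `μ`, and `Φ` is a polynomially bounded
potential, which bounds the size of the stack contents and does not increase. -/
theorem loop {e : α → Stk Γ} (k : V) (c : Option (Γ k) → Bool) (next fin : α → α) (μ Φ : α → ℕ)
    (Q : Polynomial ℕ) (hΦ : ∀ a, Φ a ≤ Q.eval (e a).size) (hμ : ∀ a, μ a ≤ Φ a)
    (hs : ∀ a, (e a).size ≤ Φ a)
    (h : PolyOp (fun a : {a // c (e a k).head? = true} => e a) (fun a => e (next a)))
    (hnext : ∀ a, c (e a k).head? = true →
      μ (next a) < μ a ∧ Φ (next a) ≤ Φ a ∧ fin (next a) = fin a)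
    (hfin : ∀ a, c (e a k).head? = false → fin a = a) :
    PolyOp e (fun a => e (fin a)) := by
  obtain ⟨A, P, hA⟩ := h
  -- At most `n` iterations remain, each costing at most `P.eval (Φ a) + 1` steps including its
  -- test; the bound for the first iteration serves for all of them because `Φ` does not increase.
  -- The last summand is the failing test.
  have key : ∀ n a, μ a ≤ n →
      ∃ t ≤ n * (P.eval (Φ a) + 1) + 1, (A.loop k c).Runs t (e a) (e (fin a)) := by
    intro n
    induction n with
    | zero =>
      intro a ha
      have hc : c (e a k).head? = false := by
        by_contra hc
        have := (hnext a (by simpa using hc)).1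
        omega
      exact ⟨1, by omega, by rw [hfin a hc]; exact .loop_false hc⟩
    | succ n ih =>
      intro a ha
      cases hc : c (e a k).head? with
      | false => exact ⟨1, by omega, by rw [hfin a hc]; exact .loop_false hc⟩
      | true =>
        obtain ⟨h1, h2, h3⟩ := hnext a hc
        obtain ⟨t, ht, hr⟩ := hA ⟨a, hc⟩
        obtain ⟨t', ht', hr'⟩ := ih (next a) (by omega)
        refine ⟨t + 1 + t', ?_, .loop_true hc hr (h3 ▸ hr')⟩
        have h4 : t ≤ P.eval (Φ a) := ht.trans (eval_mono P (hs a))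
        have h5 := Nat.mul_le_mul_left n (Nat.add_le_add_right (eval_mono P h2) 1)
        rw [Nat.add_one_mul]
        omega
  refine ⟨A.loop k c, Q * (P.comp Q + 1) + 1, fun a => ?_⟩
  obtain ⟨t, ht, hr⟩ := key (μ a) a le_rfl
  refine ⟨t, ht.trans ?_, hr⟩
  simp only [Polynomial.eval_add, Polynomial.eval_mul, Polynomial.eval_comp, Polynomial.eval_one]
  exact Nat.add_le_add_right (Nat.mul_le_mul ((hμ a).trans (hΦ a))
    (Nat.add_le_add_right (eval_mono P (hΦ a)) 1)) 1

variable {W : Type} [DecidableEq W] [Fintype W]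

theorem frame {Γ : W ⊕ V → Type} {e e' : α → Stk fun v => Γ (.inr v)} (h : PolyOp e e')
    (T : α → Stk fun w => Γ (.inl w)) :
    PolyOp (Γ := Γ) (fun a => Stk.join (T a) (e a)) (fun a => Stk.join (T a) (e' a)) := by
  obtain ⟨A, P, hA⟩ := h
  refine ⟨A.frame, P, fun a => ?_⟩
  obtain ⟨t, ht, hr⟩ := hA a
  exact ⟨t, ht.trans (eval_mono P (by simp)), hr.frame _⟩

theorem hide {Γ : V ⊕ W → Type} {e e' : α → Stk fun v => Γ (.inl v)}
    (h : PolyOp (Γ := Γ) (fun a => Stk.join (e a) Stk.nil) (fun a => Stk.join (e' a) Stk.nil)) :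
    PolyOp e e' := by
  obtain ⟨A, P, hA⟩ := h
  refine ⟨A.hide, P, fun a => ?_⟩
  obtain ⟨t, ht, hr⟩ := hA a
  exact ⟨t, by simpa using ht, hr.hide⟩

end PolyOp

end PolyOp

end ClusterComputing

namespace ClusterComputing

open Turing Turing.TM2 Function

/-! ### Clearing, moving and copying stacks -/

namespace PolyOp

variable {V : Type} [DecidableEq V] [Fintype V] {Γ : V → Type} {α : Type}

theorem clear (k : V) : PolyOp (Γ := Γ) id (fun S => update S k []) := by
  refine loop (e := id) k Option.isSome (fun S => update S k (S k).tail) (fun S => update S k [])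
    (fun S => (S k).length) Stk.size .X (fun _ => by simp) (fun S => length_le_size S k)
    (fun _ => le_rfl) (pop (fun S : {S : Stk Γ // _} => S.1) k) (fun S hS => ?_) (fun S hS => ?_)
  · have h := size_update S k (S k).tail
    simp only [id] at hS
    cases hk : S k with
    | nil => simp [hk] at hS
    | cons a w =>
      simp only [hk, List.length_cons, List.tail_cons] at h ⊢
      exact ⟨by simp, by omega, by simp⟩
  · have : S k = [] := by simpa using hS
    exact this ▸ update_eq_self k S

theorem clearAll (l : List V) :
    PolyOp (Γ := Γ) id (fun S v => if v ∈ l then [] else S v) := by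
  induction l with
  | nil => exact (skip id).congr (fun _ => rfl) (fun S => by simp)
  | cons k l ih =>
    refine (ih.seq ((clear k).apply _)).congr (fun _ => rfl) fun S => ?_
    funext v
    rcases eq_or_ne v k with rfl | h <;> simp [*]

/-- Moving a symbol from one stack to another one. -/
theorem popPush {i j : V} (hij : i ≠ j) [Fintype (Γ j)] [Nonempty (Γ j)] (τ : Γ i → Γ j) :
    PolyOp (Γ := Γ) (fun S : {S : Stk Γ // Option.isSome (S i).head? = true} => S.1)
      (fun S => update (update S.1 i (S.1 i).tail) j ((S.1 i).head?.toList.map τ ++ S.1 j)) := by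
  -- The moved symbol is kept in the internal state, which is why its alphabet has to be finite. The
  -- default symbol is never pushed, the source stack being nonempty.
  refine of_stmt (Option (Γ j)) none (.pop (.inl i) (fun _ o => o.map τ)
    (.push (.inl j) (fun v => v.getD (Classical.arbitrary _)) (.load (fun _ => none) .halt)))
    fun ⟨S, hS⟩ => ?_
  obtain ⟨a, ha⟩ := Option.isSome_iff_exists.1 hS
  have h1 : Stk.join (Γ := SumFam Γ fun _ : Empty => Empty) S Stk.nil (.inl i) = S i := rfl
  simp only [stepAux, h1, ha]
  rw [← join_update_left, ← join_update_left]
  simp only [Stk.join_inl, update_of_ne hij.symm]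
  rfl

/-- Moving the content of a stack to another one, in reversed order. -/
theorem transfer {i j : V} (hij : i ≠ j) [Fintype (Γ j)] [Nonempty (Γ j)] (τ : Γ i → Γ j) :
    PolyOp (Γ := Γ) id (fun S => update (update S i []) j (((S i).map τ).reverse ++ S j)) := by
  refine loop (e := id) i Option.isSome
    (fun S => update (update S i (S i).tail) j ((S i).head?.toList.map τ ++ S j))
    (fun S => update (update S i []) j (((S i).map τ).reverse ++ S j))
    (fun S => (S i).length) Stk.size .X (fun _ => by simp) (fun S => length_le_size S i)
    (fun _ => le_rfl) (popPush hij τ) (fun S hS => ?_) (fun S hS => ?_)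
  · have h := size_update S i (S i).tail
    have h' := size_update (update S i (S i).tail) j ((S i).head?.toList.map τ ++ S j)
    simp only [id] at hS
    cases hk : S i with
    | nil => simp [hk] at hS
    | cons a w =>
      simp only [hk, List.length_cons, List.tail_cons, List.length_append, update_of_ne hij.symm,
        List.head?_cons, Option.toList_some, List.map_cons, List.map_nil, List.length_nil] at h h' ⊢
      refine ⟨by simp [hij], by omega, ?_⟩
      funext k
      rcases eq_or_ne k j with rfl | hk
      · simp [hij]
      · rcases eq_or_ne k i with rfl | hk' <;> simp [*]
  · have : S i = [] := by simpa using hS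
    funext k
    rcases eq_or_ne k j with rfl | hk
    · simp [this]
    · rcases eq_or_ne k i with rfl | hk' <;> simp [*]

/-- Moving the content of a stack to two other ones, in reversed order. -/
theorem dup {i j k : V} (hij : i ≠ j) (hik : i ≠ k) (hjk : j ≠ k) :
    PolyOp (Γ := fun _ => Bool) id (fun S : V → Str => update (update (update S i []) j
      ((S i).reverse ++ S j)) k ((S i).reverse ++ S k)) := by
  refine loop (e := id) i Option.isSome
    (fun S : V → Str => update (update (update S i (S i).tail) j ((S i).head?.toList ++ S j)) k
      ((S i).head?.toList ++ S k))
    (fun S : V → Str => update (update (update S i []) j ((S i).reverse ++ S j)) k ((S i).reverse ++ S k))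
    -- Every symbol of stack `i` becomes two symbols, so the potential counts this stack twice.
    (fun S => (S i).length) (fun S => S.size + (S i).length) (2 * .X)
    (fun S => by have := length_le_size S i; simp; omega)
    (fun S => Nat.le_add_left _ _) (fun _ => Nat.le_add_right _ _) ?_ (fun S hS => ?_)
    (fun S hS => ?_)
  · refine of_stmt Bool false (.pop (.inl i) (fun _ o => o.getD false) (.push (.inl j) (fun v => v)
      (.push (.inl k) (fun v => v) (.load (fun _ => false) .halt)))) fun ⟨S, hS⟩ => ?_
    obtain ⟨a, ha⟩ := Option.isSome_iff_exists.1 hS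
    simp only [stepAux]
    rw [← join_update_left, ← join_update_left, ← join_update_left]
    simp only [Stk.join_inl, update_of_ne hij.symm, update_of_ne hik.symm, update_of_ne hjk.symm, ha]
    simp only [id] at ha
    simp only [ha]
    rfl
  · have h := size_update S i (S i).tail
    have h' := size_update (update S i (S i).tail) j ((S i).head?.toList ++ S j)
    have h'' := size_update (update (update S i (S i).tail) j ((S i).head?.toList ++ S j)) k
      ((S i).head?.toList ++ S k)
    simp only [id] at hS
    cases hk : S i with
    | nil => simp [hk] at hS
    | cons a w =>
      simp only [hk, List.length_cons, List.tail_cons, List.length_append, update_of_ne hij.symm,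
        update_of_ne hik.symm, update_of_ne hjk.symm, update_of_ne hij, update_of_ne hik,
        List.head?_cons, Option.toList_some, List.length_nil, update_self] at h h' h'' ⊢
      refine ⟨by simp, by omega, ?_⟩
      funext l
      rcases eq_or_ne l k with rfl | hk
      · simp [*]
      rcases eq_or_ne l j with rfl | hk
      · simp [*]
      · rcases eq_or_ne l i with rfl | hk' <;> simp [*]
  · have : S i = [] := by simpa using hS
    funext l
    rcases eq_or_ne l k with rfl | hk
    · simp [this]
    rcases eq_or_ne l j with rfl | hk
    · simp [*]
    · rcases eq_or_ne l i with rfl | hk' <;> simp [*]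

/-- Copying a stack onto another one. -/
theorem copy {i j : V} (hij : i ≠ j) :
    PolyOp (Γ := fun _ : V => Bool) id (fun S => update S j (S i ++ S j)) := by
  -- The source is reversed onto a hidden stack; emptying that stack onto both `i` and `j` restores
  -- the source and its order.
  refine hide (W := Unit) (Γ := fun _ => Bool) ?_
  have h1 := transfer (Γ := fun _ : V ⊕ Unit => Bool) (i := .inl i) (j := .inr ()) (by simp) id
  have h2 := dup (i := Sum.inr ()) (j := (Sum.inl i : V ⊕ Unit)) (k := .inl j) (by simp) (by simp)
    (by simpa using hij)
  refine ((h1.seq (h2.apply _)).apply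
    (fun S : V → Str => Stk.join (Γ := fun _ => Bool) S Stk.nil)).congr (fun _ => rfl) fun S => ?_
  funext l
  rcases l with l | l
  · rcases eq_or_ne l j with rfl | hk
    · simp [hij.symm]
    · rcases eq_or_ne l i with rfl | hk' <;> simp [*]
  · simp

end PolyOp


/-! ### Polynomial-time functions of several strings -/

section PT

variable {ι κ : Type}

/-- `f` is computable in polynomial time: next to any other stacks, a program can put `f S` onto an
empty stack, where `S` is the content of given stacks, which are left as they are. -/
def PT (f : (ι → Str) → Str) : Prop :=
  ∀ (V : Type) [DecidableEq V] [Fintype V] (r : ι → V) (o : V), (∀ i, r i ≠ o) →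
    PolyOp (Γ := fun _ : V => Bool) (fun S : {S : V → Str // S o = []} => S.1)
      (fun S => update S.1 o (f fun i => S.1 (r i)))

/-- A polynomial-time predicate. -/
def PTb (P : (ι → Str) → Bool) : Prop := PT fun S => [P S]

theorem PT.var (i : ι) : PT fun S => S i := fun V _ _ r o h =>
  ((PolyOp.copy (h i)).apply fun S : {S : V → Str // S o = []} => S.1).congr (fun _ => rfl)
    fun S => by simp [S.2]

theorem PT.const (w : Str) : PT fun _ : ι → Str => w := by
  intro V _ _ r o h
  induction w with
  | nil =>
    exact (PolyOp.skip fun S : {S : V → Str // S o = []} => S.1).congr (fun _ => rfl)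
      fun S => (update_eq_self_iff.2 S.2.symm).symm
  | cons b w ih => exact (ih.seq (PolyOp.push _ o b)).congr (fun _ => rfl) fun S => by simp

/-- The intermediate values are put onto hidden stacks, one for each argument of `g`. They are
cleared at the end, since hidden stacks must be left empty. -/
theorem PT.comp [DecidableEq κ] [Fintype κ] {g : (κ → Str) → Str} {f : κ → (ι → Str) → Str}
    (hg : PT g) (hf : ∀ k, PT (f k)) : PT fun S => g fun k => f k S := by
  intro V _ _ r o h
  refine PolyOp.hide (W := κ) (Γ := fun _ => Bool) ?_
  have h1 : ∀ l : List κ, l.Nodup → PolyOp (Γ := fun _ : V ⊕ κ => Bool)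
      (fun S : {S : V → Str // S o = []} => Stk.join S.1 Stk.nil)
      (fun S => Stk.join S.1 fun k => if k ∈ l then f k (fun i => S.1 (r i)) else []) := by
    intro l
    induction l with
    | nil =>
      intro _
      exact (PolyOp.skip _).congr (fun _ => rfl) fun S => by simp; rfl
    | cons k l ih =>
      intro hl
      have h2 := (hf k (V ⊕ κ) (fun i => .inl (r i)) (.inr k) (by simp)).reindex
        (fun S : {S : V → Str // S o = []} => ⟨Stk.join (Γ := fun _ => Bool) S.1
          fun k => if k ∈ l then f k (fun i => S.1 (r i)) else [],
          by simp [(List.nodup_cons.1 hl).1]⟩)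
      refine ((ih (List.nodup_cons.1 hl).2).seq h2).congr (fun _ => rfl) fun S => ?_
      funext v
      rcases v with v | v
      · simp
      · rcases eq_or_ne v k with rfl | hk <;> simp [*]
  have h2 := (hg (V ⊕ κ) (fun k => .inr k) (.inl o) (by simp)).reindex
    (fun S : {S : V → Str // S o = []} => ⟨Stk.join (Γ := fun _ => Bool) S.1
      fun k => f k (fun i => S.1 (r i)), by simp [S.2]⟩)
  have h3 := PolyOp.clearAll (Γ := fun _ : V ⊕ κ => Bool) (Finset.univ.toList.map Sum.inr)
  refine (((h1 Finset.univ.toList (Finset.nodup_toList _)).congr (fun _ => rfl)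
    (fun S => by simp)).seq (h2.seq (h3.apply _))).congr (fun _ => rfl) fun S => ?_
  funext v
  rcases v with v | v
  · rcases eq_or_ne v o with rfl | hv <;> simp [*]
  · simp

/-- An operation on finitely many stacks, some of which contain the arguments, whereas the other
ones are empty at the beginning, gives polynomial-time functions. -/
theorem PT.of_op {V₀ : Type} [DecidableEq V₀] [Fintype V₀] (q : V₀ → Option κ)
    {F : (κ → Str) → V₀ → Str} (hF : PolyOp (Γ := fun _ : V₀ => Bool)
      (fun (S : κ → Str) v => (q v).elim [] S) F) (j : V₀) : PT fun S => F S j := by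
  intro V _ _ r o h
  refine PolyOp.hide (W := V₀) (Γ := fun _ => Bool) ?_
  -- The operation may destroy its arguments, so it works on hidden copies of them.
  have h1 : ∀ l : List V₀, l.Nodup → PolyOp (Γ := fun _ : V ⊕ V₀ => Bool)
      (fun S : {S : V → Str // S o = []} => Stk.join S.1 Stk.nil)
      (fun S => Stk.join S.1
        fun v => if v ∈ l then (q v).elim [] (fun i => S.1 (r i)) else []) := by
    intro l
    induction l with
    | nil =>
      intro _
      exact (PolyOp.skip _).congr (fun _ => rfl) fun S => by simp; rfl
    | cons v l ih =>
      intro hl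
      cases hv : q v with
      | none =>
        refine (ih (List.nodup_cons.1 hl).2).congr (fun _ => rfl) fun S => ?_
        funext w
        rcases w with w | w
        · simp
        · rcases eq_or_ne w v with rfl | hk <;> simp [*]
      | some i =>
        have h2 := PolyOp.copy (i := (.inl (r i) : V ⊕ V₀)) (j := .inr v) (by simp)
        refine ((ih (List.nodup_cons.1 hl).2).seq (h2.apply _)).congr (fun _ => rfl) fun S => ?_
        funext w
        rcases w with w | w
        · simp
        · rcases eq_or_ne w v with rfl | hk
          · simp [*, (List.nodup_cons.1 hl).1]
          · simp [*]
  have h2 := (hF.reindex (fun (S : {S : V → Str // S o = []}) i => S.1 (r i))).frame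
    (Γ := fun _ : V ⊕ V₀ => Bool) (fun S => S.1)
  have h3 := PolyOp.copy (i := (.inr j : V ⊕ V₀)) (j := .inl o) (by simp)
  have h4 := PolyOp.clearAll (Γ := fun _ : V ⊕ V₀ => Bool) (Finset.univ.toList.map Sum.inr)
  refine (((h1 Finset.univ.toList (Finset.nodup_toList _)).congr (fun _ => rfl)
    (fun S => by simp)).seq (h2.seq ((h3.apply _).seq (h4.apply _)))).congr (fun _ => rfl)
    fun S => ?_
  funext v
  rcases v with v | v
  · rcases eq_or_ne v o with rfl | hv <;> simp [S.2, *]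
  · simp

end PT

end ClusterComputing

namespace ClusterComputing

open Turing Turing.TM2 Function

section

variable {ι : Type}

theorem PT.congr {f g : (ι → Str) → Str} (h : PT f) (hfg : ∀ S, f S = g S) : PT g := by
  rwa [← funext hfg]

theorem PTb.congr {P Q : (ι → Str) → Bool} (h : PTb P) (hPQ : ∀ S, P S = Q S) : PTb Q := by
  rwa [← funext hPQ]

theorem PT.comp₁ {g : Str → Str} (hg : PT fun S : Fin 1 → Str => g (S 0)) {f : (ι → Str) → Str}
    (hf : PT f) : PT fun S => g (f S) :=
  hg.comp (f := ![f]) (by simpa [Fin.forall_fin_succ])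

theorem PT.comp₂ {g : Str → Str → Str} (hg : PT fun S : Fin 2 → Str => g (S 0) (S 1))
    {f f' : (ι → Str) → Str} (hf : PT f) (hf' : PT f') : PT fun S => g (f S) (f' S) :=
  hg.comp (f := ![f, f']) (by simp [Fin.forall_fin_succ, hf, hf'])

theorem PT.comp₃ {g : Str → Str → Str → Str}
    (hg : PT fun S : Fin 3 → Str => g (S 0) (S 1) (S 2)) {f f' f'' : (ι → Str) → Str}
    (hf : PT f) (hf' : PT f') (hf'' : PT f'') : PT fun S => g (f S) (f' S) (f'' S) :=
  hg.comp (f := ![f, f', f'']) (by simp [Fin.forall_fin_succ, hf, hf', hf''])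

/-! ### Elementary functions -/

theorem PT.reverse {f : (ι → Str) → Str} (hf : PT f) : PT fun S => (f S).reverse :=
  PT.comp₁ (g := List.reverse) ((PT.of_op (V₀ := Fin 2) (κ := Fin 1) ![some 0, none]
    ((PolyOp.transfer (Γ := fun _ => Bool) (i := 0) (j := 1) (by simp) id).apply _) 1).congr
    fun S => by simp) hf

theorem PT.tail {f : (ι → Str) → Str} (hf : PT f) : PT fun S => (f S).tail :=
  PT.comp₁ (g := List.tail) ((PT.of_op (V₀ := Fin 1) (κ := Fin 1) some
    (PolyOp.pop (Γ := fun _ => Bool) _ 0) 0).congr fun S => by simp) hf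

theorem PT.replicate {f : (ι → Str) → Str} (hf : PT f) (b : Bool) :
    PT fun S => List.replicate (f S).length b :=
  PT.comp₁ (g := fun w => List.replicate w.length b)
    ((PT.of_op (V₀ := Fin 2) (κ := Fin 1) ![some 0, none]
    ((PolyOp.transfer (Γ := fun _ => Bool) (i := 0) (j := 1) (by simp) fun _ => b).apply _) 1).congr
    fun S => by simp [List.map_const']) hf

end

/-! ### Finite automata that read two strings -/

section scan

variable {τ : Type}

/-- The state of an automaton after reading two strings simultaneously. -/
def scan (δ : τ → Option Bool → Option Bool → τ) : τ → Str → Str → τ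
  | s, [], [] => s
  | s, [], b :: v => scan δ (δ s none (some b)) [] v
  | s, a :: u, [] => scan δ (δ s (some a) none) u []
  | s, a :: u, b :: v => scan δ (δ s (some a) (some b)) u v

variable [Fintype τ]

/-- A single pass: in each step the machine pops from both stacks, where an exhausted stack yields
`none`, and it keeps the state of the automaton in its internal state. -/
theorem PT.of_scan {ι : Type} (δ : τ → Option Bool → Option Bool → τ) (s₀ : τ) (acc : τ → Bool)
    {f g : (ι → Str) → Str} (hf : PT f) (hg : PT g) :
    PTb fun S => acc (scan δ s₀ (f S) (g S)) := by
  refine PT.comp₂ (g := fun u v => [acc (scan δ s₀ u v)]) ?_ hf hg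
  refine (PT.of_op (V₀ := Fin 3) (κ := Fin 2) ![some 0, some 1, none]
    (F := fun S => ![[], [], [acc (scan δ s₀ (S 0) (S 1))]]) ?_ 2).congr
    fun S => by simp
  let A : Frag (fun _ : Fin 3 => Bool) :=
    { H := Empty
      Δ := fun _ => Empty
      Λ := Unit
      main := ()
      σ := τ × Option Bool × Option Bool
      v₀ := (s₀, none, none)
      m := fun _ => .pop (.inl 0) (fun v o => (v.1, o, v.2.2)) <|
        .pop (.inl 1) (fun v o => (v.1, v.2.1, o)) <|
        .branch (fun v => v.2.1.isNone && v.2.2.isNone)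
          (.push (.inl 2) (fun v => acc v.1) <| .load (fun _ => (s₀, none, none)) .halt)
          (.load (fun v => (δ v.1 v.2.1 v.2.2, none, none)) (.goto fun _ => ())) }
  have hj : ∀ u v w u' : Str, update (Stk.join (Γ := SumFam (fun _ : Fin 3 => Bool) A.Δ)
      ![u, v, w] Stk.nil) (.inl 0) u' = Stk.join ![u', v, w] Stk.nil := by
    intro u v w u'
    rw [← join_update_left]
    congr 1
    funext i; fin_cases i <;> rfl
  have hj' : ∀ u v w u' : Str, update (Stk.join (Γ := SumFam (fun _ : Fin 3 => Bool) A.Δ)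
      ![u, v, w] Stk.nil) (.inl 1) u' = Stk.join ![u, u', w] Stk.nil := by
    intro u v w u'
    rw [← join_update_left]
    congr 1
    funext i; fin_cases i <;> rfl
  have hj'' : ∀ u v w u' : Str, update (Stk.join (Γ := SumFam (fun _ : Fin 3 => Bool) A.Δ)
      ![u, v, w] Stk.nil) (.inl 2) u' = Stk.join ![u, v, u'] Stk.nil := by
    intro u v w u'
    rw [← join_update_left]
    congr 1
    funext i; fin_cases i <;> rfl
  have h0 : ∀ u v w : Str, Stk.join (Γ := SumFam (fun _ : Fin 3 => Bool) A.Δ)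
      ![u, v, w] Stk.nil (.inl 0) = u := fun _ _ _ => rfl
  have h1 : ∀ u v w : Str, Stk.join (Γ := SumFam (fun _ : Fin 3 => Bool) A.Δ)
      ![u, v, w] Stk.nil (.inl 1) = v := fun _ _ _ => rfl
  have h2 : ∀ u v w : Str, Stk.join (Γ := SumFam (fun _ : Fin 3 => Bool) A.Δ)
      ![u, v, w] Stk.nil (.inl 2) = w := fun _ _ _ => rfl
  have hm : ∀ u v s, stepAux (A.m ()) (s, none, none) (Stk.join ![u, v, []] Stk.nil) =
      bif u.head?.isNone && v.head?.isNone then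
        ⟨none, (s₀, none, none), Stk.join ![u.tail, v.tail, [acc s]] Stk.nil⟩
      else ⟨some (), (δ s u.head? v.head?, none, none), Stk.join ![u.tail, v.tail, []] Stk.nil⟩ := by
    intro u v s
    unfold A
    simp only [stepAux, h0, h1, h2, hj, hj', hj'']
  have key : ∀ u v s, ∃ t ≤ u.length + v.length + 1,
      Steps A.m ⟨some (), (s, none, none), Stk.join ![u, v, []] Stk.nil⟩ t
        ⟨none, (s₀, none, none), Stk.join ![[], [], [acc (scan δ s u v)]] Stk.nil⟩ := by
    intro u v s
    induction s, u, v using scan.induct δ with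
    | case1 s =>
      exact ⟨0 + 1, by simp, .head (by rw [hm, scan]; exact Steps.refl _)⟩
    | case2 s b v ih =>
      obtain ⟨t, ht, h⟩ := ih
      exact ⟨t + 1, by simp at ht ⊢; omega, .head (by rw [hm, scan]; exact h)⟩
    | case3 s a u ih =>
      obtain ⟨t, ht, h⟩ := ih
      exact ⟨t + 1, by simp at ht ⊢; omega, .head (by rw [hm, scan]; exact h)⟩
    | case4 s a u b v ih =>
      obtain ⟨t, ht, h⟩ := ih
      exact ⟨t + 1, by simp at ht ⊢; omega, .head (by rw [hm, scan]; exact h)⟩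
  refine ⟨A, .X + 1, fun S => ?_⟩
  have he : (fun v : Fin 3 => (![some 0, some 1, none] v : Option (Fin 2)).elim [] S) =
      ![S 0, S 1, []] := by
    funext i; fin_cases i <;> rfl
  obtain ⟨t, ht, h⟩ := key (S 0) (S 1) s₀
  refine ⟨t, ht.trans ?_, ?_⟩
  · simp [Stk.size, Fin.sum_univ_succ]
  · change A.Runs t (fun v : Fin 3 => (![some 0, some 1, none] v : Option (Fin 2)).elim [] S) _
    rw [he]
    exact h

/-- The state records whether all pairs read so far were equal. Different lengths are noticed
because `none` differs from every bit. -/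
theorem PT.eq {ι : Type} {f g : (ι → Str) → Str} (hf : PT f) (hg : PT g) :
    PTb fun S => decide (f S = g S) := by
  let δ : Bool → Option Bool → Option Bool → Bool := fun s x y => s && decide (x = y)
  have h : ∀ (u v : Str) (s : Bool), scan δ s u v = (s && decide (u = v)) := by
    intro u v s
    induction s, u, v using scan.induct δ <;> simp_all [scan, Bool.and_assoc, δ]
  exact PTb.congr (PT.of_scan δ true id hf hg) fun S => h _ _ _

theorem PT.all {ι : Type} {f : (ι → Str) → Str} (hf : PT f) (b : Bool) :
    PTb fun S => (f S).all (· == b) := by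
  let δ : Bool → Option Bool → Option Bool → Bool := fun s x _ => s && x == some b
  have h : ∀ (u : Str) (s : Bool), scan δ s u [] = (s && u.all (· == b)) := by
    intro u
    induction u with
    | nil => simp [scan]
    | cons a u ih => intro s; simp [scan, ih, Bool.and_assoc, δ]
  exact PTb.congr (PT.of_scan δ true id hf (PT.const [])) fun S => h _ _

theorem PT.head {ι : Type} {f : (ι → Str) → Str} (hf : PT f) :
    PTb fun S => (f S).head?.getD false := by
  let δ : Option Bool → Option Bool → Option Bool → Option Bool := fun s x _ => s.or x
  have h : ∀ (u : Str) (s : Option Bool), scan δ s u [] = s.or u.head? := by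
    intro u
    induction u with
    | nil => simp [scan]
    | cons b u ih => intro s; cases s <;> simp [scan, ih, δ]
  exact PTb.congr (PT.of_scan δ none (fun s => s.getD false) hf (PT.const []))
    fun S => by rw [h]; rfl

/-- Boolean combinations. -/
theorem PTb.bool {ι : Type} {P Q : (ι → Str) → Bool} (hP : PTb P) (hQ : PTb Q)
    (φ : Bool → Bool → Bool) : PTb fun S => φ (P S) (Q S) :=
  -- Truth values are strings with one symbol, so the automaton stops after one transition.
  (PT.of_scan (fun s x y => (x.getD false, y.getD false)) (false, false) (fun s => φ s.1 s.2)
    hP hQ).congr fun S => by simp [scan]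

theorem PTb.and {ι : Type} {P Q : (ι → Str) → Bool} (hP : PTb P) (hQ : PTb Q) :
    PTb fun S => P S && Q S := hP.bool hQ (· && ·)

theorem PTb.or {ι : Type} {P Q : (ι → Str) → Bool} (hP : PTb P) (hQ : PTb Q) :
    PTb fun S => P S || Q S := hP.bool hQ (· || ·)

theorem PTb.not {ι : Type} {P : (ι → Str) → Bool} (hP : PTb P) :
    PTb fun S => !P S := hP.bool hP fun b _ => !b

theorem PTb.cond {ι : Type} {P Q R : (ι → Str) → Bool} (hP : PTb P) (hQ : PTb Q) (hR : PTb R) :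
    PTb fun S => bif P S then Q S else R S :=
  PTb.congr ((hP.and hQ).or (hP.not.and hR)) fun S => by cases P S <;> simp

/-- `v` is the successor of `u`, as binary numbers with the least significant bit first. -/
def isSucc : Str → Str → Bool
  | false :: u, true :: v => u = v
  | true :: u, false :: v => isSucc u v
  | _, _ => false

/-- With the least significant bit first, the carry moves in the reading direction. State `none`
means that only pairs `1, 0` have been read, `some true` that the carry has been absorbed by a pair
`0, 1` and that equal bits followed, and `some false` is failure. -/
theorem PT.of_isSucc {ι : Type} {f g : (ι → Str) → Str} (hf : PT f) (hg : PT g) :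
    PTb fun S => isSucc (f S) (g S) := by
  let δ : Option Bool → Option Bool → Option Bool → Option Bool
    | none, some true, some false => none
    | none, some false, some true => some true
    | some true, x, y => some (decide (x = y))
    | _, _, _ => some false
  have h0 : ∀ u v s, s = some false → scan δ s u v = some false := by
    intro u v s
    induction s, u, v using scan.induct δ <;> simp_all [scan, δ]
  have h1 : ∀ u v s, s = some true → scan δ s u v = some (decide (u = v)) := by
    intro u v s
    induction s, u, v using scan.induct δ with
    | case1 => simp [scan]
    | case2 s b v ih => rintro rfl; simp [scan, δ, h0]
    | case3 s b v ih => rintro rfl; simp [scan, δ, h0]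
    | case4 s a u b v ih =>
      rintro rfl
      by_cases hab : a = b
      · subst hab
        simp only [scan]
        rw [ih (by simp [δ])]
        simp
      · simp only [scan]
        rw [h0 _ _ _ (by simp [δ, hab])]
        simp [hab]
  have h2 : ∀ u v, (scan δ none u v == some true) = isSucc u v := by
    intro u v
    induction u, v using isSucc.induct with
    | case1 u v => simp [scan, δ, isSucc, h1]
    | case2 u v ih => simpa [scan, δ, isSucc] using ih
    | case3 u v h h' =>
      rcases u with _ | ⟨_ | _, u⟩ <;> rcases v with _ | ⟨_ | _, v⟩ <;>
        simp_all [scan, δ, isSucc]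
  exact PTb.congr (PT.of_scan δ none (fun s => s == some true) hf hg) fun S => h2 _ _

end scan

/-! ### Polynomial clocks -/

/-- A string of length `|u| * (|v| + 2)`, computed by appending. -/
theorem PT.mul {ι : Type} {f g : (ι → Str) → Str} (hf : PT f) (hg : PT g) (b : Bool) :
    PT fun S => List.replicate ((f S).length * ((g S).length + 2)) b := by
  -- The two extra symbols per iteration turn the factor `|v|` into `|v| + 2`, a base that is at
  -- least `2` even for empty strings.
  let next : (Fin 3 → Str) → Fin 3 → Str := fun S => ![(S 0).tail, S 1, S 1 ++ b :: b :: S 2]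
  have hnext : PolyOp (Γ := fun _ : Fin 3 => Bool) id next := by
    refine ((PolyOp.pop (Γ := fun _ : Fin 3 => Bool) id 0).seq ((PolyOp.push _ 2 b).seq
      ((PolyOp.push _ 2 b).seq ((PolyOp.copy (i := (1 : Fin 3)) (j := 2) (by simp)).apply
      _)))).congr (fun _ => rfl) fun S => ?_
    funext i; fin_cases i <;> simp [next]
  let fin : (Fin 3 → Str) → Fin 3 → Str := fun S =>
    ![[], S 1, (fun w => S 1 ++ b :: b :: w)^[(S 0).length] (S 2)]
  have hsz : ∀ S : Fin 3 → Str, Stk.size (Γ := fun _ => Bool) S =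
      (S 0).length + (S 1).length + (S 2).length := by
    intro S; simp [Stk.size, Fin.sum_univ_succ]; omega
  have hloop : PolyOp (Γ := fun _ : Fin 3 => Bool) id fin := by
    refine PolyOp.loop (e := id) 0 Option.isSome next fin (fun S => (S 0).length)
      -- The potential counts in advance all symbols that are still to be pushed.
      (fun S => Stk.size (Γ := fun _ : Fin 3 => Bool) S + (S 0).length * ((S 1).length + 2))
      (.X + .X * (.X + 2)) (fun S => ?_) (fun S => ?_) (fun S => Nat.le_add_right _ _)
      (hnext.reindex Subtype.val) (fun S hS => ?_) (fun S hS => ?_)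
    · have h0 := length_le_size (Γ := fun _ : Fin 3 => Bool) S 0
      have h1 := length_le_size (Γ := fun _ : Fin 3 => Bool) S 1
      simp only [Polynomial.eval_add, Polynomial.eval_mul, Polynomial.eval_X,
        Polynomial.eval_ofNat, id]
      gcongr
    · have h0 := length_le_size (Γ := fun _ : Fin 3 => Bool) S 0
      omega
    · simp only [id] at hS
      simp only [hsz]
      cases h : S 0 with
      | nil => simp [h] at hS
      | cons a u =>
        refine ⟨by simp [next, h], ?_, by simp [fin, next, h]⟩
        simp only [next, h, List.tail_cons, Matrix.cons_val_zero, Matrix.cons_val_one,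
          Matrix.cons_val, List.length_append, List.length_cons, Nat.add_one_mul]
        omega
    · have h : S 0 = [] := by simpa using hS
      funext i; fin_cases i <;> simp [fin, h]
  have hlen : ∀ (u : Str) n, ((fun w => u ++ b :: b :: w)^[n] []).length = n * (u.length + 2) := by
    intro u n
    induction n with
    | zero => simp
    | succ n ih => rw [iterate_succ_apply']; simp [ih, Nat.add_one_mul]; omega
  refine (PT.comp₂ (g := fun u v => (fun w => v ++ b :: b :: w)^[u.length] []) ?_ hf hg).replicate
    b |>.congr fun S => by rw [hlen]
  refine (PT.of_op (V₀ := Fin 3) (κ := Fin 2) ![some 0, some 1, none] (hloop.apply _) 2).congr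
    fun S => by simp [fin]

/-- Powers of `n + 2` suffice as clocks, since they exceed every polynomial; see
`exists_eval_lt_pow`. -/
theorem PT.clock {ι : Type} {f : (ι → Str) → Str} (hf : PT f) (d : ℕ) (b : Bool) :
    PT fun S => List.replicate (((f S).length + 2) ^ d) b := by
  induction d with
  | zero => exact (PT.const [b]).congr fun S => by simp
  | succ d ih => exact (ih.mul hf b).congr fun S => by simp [pow_succ]

end ClusterComputing

namespace ClusterComputing

open Turing Turing.TM2 Function

/-! ### Simulating nondeterministic machines -/

instance fintypeStacks (tm : FinTM2) : Fintype tm.K := tm.kFin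

instance fintypeInput (tm : FinTM2) : Fintype (tm.Γ tm.k₀) := tm.Γk₀Fin

/-- `Follows g w r`: reading the bits `w` from the string `g` leaves `r`; zeros are read when `g` is
exhausted. -/
inductive Follows : Str → Str → Str → Prop
  | nil (g) : Follows g [] g
  | cons {g w r} : Follows g.tail w r → Follows g (g.head?.getD false :: w) r

/-- Default zeros are read only after `g` is exhausted, which does not happen for at most `g.length`
bits. -/
theorem Follows.append_eq {g w r : Str} (h : Follows g w r) (hw : w.length ≤ g.length) :
    w ++ r = g := by
  induction h with
  | nil => rfl
  | @cons g w r _ ih =>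
    cases g with
    | nil => simp at hw
    | cons a g => simpa using ih (by simpa using hw)

namespace NTM

variable {N : NTM}

theorem Run.length_le {c c' : N.Cfg} {w : Str} {t : ℕ} (h : N.Run c w t c') : w.length ≤ t := by
  induction h with
  | refl => simp
  | det _ _ ih => omega
  | guess_zero _ _ ih => simpa using ih
  | guess_one _ _ ih => simpa using ih

/-- A halting computation determines every computation with compatible guesses. -/
theorem Run.determined {c c' c₁ : N.Cfg} {w w₁ : Str} {t t₁ : ℕ} (h : N.Run c w t c')
    (hc' : c'.l = none) (h₁ : N.Run c w₁ t₁ c₁) (hw : w <+: w₁ ∨ w₁ <+: w) :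
    t₁ ≤ t ∧ w₁ <+: w ∧ (c₁.l = none → c₁ = c' ∧ w₁ = w) := by
  induction h generalizing w₁ t₁ with
  | refl c =>
    cases h₁ with
    | refl => simp
    | det => simp at hc'
    | guess_zero => simp at hc'
    | guess_one => simp at hc'
  | det hl h ih =>
    cases h₁ with
    | refl => simp
    | det hl' h' => simpa using ih hc' h' hw
    | guess_zero hl' => simp [hl] at hl'
    | guess_one hl' => simp [hl] at hl'
  | guess_zero hl h ih =>
    cases h₁ with
    | refl => simp
    | det hl' => simp [hl] at hl'
    | guess_zero hl' h' => simpa using ih hc' h' (by simpa using hw)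
    -- Runs that differ in their first guess are excluded by the prefix condition.
    | guess_one hl' h' => simp at hw
  | guess_one hl h ih =>
    cases h₁ with
    | refl => simp
    | det hl' => simp [hl] at hl'
    | guess_zero hl' h' => simp at hw
    | guess_one hl' h' =>
      obtain rfl := Option.some_injective _ (hl.symm.trans hl')
      simpa using ih hc' h' (by simpa using hw)

/-- The guesses are taken from `g`, and the machine is run until it halts or the budget of `n` steps
is used up. -/
theorem exists_run_aux (n : ℕ) (c : N.Cfg) (g : Str) :
    ∃ w r t c', N.Run c w t c' ∧ Follows g w r ∧ (t = n ∨ c'.l = none) := by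
  induction n generalizing c g with
  | zero => exact ⟨[], g, 0, c, .refl _, .nil _, .inl rfl⟩
  | succ n ih =>
    obtain ⟨_ | l, v, S⟩ := c
    · exact ⟨[], g, 0, _, .refl _, .nil _, .inr rfl⟩
    cases hl : N.alt l with
    | none =>
      obtain ⟨w, r, t, c', h1, h2, h3⟩ := ih (stepAux (N.tm.m l) v S) g
      exact ⟨w, r, t + 1, c', .det hl h1, h2, h3.imp_left (by omega)⟩
    | some s =>
      cases hg : g.head?.getD false with
      | false =>
        obtain ⟨w, r, t, c', h1, h2, h3⟩ := ih (stepAux (N.tm.m l) v S) g.tail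
        exact ⟨_, r, t + 1, c', .guess_zero hl h1, hg ▸ .cons h2, h3.imp_left (by omega)⟩
      | true =>
        obtain ⟨w, r, t, c', h1, h2, h3⟩ := ih (stepAux s v S) g.tail
        exact ⟨_, r, t + 1, c', .guess_one hl h1, hg ▸ .cons h2, h3.imp_left (by omega)⟩

theorem IsNPTM.exists_run (hN : N.IsNPTM) (x g : Str) :
    ∃ w r t c', N.Run (N.init x) w t c' ∧ Follows g w r ∧ c'.l = none := by
  obtain ⟨P, hP⟩ := hN
  -- A budget of one step more than the time bound cannot be used up, so the run halts.
  obtain ⟨w, r, t, c', h1, h2, h3⟩ := exists_run_aux (P.eval x.length + 1) (N.init x) g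
  refine ⟨w, r, t, c', h1, h2, h3.resolve_left fun h => ?_⟩
  have := hP _ _ _ _ h1
  omega

theorem init_stk (x : Str) :
    (N.init x).stk = update Stk.nil N.tm.k₀ (x.map N.inputAlphabet.symm) := by
  refine eq_update_iff.2 ⟨by simp [init, initList], fun k hk => by simp [init, initList, hk]⟩

variable (N)

/-- The stacks of the simulating fragment: the reversed input, the string of guesses, the reversed
computation path, a flag, the reversed output, and the stacks of the simulated machine. -/
abbrev simFam : Fin 5 ⊕ N.tm.K → Type := SumFam (fun _ => Bool) N.tm.Γ

/-- The stacks and the states of the simulated machine. -/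
def simEmbed : Embed N.tm.Γ (SumFam N.simFam fun _ : Empty => Empty) N.tm.σ (N.tm.σ × Bool) where
  ι k := .inl (.inr k)
  en _ a := a
  de _ a := a
  de_en _ _ := rfl
  get v := v.1
  st v := (v, false)
  get_st _ := rfl

/-- The contents of the stacks of the simulating fragment. -/
def simStk (T : Fin 5 → Str) (S : Stk N.tm.Γ) : Stk (SumFam N.simFam fun _ : Empty => Empty) :=
  Stk.join (Stk.join (Γ := N.simFam) T S) Stk.nil

theorem simCompat (T : Fin 5 → Str) : N.simEmbed.Compat (N.simStk T) where
  get S k := (List.map_id _).symm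
  upd S k w := by
    change _ = update _ (Sum.inl (Sum.inr k)) _
    rw [simStk, join_update_right (Γ := N.simFam), join_update_left]
    congr 1
    exact (List.map_id w).symm

/-- The final statement of the simulating fragment. -/
def simExit : Stmt (SumFam N.simFam fun _ : Empty => Empty) N.tm.Λ (N.tm.σ × Bool) :=
  .push (.inl (.inl 3)) (fun v => N.accept v.1) <|
    .load (fun _ => (N.tm.initialState, false)) .halt

/-- The fragment that simulates the machine on given guesses. -/
def simFrag : Frag N.simFam where
  H := Empty
  Δ := fun _ => Empty
  Λ := N.tm.Λ
  finΛ := N.tm.ΛFin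
  main := N.tm.main
  σ := N.tm.σ × Bool
  finσ := @instFintypeProd _ _ N.tm.σFin _
  v₀ := (N.tm.initialState, false)
  m l := match N.alt l with
    | none => N.simEmbed.lift id N.simExit (N.tm.m l)
    | some s =>
      .pop (.inl (.inl 1)) (fun v o => (v.1, o.getD false)) <|
      .push (.inl (.inl 2)) (fun v => v.2) <|
      .branch (fun v => v.2)
        (.load (fun v => (v.1, false)) (N.simEmbed.lift id N.simExit s))
        (.load (fun v => (v.1, false)) (N.simEmbed.lift id N.simExit (N.tm.m l)))

theorem update_simStk (T : Fin 5 → Str) (S : Stk N.tm.Γ) (i : Fin 5) (w : Str) :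
    update (N.simStk T S) (.inl (.inl i)) w = N.simStk (update T i w) S := by
  unfold simStk
  rw [join_update_left (Γ := N.simFam), join_update_left]

variable {N}

/-- Each step of the machine is simulated by one step, a guess being replaced by popping a bit from
the string `g`. The bits are recorded on a stack, so the path appears in reverse. -/
theorem Run.simulate {c c' : N.Cfg} {w : Str} {t : ℕ} (h : N.Run c w t c') {g r : Str}
    (hg : Follows g w r) (u : Str) :
    Steps N.simFrag.m (N.simEmbed.liftCfg id N.simExit (N.simStk ![[], g, u, [], []]) c) t
      (N.simEmbed.liftCfg id N.simExit (N.simStk ![[], r, w.reverse ++ u, [], []]) c') := by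
  have key : ∀ (l : N.tm.Λ) (s) (v : N.tm.σ) (S : Stk N.tm.Γ) (g u : Str), N.alt l = some s →
      stepAux (N.simFrag.m l) (v, false) (N.simStk ![[], g, u, [], []] S) =
        bif g.head?.getD false then
          N.simEmbed.liftCfg id N.simExit (N.simStk ![[], g.tail, true :: u, [], []])
            (stepAux s v S)
        else N.simEmbed.liftCfg id N.simExit (N.simStk ![[], g.tail, false :: u, [], []])
            (stepAux (N.tm.m l) v S) := by
    intro l s v S g u hl
    have h1 : ∀ g' : Str, update (![[], g, u, [], []] : Fin 5 → Str) 1 g' =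
        ![[], g', u, [], []] := by
      intro g'; funext i; fin_cases i <;> rfl
    have h2 : ∀ g' u' : Str, update (![[], g', u, [], []] : Fin 5 → Str) 2 u' =
        ![[], g', u', [], []] := by
      intro g' u'; funext i; fin_cases i <;> rfl
    have hm : N.simFrag.m l = .pop (.inl (.inl 1)) (fun v o => (v.1, o.getD false)) (
      .push (.inl (.inl 2)) (fun v => v.2) <|
      .branch (fun v => v.2)
        (.load (fun v => (v.1, false)) (N.simEmbed.lift id N.simExit s))
        (.load (fun v => (v.1, false)) (N.simEmbed.lift id N.simExit (N.tm.m l)))) := by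
      simp [simFrag, hl]
    rw [hm]
    change (bif g.head?.getD false then
        stepAux (N.simEmbed.lift id N.simExit s) (N.simEmbed.st v)
          (update (update (N.simStk ![[], g, u, [], []] S) (.inl (.inl 1)) g.tail) (.inl (.inl 2))
            (g.head?.getD false :: u))
      else stepAux (N.simEmbed.lift id N.simExit (N.tm.m l)) (N.simEmbed.st v)
          (update (update (N.simStk ![[], g, u, [], []] S) (.inl (.inl 1)) g.tail) (.inl (.inl 2))
            (g.head?.getD false :: u))) = _
    rw [update_simStk, update_simStk, h1, h2, Embed.stepAux_lift (N.simCompat _),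
      Embed.stepAux_lift (N.simCompat _)]
    cases g.head?.getD false <;> rfl
  induction h generalizing g u with
  | refl =>
    cases hg
    exact .refl _
  | @det l v S w t c hl h ih =>
    refine .head (l := l) ?_
    have : N.simFrag.m l = N.simEmbed.lift id N.simExit (N.tm.m l) := by simp [simFrag, hl]
    rw [this]
    exact (Embed.stepAux_lift (N.simCompat _) id N.simExit (N.tm.m l) v S) ▸ ih hg u
  | @guess_zero l s v S w t c hl h ih =>
    generalize hw : false :: w = w' at hg
    cases hg with
    | nil => simp at hw
    | cons hg =>
      obtain ⟨hb, rfl⟩ := List.cons_eq_cons.1 hw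
      refine .head (l := l) ?_
      have := ih hg (false :: u)
      rw [List.reverse_cons, List.append_assoc]
      rw [← hb]
      exact (key l s v S g u hl).symm ▸ hb ▸ this
  | @guess_one l s v S w t c hl h ih =>
    generalize hw : true :: w = w' at hg
    cases hg with
    | nil => simp at hw
    | cons hg =>
      obtain ⟨hb, rfl⟩ := List.cons_eq_cons.1 hw
      refine .head (l := l) ?_
      have := ih hg (true :: u)
      rw [List.reverse_cons, List.append_assoc]
      rw [← hb]
      exact (key l s v S g u hl).symm ▸ hb ▸ this

/-- Simulation of a polynomial-time machine: there are polynomial-time functions that, given an input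
and a string of guesses, compute the remaining guesses, the computation path, whether it is
accepting, and the output. -/
theorem IsNPTM.exists_simulation (hN : N.IsNPTM) :
    ∃ (rest path out : Str → Str → Str) (acc : Str → Str → Bool),
      (∀ x g, ∃ t c, N.Run (N.init x) (path x g) t c ∧ c.l = none ∧
        Follows g (path x g) (rest x g) ∧ acc x g = N.accept c.var ∧
        out x g = (c.stk N.tm.k₁).map N.outputAlphabet) ∧
      (PT fun S : Fin 2 → Str => rest (S 0) (S 1)) ∧
      (PT fun S : Fin 2 → Str => path (S 0) (S 1)) ∧
      (PT fun S : Fin 2 → Str => out (S 0) (S 1)) ∧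
      (PTb fun S : Fin 2 → Str => acc (S 0) (S 1)) := by
  choose path rest T C h1 h2 h3 using hN.exists_run
  let out : Str → Str → Str := fun x g => ((C x g).stk N.tm.k₁).map N.outputAlphabet
  let acc : Str → Str → Bool := fun x g => N.accept (C x g).var
  refine ⟨rest, path, out, acc, fun x g => ⟨T x g, C x g, h1 x g, h3 x g, h2 x g, rfl, rfl⟩, ?_⟩
  have hrun : PolyOp (Γ := N.simFam)
      (fun a : Str × Str => Stk.join ![[], a.2, [], [], []] (N.init a.1).stk)
      (fun a => Stk.join ![[], rest a.1 a.2, (path a.1 a.2).reverse, [acc a.1 a.2], []]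
        (C a.1 a.2).stk) := by
    obtain ⟨P, hP⟩ := hN
    refine ⟨N.simFrag, P, fun a => ⟨T a.1 a.2, (hP _ _ _ _ (h1 a.1 a.2)).trans (eval_mono P ?_), ?_⟩⟩
    · have := size_update (Stk.nil : Stk N.tm.Γ) N.tm.k₀ (a.1.map N.inputAlphabet.symm)
      rw [size_join, init_stk]
      simp at this ⊢
      omega
    · have := (h1 a.1 a.2).simulate (h2 a.1 a.2) []
      rw [List.append_nil] at this
      have h4 : N.simEmbed.liftCfg id N.simExit (N.simStk ![[], rest a.1 a.2,
          (path a.1 a.2).reverse, [], []]) (C a.1 a.2) = ⟨none, (N.tm.initialState, false),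
          Stk.join (Stk.join (Γ := N.simFam) ![[], rest a.1 a.2, (path a.1 a.2).reverse,
            [acc a.1 a.2], []] (C a.1 a.2).stk) Stk.nil⟩ := by
        unfold Embed.liftCfg
        rw [h3]
        change Cfg.mk none _ (update (N.simStk _ _) (.inl (.inl 3)) _) = _
        rw [update_simStk]
        congr 3
        funext i; fin_cases i <;> rfl
      exact (congrArg (Steps N.simFrag.m _ (T a.1 a.2)) h4).mp this
  -- Moving a string to another stack reverses it. The input is therefore supplied in reverse, and
  -- path and output are reversed once more at the end.
  have hop : PolyOp (Γ := fun _ : Fin 5 => Bool)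
      (fun (S : Fin 2 → Str) i =>
        ((![some 0, some 1, none, none, none] : Fin 5 → Option (Fin 2)) i).elim [] S)
      (fun S => ![[], rest (S 0).reverse (S 1), (path (S 0).reverse (S 1)).reverse,
        [acc (S 0).reverse (S 1)], (out (S 0).reverse (S 1)).reverse]) := by
    refine PolyOp.hide (Γ := N.simFam) ?_
    have : Nonempty (N.tm.Γ N.tm.k₀) := ⟨N.inputAlphabet.symm true⟩
    have s1 := PolyOp.transfer (Γ := N.simFam) (i := .inl 0) (j := .inr N.tm.k₀) (by simp)
      N.inputAlphabet.symm
    have s2 := hrun.reindex fun S : Fin 2 → Str => ((S 0).reverse, S 1)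
    have s3 := PolyOp.transfer (Γ := N.simFam) (i := .inr N.tm.k₁) (j := .inl 4) (by simp)
      N.outputAlphabet
    -- A nondeterministic machine may halt with arbitrary contents on its stacks, whereas hidden
    -- stacks must end empty.
    have s4 := PolyOp.clearAll (Γ := N.simFam) (Finset.univ.toList.map Sum.inr)
    refine (((s1.apply _).congr (fun _ => rfl) fun S => ?_).seq
      (s2.seq ((s3.apply _).seq (s4.apply _)))).congr (fun _ => rfl) fun S => ?_
    · rw [init_stk]
      funext k
      rcases k with i | k
      · fin_cases i <;> simp
      · rcases eq_or_ne k N.tm.k₀ with rfl | hk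
        · simp [List.map_reverse]
        · simp [hk]
    · funext k
      rcases k with i | k
      · fin_cases i <;> simp [out]
      · simp
  have hin : PT fun S : Fin 2 → Str => (S 0).reverse := (PT.var 0).reverse
  have hop' := fun j => PT.of_op _ hop j
  refine ⟨?_, ?_, ?_, ?_⟩
  · exact (PT.comp₂ (g := fun u v => rest u.reverse v) (hop' 1) hin (PT.var 1)).congr fun S => by
      rw [List.reverse_reverse]
  · exact (PT.comp₂ (g := fun u v => (path u.reverse v).reverse) (hop' 2) hin
      (PT.var 1)).reverse.congr fun S => by simp
  · exact (PT.comp₂ (g := fun u v => (out u.reverse v).reverse) (hop' 4) hin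
      (PT.var 1)).reverse.congr fun S => by simp
  · exact (PT.comp₂ (g := fun u v => [acc u.reverse v]) (hop' 3) hin
      (PT.var 1)).congr fun S => by simp

end NTM

end ClusterComputing

namespace ClusterComputing

open Turing Turing.TM2 Function

/-! ### Polynomial-time machines with prescribed input and output -/

/-- The iterated form is the one in which `TM2ComputableInPolyTime` expresses computations. -/
theorem steps_iff_iterate {K : Type} [DecidableEq K] {Γ : K → Type} {Λ σ : Type}
    {m : Λ → Stmt Γ Λ σ} {c c' : Cfg Γ Λ σ} {n : ℕ} :
    Steps m c n c' ↔ (flip bind (step m))^[n] (some c) = some c' := by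
  constructor
  · intro h
    induction h with
    | refl => rfl
    | head _ ih => exact ih
  · induction n generalizing c with
    | zero =>
      intro h
      obtain rfl : c = c' := by simpa using h
      exact .refl _
    | succ n ih =>
      intro h
      obtain ⟨_ | l, v, S⟩ := c
      · have : ∀ n, (flip bind (step m))^[n] none = none := by
          intro n
          induction n with
          | zero => rfl
          | succ n ih => rw [iterate_succ_apply]; exact ih
        rw [iterate_succ_apply] at h
        exact absurd ((this n).symm.trans h) (by simp)
      · exact .head (ih h)

theorem initList_eq (tm : FinTM2) (s : List (tm.Γ tm.k₀)) :
    initList tm s = ⟨some tm.main, tm.initialState, update Stk.nil tm.k₀ s⟩ :=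
  congrArg (Cfg.mk _ _)
    (eq_update_iff.2 ⟨by simp, fun k hk => by simp [hk]⟩)

theorem haltList_eq (tm : FinTM2) (s : List (tm.Γ tm.k₁)) :
    haltList tm s = ⟨none, tm.initialState, update Stk.nil tm.k₁ s⟩ :=
  congrArg (Cfg.mk _ _)
    (eq_update_iff.2 ⟨by simp, fun k hk => by simp [hk]⟩)

/-- The stacks and the states of a machine, seen as a fragment. -/
def machineEmbed (tm : FinTM2) :
    Embed tm.Γ (SumFam tm.Γ fun _ : Empty => Empty) tm.σ tm.σ where
  ι := .inl
  en _ a := a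
  de _ a := a
  de_en _ _ := rfl
  get v := v
  st v := v
  get_st _ := rfl

/-- A machine, seen as a fragment all of whose stacks are visible. -/
def machineFrag (tm : FinTM2) : Frag tm.Γ where
  H := Empty
  Δ := fun _ => Empty
  Λ := tm.Λ
  finΛ := tm.ΛFin
  main := tm.main
  σ := tm.σ
  finσ := tm.σFin
  v₀ := tm.initialState
  m l := (machineEmbed tm).lift id .halt (tm.m l)

/-- Such a machine halts in its initial state with nothing but the output on its stacks, exactly as
is required of a fragment. It can be used as a subprogram without changes. -/
theorem machine_polyOp {α β A B : Type} {ea : α → List A} {eb : β → List B} {f : α → β}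
    (M : TM2ComputableInPolyTime ea eb f) :
    PolyOp (Γ := M.tm.Γ)
      (fun a => update Stk.nil M.tm.k₀ ((ea a).map M.inputAlphabet.symm))
      (fun a => update Stk.nil M.tm.k₁ ((eb (f a)).map M.outputAlphabet.symm)) := by
  refine ⟨machineFrag M.tm, M.time, fun a => ⟨(M.outputsFun a).steps,
    (M.outputsFun a).steps_le_m.trans (eval_mono _ ?_), ?_⟩⟩
  · have := size_update (Stk.nil : Stk M.tm.Γ) M.tm.k₀ ((ea a).map M.inputAlphabet.symm)
    simp only [size_nil, Stk.nil_apply, List.length_nil, List.length_map, Nat.zero_add,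
      Nat.add_zero] at this
    exact this.ge
  · have h : Steps M.tm.m (initList M.tm ((ea a).map M.inputAlphabet.symm)) _
      (haltList M.tm ((eb (f a)).map M.outputAlphabet.symm)) :=
        steps_iff_iterate.2 (M.outputsFun a).evals_in_steps
    rw [initList_eq, haltList_eq] at h
    have hL : (machineEmbed M.tm).Compat fun S => Stk.join S Stk.nil :=
      ⟨fun S k => (List.map_id _).symm, fun S k w => by
        rw [join_update_left (Γ := SumFam M.tm.Γ fun _ : Empty => Empty)]
        congr 1
        exact (List.map_id w).symm⟩
    exact Embed.steps_lift hL (fl := id) (ex := .halt) (m' := (machineFrag M.tm).m)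
      (fun l => rfl) h

/-- The arguments are moved onto the input stack with their tags, the third one first, because the
top of the stack is the beginning of the encoding. Moving reverses them, so they are reversed
beforehand. -/
theorem PolyTimePred.ptb {prec : Str → Str → Str → Bool} (h : PolyTimePred prec) {ι : Type}
    {f g k : (ι → Str) → Str} (hf : PT f) (hg : PT g) (hk : PT k) :
    PTb fun S => prec (f S) (g S) (k S) := by
  obtain ⟨M⟩ := h
  have hop : PolyOp (Γ := fun _ : Fin 4 => Bool)
      (fun (S : Fin 3 → Str) i =>
        ((![some 0, some 1, some 2, none] : Fin 4 → Option (Fin 3)) i).elim [] S)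
      (fun S => ![[], [], [], [prec (S 0).reverse (S 1).reverse (S 2).reverse]]) := by
    refine PolyOp.hide (Γ := SumFam (fun _ => Bool) M.tm.Γ) ?_
    have : Nonempty (M.tm.Γ M.tm.k₀) := ⟨M.inputAlphabet.symm (.inl true)⟩
    have s1 := PolyOp.transfer (Γ := SumFam (fun _ : Fin 4 => Bool) M.tm.Γ) (i := .inl 2)
      (j := .inr M.tm.k₀) (by simp) fun b => M.inputAlphabet.symm (.inr (.inr b))
    have s2 := PolyOp.transfer (Γ := SumFam (fun _ : Fin 4 => Bool) M.tm.Γ) (i := .inl 1)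
      (j := .inr M.tm.k₀) (by simp) fun b => M.inputAlphabet.symm (.inr (.inl b))
    have s3 := PolyOp.transfer (Γ := SumFam (fun _ : Fin 4 => Bool) M.tm.Γ) (i := .inl 0)
      (j := .inr M.tm.k₀) (by simp) fun b => M.inputAlphabet.symm (.inl b)
    have s4 := ((machine_polyOp M).reindex fun S : Fin 3 → Str =>
      ((S 0).reverse, (S 1).reverse, (S 2).reverse)).frame
        (Γ := SumFam (fun _ : Fin 4 => Bool) M.tm.Γ) fun _ => Stk.nil
    have s5 := PolyOp.transfer (Γ := SumFam (fun _ : Fin 4 => Bool) M.tm.Γ) (i := .inr M.tm.k₁)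
      (j := .inl 3) (by simp) M.outputAlphabet
    refine ((((s1.seq (s2.apply _)).seq (s3.apply _)).apply _).congr (fun _ => rfl) fun S => ?_).seq
      (s4.seq (s5.apply _)) |>.congr (fun _ => rfl) fun S => ?_
    · funext k
      rcases k with i | k
      · fin_cases i <;> simp
      · rcases eq_or_ne k M.tm.k₀ with rfl | hk
        · simp [encodingTriple, Computability.encodingProd, Computability.encodingList,
            List.map_reverse]
          rfl
        · simp [hk]
    · funext k
      rcases k with i | k
      · fin_cases i <;> simp [Computability.encodeBool]
      · rcases eq_or_ne k M.tm.k₁ with rfl | hk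
        · simp
        · simp [hk]
  exact (PT.comp₃ (g := fun u v w => [prec u.reverse v.reverse w.reverse]) (PT.of_op _ hop 3)
    hf.reverse hg.reverse hk.reverse).congr fun S => by simp

/-- Machines from operations. -/
theorem computable_of_polyOp {V : Type} [DecidableEq V] [Fintype V] {Γ : V → Type} (k₀ k₁ : V)
    [Fintype (Γ k₀)] {α β : Type} (ea : α → List (Γ k₀)) (eb : β → List (Γ k₁)) (f : α → β)
    (h : PolyOp (fun a => update Stk.nil k₀ (ea a)) (fun a => update Stk.nil k₁ (eb (f a)))) :
    Nonempty (TM2ComputableInPolyTime ea eb f) := by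
  obtain ⟨A, P, hA⟩ := h
  choose t ht hr using hA
  let tm : FinTM2 :=
    { K := V ⊕ A.H
      k₀ := .inl k₀
      k₁ := .inl k₁
      Γ := SumFam Γ A.Δ
      Λ := A.Λ
      main := A.main
      σ := A.σ
      initialState := A.v₀
      Γk₀Fin := inferInstanceAs (Fintype (Γ k₀))
      m := A.m }
  refine ⟨⟨⟨tm, Equiv.refl _, Equiv.refl _⟩, P, fun a => ⟨⟨t a, ?_⟩, (ht a).trans (le_of_eq ?_)⟩⟩⟩
  · refine steps_iff_iterate.1 ?_
    have h0 : initList tm ((ea a).map id) =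
        ⟨some A.main, A.v₀, Stk.join (update Stk.nil k₀ (ea a)) Stk.nil⟩ := by
      rw [initList_eq, List.map_id]
      refine congrArg (Cfg.mk _ _) ?_
      rw [join_update_left (Γ := SumFam Γ A.Δ)]
      refine congrArg (fun S : Stk (SumFam Γ A.Δ) => update S (.inl k₀) (ea a)) ?_
      funext k
      cases k <;> rfl
    have h1 : haltList tm ((eb (f a)).map id) =
        ⟨none, A.v₀, Stk.join (update Stk.nil k₁ (eb (f a))) Stk.nil⟩ := by
      rw [haltList_eq, List.map_id]
      refine congrArg (Cfg.mk _ _) ?_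
      rw [join_update_left (Γ := SumFam Γ A.Δ)]
      refine congrArg (fun S : Stk (SumFam Γ A.Δ) => update S (.inl k₁) (eb (f a))) ?_
      funext k
      cases k <;> rfl
    exact (congrArg₂ (Steps A.m · (t a) ·) h0 h1).mpr (hr a)
  · congr 1
    have := size_update (Stk.nil : Stk Γ) k₀ (ea a)
    simpa using this

/-- The program preserves its argument, but a machine has to halt with nothing but the output; so
the input stack is cleared afterwards. -/
theorem PT.fpt {g : Str → Str} (h : PT fun S : Fin 1 → Str => g (S 0)) : FPt g := by
  refine computable_of_polyOp (Γ := fun _ : Fin 2 => Bool) 0 1 _ _ g ?_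
  have s1 := (h (Fin 2) (fun _ => 0) 1 (by simp)).reindex
    fun x : Str => ⟨update Stk.nil 0 x, by simp⟩
  have s2 := PolyOp.clear (Γ := fun _ : Fin 2 => Bool) 0
  refine (s1.seq (s2.apply _)).congr (fun _ => rfl) fun x => ?_
  funext i
  fin_cases i <;> simp [Computability.encodingList]

/-- The alphabet of encoded triples. -/
abbrev Tagged : Type := Bool ⊕ (Bool ⊕ Bool)

/-- The symbol of the first component. -/
@[simp] def Tagged.fst : Tagged → Option Bool
  | .inl b => some b
  | .inr _ => none

/-- The symbol of the second component. -/
@[simp] def Tagged.snd : Tagged → Option Bool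
  | .inr (.inl b) => some b
  | _ => none

/-- The symbol of the third component. -/
@[simp] def Tagged.thd : Tagged → Option Bool
  | .inr (.inr b) => some b
  | _ => none

theorem encodingTriple_encode (a : Str × Str × Str) : encodingTriple.encode a =
    a.1.map Sum.inl ++ (a.2.1.map (fun b => Sum.inr (Sum.inl b)) ++
      a.2.2.map fun b => Sum.inr (Sum.inr b)) := by
  simp [encodingTriple, Computability.encodingProd, Computability.encodingList]
  rfl

theorem filterMap_fst_encode (a : Str × Str × Str) :
    (encodingTriple.encode a).filterMap Tagged.fst = a.1 := by
  rw [encodingTriple_encode, List.filterMap_append, List.filterMap_append, List.filterMap_map,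
    List.filterMap_map, List.filterMap_map]
  change List.filterMap some _ ++ (List.filterMap (fun _ => none) _ ++
    List.filterMap (fun _ => none) _) = _
  simp

theorem filterMap_snd_encode (a : Str × Str × Str) :
    (encodingTriple.encode a).filterMap Tagged.snd = a.2.1 := by
  rw [encodingTriple_encode, List.filterMap_append, List.filterMap_append, List.filterMap_map,
    List.filterMap_map, List.filterMap_map]
  change List.filterMap (fun _ => none) _ ++ (List.filterMap some _ ++
    List.filterMap (fun _ => none) _) = _
  simp

theorem filterMap_thd_encode (a : Str × Str × Str) :
    (encodingTriple.encode a).filterMap Tagged.thd = a.2.2 := by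
  rw [encodingTriple_encode, List.filterMap_append, List.filterMap_append, List.filterMap_map,
    List.filterMap_map, List.filterMap_map]
  change List.filterMap (fun _ => none) _ ++ (List.filterMap (fun _ => none) _ ++
    List.filterMap some _) = _
  simp

/-- Splitting an encoded triple. -/
theorem split_polyOp : PolyOp (Γ := SumFam (fun _ : Unit => Tagged) fun _ : Fin 4 => Bool)
    (fun a : List Tagged × Str × Str × Str =>
      Stk.join (fun _ => a.1) ![a.2.1, a.2.2.1, a.2.2.2, []])
    (fun a => Stk.join (fun _ => []) ![(a.1.filterMap Tagged.fst).reverse ++ a.2.1,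
      (a.1.filterMap Tagged.snd).reverse ++ a.2.2.1,
      (a.1.filterMap Tagged.thd).reverse ++ a.2.2.2, []]) := by
  have hsz : ∀ (l : List Tagged) (u v w : Str),
      Stk.size (Stk.join (Γ := SumFam (fun _ : Unit => Tagged) fun _ : Fin 4 => Bool)
        (fun _ => l) ![u, v, w, []]) = l.length + u.length + v.length + w.length := by
    intro l u v w
    rw [size_join]
    simp [Stk.size, Fin.sum_univ_succ]
    omega
  refine PolyOp.loop (.inl ()) Option.isSome
    (fun a : List Tagged × Str × Str × Str => match a with
      | (.inl b :: l, u, v, w) => (l, b :: u, v, w)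
      | (.inr (.inl b) :: l, u, v, w) => (l, u, b :: v, w)
      | (.inr (.inr b) :: l, u, v, w) => (l, u, v, b :: w)
      | ([], u, v, w) => ([], u, v, w))
    (fun a => ([], (a.1.filterMap Tagged.fst).reverse ++ a.2.1,
      (a.1.filterMap Tagged.snd).reverse ++ a.2.2.1,
      (a.1.filterMap Tagged.thd).reverse ++ a.2.2.2))
    (fun a => a.1.length) (fun a => a.1.length + a.2.1.length + a.2.2.1.length + a.2.2.2.length)
    .X (fun a => by rw [Polynomial.eval_X, hsz]) (fun a => by omega) (fun a => by rw [hsz])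
    ?_ (fun a ha => ?_) (fun a ha => ?_)
  · have hp := fun (j : Fin 4) (τ : Tagged → Bool) => PolyOp.popPush
      (Γ := SumFam (fun _ : Unit => Tagged) fun _ : Fin 4 => Bool) (i := .inl ()) (j := .inr j)
      (by simp) τ
    -- The tag of the topmost symbol selects the destination; in each branch the default `false` is
    -- irrelevant.
    refine PolyOp.ite (.inl ()) (fun o => (o.bind Tagged.fst).isSome) ?_
      (PolyOp.ite (.inl ()) (fun o => (o.bind Tagged.snd).isSome) ?_ ?_)
    · refine ((hp 0 fun t => (Tagged.fst t).getD false).reindex fun a => ⟨_, a.1.2⟩).congr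
        (fun _ => rfl) ?_
      rintro ⟨⟨⟨_ | ⟨b | b | b, l⟩, u, v, w⟩, h⟩, h'⟩ <;> simp at h h'
      funext i
      rcases i with i | i
      · simp
      · fin_cases i <;> simp
    · refine ((hp 1 fun t => (Tagged.snd t).getD false).reindex
        fun a => ⟨_, a.1.1.2⟩).congr (fun _ => rfl) ?_
      rintro ⟨⟨⟨⟨_ | ⟨b | b | b, l⟩, u, v, w⟩, h⟩, h'⟩, h''⟩ <;> simp at h h' h''
      funext i
      rcases i with i | i
      · simp
      · fin_cases i <;> simp
    · refine ((hp 2 fun t => (Tagged.thd t).getD false).reindex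
        fun a => ⟨_, a.1.1.2⟩).congr (fun _ => rfl) ?_
      rintro ⟨⟨⟨⟨_ | ⟨b | b | b, l⟩, u, v, w⟩, h⟩, h'⟩, h''⟩ <;> simp at h h' h''
      funext i
      rcases i with i | i
      · simp
      · fin_cases i <;> simp
  · obtain ⟨_ | ⟨b | b | b, l⟩, u, v, w⟩ := a
    · simp at ha
    all_goals
      refine ⟨by simp, by simp only [List.length_cons]; omega, ?_⟩
      simp [List.filterMap_cons]
  · obtain ⟨l, u, v, w⟩ := a
    have : l = [] := by simpa using ha
    simp [this]

theorem PTb.polyTimePred {P : Str → Str → Str → Bool}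
    (h : PTb fun S : Fin 3 → Str => P (S 0) (S 1) (S 2)) : PolyTimePred P := by
  let Γ : Unit ⊕ Fin 4 → Type := SumFam (fun _ : Unit => Tagged) fun _ : Fin 4 => Bool
  refine computable_of_polyOp (Γ := Γ) (.inl ()) (.inr 3) _ _ _ ?_
  have h' : PTb fun S : Fin 3 → Str => P (S 0).reverse (S 1).reverse (S 2).reverse :=
    PT.comp₃ (g := fun u v w => [P u v w]) h (PT.var 0).reverse (PT.var 1).reverse
      (PT.var 2).reverse
  have s1 := split_polyOp.reindex fun a : Str × Str × Str => (encodingTriple.encode a, [], [], [])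
  have s2 := ((h' (Fin 4) ![0, 1, 2] 3 (by simp [Fin.forall_fin_succ])).reindex
    fun a : Str × Str × Str => ⟨![a.1.reverse, a.2.1.reverse, a.2.2.reverse, []], rfl⟩).frame
      (Γ := Γ) fun _ _ => []
  have s3 := PolyOp.clearAll (Γ := Γ) [.inr 0, .inr 1, .inr 2]
  refine ((s1.congr (fun a => ?_) (fun a => ?_)).seq (s2.seq (s3.apply _))).congr
    (fun _ => rfl) fun a => ?_
  · funext i
    rcases i with i | i
    · simp
    · fin_cases i <;> simp
  · funext i
    rcases i with i | i
    · simp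
    · fin_cases i <;>
        simp [filterMap_fst_encode, filterMap_snd_encode, filterMap_thd_encode]
  · funext i
    rcases i with i | i
    · simp
    · fin_cases i <;> simp [Computability.encodeBool]

end ClusterComputing

namespace ClusterComputing

open Turing Turing.TM2 Function

/-! ### Balanced machines that guess a string and evaluate a predicate -/

theorem NTM.Run.trans {N : NTM} {c c' c'' : N.Cfg} {w w' : Str} {t t' : ℕ} (h : N.Run c w t c')
    (h' : N.Run c' w' t' c'') : N.Run c (w ++ w') (t + t') c'' := by
  induction h with
  | refl => simpa using h'
  | det hl _ ih => rw [Nat.add_right_comm]; exact .det hl (ih h')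
  | guess_zero hl _ ih => rw [Nat.add_right_comm]; exact .guess_zero hl (ih h')
  | guess_one hl _ ih => rw [Nat.add_right_comm]; exact .guess_one hl (ih h')

/-- A machine with a computation on every guess string of the right length is balanced. -/
theorem NTM.balanced_of_runs {N : NTM} {q : ℕ → ℕ} {T : Polynomial ℕ} {a : Str → Str → Bool}
    (h : ∀ x w, w.length = q x.length → ∃ t ≤ T.eval x.length, ∃ c, N.Run (N.init x) w t c ∧
      c.l = none ∧ N.accept c.var = a x w) :
    N.IsNPTM ∧ N.Balanced q ∧ ∀ x, N.acc x = {w | w.length = q x.length ∧ a x w = true} := by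
  -- Truncation or padding makes every guess sequence comparable with one of the right length, whose
  -- run is known to halt; `Run.determined` then controls arbitrary runs.
  have key : ∀ x w : Str, ∃ w₀ : Str, w₀.length = q x.length ∧ (w₀ <+: w ∨ w <+: w₀) := by
    intro x w
    rcases le_total (q x.length) w.length with h | h
    · exact ⟨w.take (q x.length), by simpa using h, .inl (List.take_prefix _ _)⟩
    · exact ⟨w ++ List.replicate (q x.length - w.length) false, by simp; omega,
        .inr (List.prefix_append _ _)⟩
  have hb : N.Balanced q := by
    intro x
    ext w
    constructor
    · rintro ⟨t, c, hr, hc⟩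
      obtain ⟨w₀, hw₀, hp⟩ := key x w
      obtain ⟨t₀, -, c₀, hr₀, hc₀, -⟩ := h x w₀ hw₀
      rw [((hr₀.determined hc₀ hr hp).2.2 hc).2]
      exact hw₀
    · intro hw
      obtain ⟨t, -, c, hr, hc, -⟩ := h x w hw
      exact ⟨t, c, hr, hc⟩
  refine ⟨⟨T, fun x w t c hr => ?_⟩, hb, fun x => ?_⟩
  · obtain ⟨w₀, hw₀, hp⟩ := key x w
    obtain ⟨t₀, ht₀, c₀, hr₀, hc₀, -⟩ := h x w₀ hw₀
    exact (hr₀.determined hc₀ hr hp).1.trans ht₀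
  · ext w
    constructor
    · rintro ⟨y, t, c, hr, hc, ha, -⟩
      have hw : w.length = q x.length := by
        have : w ∈ N.paths x := ⟨t, c, hr, hc⟩
        rwa [hb x] at this
      obtain ⟨t₀, -, c₀, hr₀, hc₀, ha₀⟩ := h x w hw
      rw [((hr₀.determined hc₀ hr (.inl (List.prefix_refl _))).2.2 hc).1] at ha
      exact ⟨hw, ha₀ ▸ ha⟩
    · rintro ⟨hw, ha⟩
      obtain ⟨t₀, -, c₀, hr₀, hc₀, ha₀⟩ := h x w hw
      exact ⟨_, t₀, c₀, hr₀, hc₀, ha₀.trans ha, rfl⟩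

theorem NTM.run_lift {N : NTM} {K : Type} [DecidableEq K] {Γ : K → Type} {Λ σ : Type}
    {E : Embed Γ N.tm.Γ σ N.tm.σ} {L : Stk Γ → Stk N.tm.Γ} (hL : E.Compat L) {fl : Λ → N.tm.Λ}
    {ex : Stmt N.tm.Γ N.tm.Λ N.tm.σ} {m : Λ → Stmt Γ Λ σ}
    (hm : ∀ l, N.tm.m (fl l) = E.lift fl ex (m l)) (ha : ∀ l, N.alt (fl l) = none)
    {c c' : TM2.Cfg Γ Λ σ} {t : ℕ} (h : Steps m c t c') :
    N.Run (E.liftCfg fl ex L c) [] t (E.liftCfg fl ex L c') := by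
  induction h with
  | refl => exact .refl _
  | head _ ih =>
    refine .det (ha _) ?_
    rw [hm, Embed.stepAux_lift hL]
    exact ih

/-! ### A machine that guesses a string of prescribed length -/

section guess

variable (A B : Frag fun _ : Fin 4 => Bool)

/-- Labels of the guessing machine: those of two fragments, and three further labels, for testing
whether further guesses have to be made, for guessing, and for reading the result. -/
abbrev GuessLabel : Type := (A.Λ ⊕ B.Λ) ⊕ Fin 3

/-- The machine that runs a fragment, which computes the number of guesses on stack `1`, makes
the guesses, which are put onto stack `2`, and runs another fragment, which leaves its result on
stack `3`. -/
def guessMachine : NTM where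
  tm :=
    { K := Fin 4 ⊕ (A.H ⊕ B.H)
      k₀ := .inl 0
      k₁ := .inl 0
      Γ := SumFam (fun _ => Bool) (SumFam A.Δ B.Δ)
      Λ := GuessLabel A B
      main := .inl (.inl A.main)
      σ := A.σ × B.σ × Bool
      initialState := (A.v₀, B.v₀, false)
      Γk₀Fin := inferInstanceAs (Fintype Bool)
      m := fun
        | .inl (.inl l) => (Frag.embL A B).lift (fun l => .inl (.inl l)) (.goto fun _ => .inr 0)
          (A.m l)
        | .inl (.inr l) => (Frag.embR A B).lift (fun l => .inl (.inr l)) (.goto fun _ => .inr 2)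
          (B.m l)
        | .inr 0 => .pop (.inl 1) (fun v o => (v.1, v.2.1, o.isSome)) <|
          .branch (fun v => v.2.2)
            (.load (fun v => (v.1, v.2.1, false)) (.goto fun _ => .inr 1))
            (.load (fun v => (v.1, v.2.1, false)) (.goto fun _ => .inl (.inr B.main)))
        | .inr 1 => .push (.inl 2) (fun _ => false) (.goto fun _ => .inr 0)
        | .inr 2 => .pop (.inl 3) (fun v o => (v.1, v.2.1, o.getD false)) .halt }
  inputAlphabet := Equiv.refl _
  outputAlphabet := Equiv.refl _
  alt
    | .inr 1 => some (.push (.inl 2) (fun _ => true) (.goto fun _ => .inr 0))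
    | _ => none
  accept v := v.2.2

/-- Configurations of the guessing machine outside the computations of the two fragments. -/
def guessCfg (l : Option (GuessLabel A B)) (b : Bool) (S : Fin 4 → Str) : (guessMachine A B).Cfg :=
  ⟨l, (A.v₀, B.v₀, b), Stk.join S Stk.nil⟩

variable {A B}

theorem guessCfg_update {S S' : Fin 4 → Str} {i : Fin 4} {w : Str} (h : update S i w = S')
    (l : Option (GuessLabel A B)) (b : Bool) :
    (TM2.Cfg.mk l (A.v₀, B.v₀, b) (update (Stk.join
      (Γ := SumFam (fun _ => Bool) (SumFam A.Δ B.Δ)) S Stk.nil) (.inl i) w) :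
      TM2.Cfg (SumFam (fun _ => Bool) (SumFam A.Δ B.Δ)) (GuessLabel A B) (A.σ × B.σ × Bool)) =
      guessCfg A B l b S' := by
  subst h
  exact congrArg (TM2.Cfg.mk l (A.v₀, B.v₀, b))
    (join_update_left (Γ := SumFam (fun _ => Bool) (SumFam A.Δ B.Δ)) S Stk.nil i w).symm

theorem run_of_update {S S' : Fin 4 → Str} {i : Fin 4} {w : Str} (h : update S i w = S')
    {l : Option (GuessLabel A B)} {b : Bool} {g : Str} {t : ℕ} {c : (guessMachine A B).Cfg}
    (hr : (guessMachine A B).Run (guessCfg A B l b S') g t c) :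
    (guessMachine A B).Run (TM2.Cfg.mk l (A.v₀, B.v₀, b) (update (Stk.join
      (Γ := SumFam (fun _ => Bool) (SumFam A.Δ B.Δ)) S Stk.nil) (.inl i) w)) g t c :=
  (congrArg (fun c' => (guessMachine A B).Run c' g t c) (guessCfg_update h l b)).mpr hr

/-- Each guess takes two steps, one to test the counter and one to guess, and a last test leaves the
loop. The guessed bits are pushed, hence the reversal. -/
theorem run_guess (x : Str) (w s : Str) : (guessMachine A B).Run
    (guessCfg A B (some (.inr 0)) false ![x, List.replicate w.length true, s, []]) w
    (2 * w.length + 1)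
    (guessCfg A B (some (.inl (.inr B.main))) false ![x, [], w.reverse ++ s, []]) := by
  induction w generalizing s with
  | nil =>
    refine .det (M := guessMachine A B) (l := Sum.inr 0) rfl ?_
    have : update (![x, List.replicate 0 true, s, []] : Fin 4 → Str) 1 [] = ![x, [], s, []] := by
      funext i; fin_cases i <;> rfl
    exact run_of_update this (.refl _)
  | cons b w ih =>
    have h1 : update (![x, List.replicate (w.length + 1) true, s, []] : Fin 4 → Str) 1
        (List.replicate w.length true) = ![x, List.replicate w.length true, s, []] := by
      funext i; fin_cases i <;> rfl
    have h2 : ∀ b, update (![x, List.replicate w.length true, s, []] : Fin 4 → Str) 2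
        (b :: s) = ![x, List.replicate w.length true, b :: s, []] := by
      intro b; funext i; fin_cases i <;> rfl
    have h3 : (guessMachine A B).Run
        (guessCfg A B (some (.inr 1)) false ![x, List.replicate w.length true, s, []]) (b :: w)
        (2 * w.length + 1 + 1)
        (guessCfg A B (some (.inl (.inr B.main))) false ![x, [], w.reverse ++ b :: s, []]) := by
      cases b with
      | false =>
        refine .guess_zero (M := guessMachine A B) (l := Sum.inr 1) rfl ?_
        exact run_of_update (h2 false) (ih (false :: s))
      | true =>
        refine .guess_one (M := guessMachine A B) (l := Sum.inr 1) rfl ?_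
        exact run_of_update (h2 true) (ih (true :: s))
    refine .det (M := guessMachine A B) (l := Sum.inr 0) rfl ?_
    rw [List.reverse_cons, List.append_assoc]
    exact run_of_update h1 h3

end guess

/-- The number of guesses is fixed beforehand by computing a unary counter of length `q |x|`, and
only after all guesses have been made is the predicate evaluated deterministically. -/
theorem exists_balanced {q : ℕ → ℕ} {a : Str → Str → Bool}
    (hq : PT fun S : Fin 1 → Str => List.replicate (q (S 0).length) true)
    (ha : PTb fun S : Fin 2 → Str => a (S 0) (S 1)) :
    ∃ N : NTM, N.IsNPTM ∧ N.Balanced q ∧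
      ∀ x, N.acc x = {w | w.length = q x.length ∧ a x w = true} := by
  obtain ⟨A, P, hA⟩ := ((hq (Fin 4) ![0] 1 (by simp)).reindex
    fun x : Str => ⟨![x, [], [], []], rfl⟩).congr (fun _ => rfl)
      (f' := fun x => ![x, List.replicate (q x.length) true, [], []])
      fun x => by funext i; fin_cases i <;> simp
  have ha' : PTb fun S : Fin 2 → Str => a (S 0) (S 1).reverse :=
    PT.comp₂ (g := fun u v => [a u v]) ha (PT.var 0) (PT.var 1).reverse
  obtain ⟨B, Q, hB⟩ := ((ha' (Fin 4) ![0, 2] 3 (by simp [Fin.forall_fin_succ])).reindex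
    fun a : Str × Str => ⟨![a.1, [], a.2, []], rfl⟩).congr (fun _ => rfl)
      (f' := fun b => ![b.1, [], b.2, [a b.1 b.2.reverse]])
      fun x => by funext i; fin_cases i <;> simp
  -- The counter has been written by a polynomial-time program, and this alone bounds `q` by a
  -- polynomial.
  let R : Polynomial ℕ := .X + .C (∑ l, pushes (A.m l)) * P
  have hR : ∀ x : Str, x.length + q x.length ≤ R.eval x.length := by
    intro x
    obtain ⟨t, ht, hr⟩ := hA x
    have h1 : Stk.size (Γ := fun _ : Fin 4 => Bool) ![x, List.replicate (q x.length) true, [], []] =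
      x.length + q x.length := by simp [Stk.size, Fin.sum_univ_succ]
    have h2 : Stk.size (Γ := fun _ : Fin 4 => Bool) ![x, [], [], []] = x.length := by
      simp [Stk.size, Fin.sum_univ_succ]
    have h3 := hr.size_le
    simp only [h2] at ht
    simp only [h1, h2] at h3
    simp only [R, Polynomial.eval_add, Polynomial.eval_mul, Polynomial.eval_X, Polynomial.eval_C]
    exact h3.trans (Nat.add_le_add_left (Nat.mul_le_mul_left _ ht) _)
  refine ⟨guessMachine A B, NTM.balanced_of_runs (T := P + (2 * R + 1) + Q.comp R + 1)
    fun x w hw => ?_⟩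
  obtain ⟨t, ht, hr⟩ := hA x
  obtain ⟨t', ht', hr'⟩ := hB (x, w.reverse)
  have h2 : Stk.size (Γ := fun _ : Fin 4 => Bool) ![x, [], [], []] = x.length := by
    simp [Stk.size, Fin.sum_univ_succ]
  have h3 : Stk.size (Γ := fun _ : Fin 4 => Bool) ![x, [], w.reverse, []] =
    x.length + q x.length := by simp [Stk.size, Fin.sum_univ_succ, hw]
  simp only [h2] at ht
  simp only [h3] at ht'
  have hinit : (guessMachine A B).init x =
      guessCfg A B (some (.inl (.inl A.main))) false ![x, [], [], []] := by
    have h1 : update (fun _ => [] : Fin 4 → Str) 0 (x.map id) = ![x, [], [], []] := by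
      funext i; fin_cases i <;> simp
    refine (initList_eq _ _).trans (Eq.trans ?_ (guessCfg_update h1 _ _))
    refine congrArg (TM2.Cfg.mk _ _) (congrArg (fun S : Stk (SumFam (fun _ : Fin 4 => Bool)
      (SumFam A.Δ B.Δ)) => update S (.inl 0) (x.map id)) ?_)
    funext k
    cases k <;> rfl
  have r1 := NTM.run_lift (N := guessMachine A B) (Frag.compatL A B)
    (fl := fun l => .inl (.inl l)) (ex := .goto fun _ => .inr 0) (fun l => rfl) (fun l => rfl) hr
  simp only [Embed.liftCfg, Frag.stkL_join] at r1
  have r2 := run_guess (A := A) (B := B) x w []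
  have r3 := NTM.run_lift (N := guessMachine A B) (Frag.compatR A B)
    (fl := fun l => .inl (.inr l)) (ex := .goto fun _ => .inr 2) (fun l => rfl) (fun l => rfl) hr'
  simp only [Embed.liftCfg, Frag.stkR_join] at r3
  have r4 : (guessMachine A B).Run (guessCfg A B (some (.inr 2)) false
      ![x, [], w.reverse, [a x w.reverse.reverse]]) [] 1
      (guessCfg A B none (a x w) ![x, [], w.reverse, []]) := by
    refine .det (M := guessMachine A B) (l := Sum.inr 2) rfl ?_
    have : update (![x, [], w.reverse, [a x w.reverse.reverse]] : Fin 4 → Str) 3 [] =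
        ![x, [], w.reverse, []] := by
      funext i; fin_cases i <;> rfl
    rw [List.reverse_reverse] at this ⊢
    exact run_of_update this (.refl _)
  refine ⟨t + (2 * w.length + 1) + t' + 1, ?_, guessCfg A B none (a x w) ![x, [], w.reverse, []],
    ?_, rfl, rfl⟩
  · have h4 := hR x
    have h5 := ht'.trans (eval_mono Q h4)
    simp only [Polynomial.eval_add, Polynomial.eval_mul, Polynomial.eval_comp, Polynomial.eval_one,
      Polynomial.eval_ofNat]
    omega
  · rw [hinit]
    rw [hw, List.append_nil] at r2
    rw [hw]
    have h : (guessMachine A B).Run _ ([] ++ w ++ [] ++ []) _ _ :=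
      ((NTM.Run.trans r1 r2).trans r3).trans r4
    rw [List.nil_append, List.append_nil, List.append_nil] at h
    exact h

end ClusterComputing

namespace ClusterComputing

open Function

/-! ### Chains that enumerate sets of strings -/

/-- A chain of a right-unique relation whose last element has no successor has no repetitions,
and related elements are consecutive. -/
theorem chain_nodup {α : Type} {r : α → α → Prop} {L : List α} (hL : L.IsChain r)
    (hr : ∀ a ∈ L, ∀ b ∈ L, ∀ c ∈ L, r a b → r a c → b = c)
    (hlast : ∀ a ∈ L.getLast?, ∀ b ∈ L, ¬ r a b) :
    L.Nodup ∧ ∀ (i j : ℕ) (hi : i < L.length) (hj : j < L.length), r L[i] L[j] ↔ j = i + 1 := by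
  have hstep := List.isChain_iff_getElem.1 hL
  have hend : ∀ (i j : ℕ) (hi : i < L.length) (hj : j < L.length), i + 1 = L.length →
      ¬ r L[i] L[j] := by
    intro i j hi hj h
    refine hlast _ ?_ _ (List.getElem_mem hj)
    rw [List.getLast?_eq_getElem?]
    simp [← h]
  -- By right-uniqueness a repetition propagates to the right.
  have hshift : ∀ (k i j : ℕ) (hi : i < L.length) (hj : j + k < L.length) (hij : i < j),
      L[i] = L[j] → L[i + k] = L[j + k] := by
    intro k
    induction k with
    | zero => intro i j _ _ _ h; exact h
    | succ k ih =>
      intro i j hi hj hij h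
      have h1 := ih i j hi (by omega) hij h
      refine hr _ (List.getElem_mem (show i + k < L.length by omega)) _ (List.getElem_mem _) _
        (List.getElem_mem _) (hstep (i + k) (by omega)) ?_
      rw [h1]
      exact hstep (j + k) (by omega)
  -- Shifted until the later occurrence is the last position, a repetition would provide the last
  -- element with a successor.
  have hne : ∀ (i j : ℕ) (hi : i < L.length) (hj : j < L.length), i < j → L[i] ≠ L[j] := by
    intro i j hi hj hij h
    have h1 := hshift (L.length - 1 - j) i j hi (by omega) hij h
    refine hend (j + (L.length - 1 - j)) (i + (L.length - 1 - j) + 1) (by omega) (by omega)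
      (by omega) ?_
    rw [← h1]
    exact hstep _ (by omega)
  have hnd : L.Nodup := by
    rw [List.nodup_iff_injective_getElem]
    rintro ⟨i, hi⟩ ⟨j, hj⟩ h
    rcases lt_trichotomy i j with h' | h' | h'
    · exact (hne i j hi hj h' h).elim
    · exact Fin.ext h'
    · exact (hne j i hj hi h' h.symm).elim
  refine ⟨hnd, fun i j hi hj => ⟨fun h => ?_, ?_⟩⟩
  · by_cases hi' : i + 1 < L.length
    · have h1 := hr _ (List.getElem_mem hi) _ (List.getElem_mem hj) _ (List.getElem_mem hi') h
        (hstep i hi')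
      exact (hnd.getElem_inj_iff).1 h1
    · exact (hend i j hi hj (by omega) h).elim
  · rintro rfl
    exact hstep i hj

/-- The strings of length `n` in lexicographical order. -/
def lexList : ℕ → List Str
  | 0 => [[]]
  | n + 1 => (lexList n).map (false :: ·) ++ (lexList n).map (true :: ·)

theorem mem_lexList {n : ℕ} {w : Str} : w ∈ lexList n ↔ w.length = n := by
  induction n generalizing w with
  | zero => simp [lexList]
  | succ n ih =>
    rcases w with _ | ⟨_ | _, w⟩ <;> simp [lexList, ih]

theorem LexLT.of_cons {a b : Str} (c : Bool) (h : LexLT a b) : LexLT (c :: a) (c :: b) :=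
  List.shortlex_cons_iff.2 h

theorem lexList_pairwise (n : ℕ) : (lexList n).Pairwise LexLT := by
  induction n with
  | zero => simp [lexList]
  | succ n ih =>
    refine List.pairwise_append.2 ⟨List.pairwise_map.2 (ih.imp fun h => h.of_cons _),
      List.pairwise_map.2 (ih.imp fun h => h.of_cons _), ?_⟩
    simp only [List.mem_map, mem_lexList]
    rintro _ ⟨a, ha, rfl⟩ _ ⟨b, hb, rfl⟩
    exact List.Shortlex.of_lex (by simp [ha, hb]) (List.Lex.rel (by decide))

theorem LexLT.asymm {a b : Str} (h : LexLT a b) : ¬ LexLT b a :=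
  Std.Asymm.asymm (r := List.Shortlex (· < ·)) _ _ h

theorem lexList_nodup (n : ℕ) : (lexList n).Nodup :=
  (lexList_pairwise n).imp fun h e => by subst e; exact h.asymm h

theorem head?_lexList (n : ℕ) : (lexList n).head? = some (List.replicate n false) := by
  induction n with
  | zero => rfl
  | succ n ih => simp [lexList, ih, List.replicate_succ]

theorem getLast?_lexList (n : ℕ) : (lexList n).getLast? = some (List.replicate n true) := by
  induction n with
  | zero => rfl
  | succ n ih => simp [lexList, ih, List.replicate_succ]

theorem lexLT_lexList {n i j : ℕ} (hi : i < (lexList n).length) (hj : j < (lexList n).length) :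
    LexLT (lexList n)[i] (lexList n)[j] ↔ i < j := by
  have h := List.pairwise_iff_getElem.1 (lexList_pairwise n)
  refine ⟨fun h' => ?_, h i j hi hj⟩
  rcases lt_trichotomy i j with h1 | h1 | h1
  · exact h1
  · subst h1; exact (h'.asymm h').elim
  · exact (h'.asymm (h j i hj hi h1)).elim

theorem lexLE_lexList {n i j : ℕ} (hi : i < (lexList n).length) (hj : j < (lexList n).length) :
    LexLE (lexList n)[i] (lexList n)[j] ↔ i ≤ j := by
  rw [LexLE, lexLT_lexList, (lexList_nodup n).getElem_inj_iff, le_iff_eq_or_lt]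

theorem LexLT.length_le {a b : Str} (h : LexLT a b) : a.length ≤ b.length := by
  rcases List.shortlex_def.1 h with h | h
  · exact h.le
  · exact h.1.le

/-- Since shorter strings come first, a string between two strings of length `n` has length `n` too.
Hence the successor in `Σ*` agrees with the successor in the list. -/
theorem lexSucc_lexList {n i j : ℕ} (hi : i < (lexList n).length) (hj : j < (lexList n).length) :
    LexSucc (lexList n)[i] (lexList n)[j] ↔ j = i + 1 := by
  have hlen : ∀ (k : ℕ) (hk : k < (lexList n).length), (lexList n)[k].length = n := fun k hk =>
    mem_lexList.1 (List.getElem_mem hk)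
  rw [LexSucc, lexLT_lexList]
  constructor
  · rintro ⟨h1, h2⟩
    by_contra h
    exact h2 (lexList n)[i + 1] ⟨(lexLT_lexList _ _).2 (by omega), (lexLT_lexList _ _).2 (by omega)⟩
  · rintro rfl
    refine ⟨by omega, fun c ⟨h1, h2⟩ => ?_⟩
    have hc : c.length = n := le_antisymm (h2.length_le.trans_eq (hlen _ _))
      ((hlen _ _).symm.trans_le h1.length_le)
    obtain ⟨k, hk, rfl⟩ := List.getElem_of_mem (mem_lexList.2 hc)
    rw [lexLT_lexList] at h1 h2
    omega

/-- An enumeration of the strings of length `n` provides a bijection, under which it corresponds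
to the lexicographical order. -/
theorem exists_equiv_of_enumeration {n : ℕ} {L : List Str} (hL : L.Nodup)
    (hmem : ∀ w, w ∈ L ↔ w.length = n) : L.length = (lexList n).length ∧
      ∃ h : BitStr n ≃ BitStr n, ∀ (i : ℕ) (hi : i < L.length) (hi' : i < (lexList n).length)
        (y : BitStr n), y.1 = L[i] → (h y).1 = (lexList n)[i] := by
  have hlen : L.length = (lexList n).length :=
    ((List.perm_ext_iff_of_nodup hL (lexList_nodup n)).2 fun w => by
      rw [hmem, mem_lexList]).length_eq
  refine ⟨hlen, (Equiv.subtypeEquivRight fun w => (hmem w).symm).trans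
    ((hL.getEquiv L).symm.trans ((finCongr hlen).trans
      (((lexList_nodup n).getEquiv _).trans (Equiv.subtypeEquivRight fun w => mem_lexList)))), ?_⟩
  rintro i hi hi' ⟨y, hy⟩ rfl
  simp [List.Nodup.getEquiv]
  congr 1
  exact letI : BEq Str := instBEqOfDecidableEq; hL.idxOf_getElem i hi

/-! ### Binary counting -/

/-- The strings of length `n` in the order of the binary numbers with the least significant bit
first. -/
def countList : ℕ → List Str
  | 0 => [[]]
  | n + 1 => ((countList n).map fun u => [false :: u, true :: u]).flatten

theorem mem_countList {n : ℕ} {w : Str} : w ∈ countList n ↔ w.length = n := by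
  induction n generalizing w with
  | zero => simp [countList]
  | succ n ih =>
    rcases w with _ | ⟨_ | _, w⟩ <;> simp [countList, ih]

/-- Within a pair only the lowest bit changes; between two pairs a carry passes from `1 :: u` to `0
:: v`, where `v` is the successor of `u` by induction. -/
theorem countList_isChain (n : ℕ) : (countList n).IsChain fun u v => isSucc u v = true := by
  induction n with
  | zero => simp [countList]
  | succ n ih =>
    refine (List.isChain_flatten (by simp)).2 ⟨?_, ?_⟩
    · simp [isSucc]
    · rw [List.isChain_map]
      exact ih.imp fun u v h => by simpa [isSucc] using h

theorem head?_countList (n : ℕ) : (countList n).head? = some (List.replicate n false) := by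
  induction n with
  | zero => rfl
  | succ n ih =>
    obtain ⟨l, hl⟩ : ∃ l, countList n = List.replicate n false :: l := by
      rcases h : countList n with _ | ⟨a, l⟩ <;> simp_all
    simp [countList, hl, List.replicate_succ]

theorem getLast?_countList (n : ℕ) : (countList n).getLast? = some (List.replicate n true) := by
  induction n with
  | zero => rfl
  | succ n ih =>
    obtain ⟨l, hl⟩ := List.getLast?_eq_some_iff.1 ih
    simp [countList, hl, List.replicate_succ]

theorem isSucc_unique {u v w : Str} (h : isSucc u v = true) (h' : isSucc u w = true) : v = w := by
  induction u generalizing v w with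
  | nil => simp [isSucc] at h
  | cons b u ih =>
    rcases b <;> rcases v with _ | ⟨_ | _, v⟩ <;> rcases w with _ | ⟨_ | _, w⟩ <;>
      simp_all [isSucc]
    exact ih h h'

theorem not_isSucc_ones (n : ℕ) (v : Str) : isSucc (List.replicate n true) v = false := by
  induction n generalizing v with
  | zero => simp [isSucc]
  | succ n ih =>
    rcases v with _ | ⟨_ | _, v⟩ <;> simp [isSucc, List.replicate_succ, ih]

end ClusterComputing

namespace ClusterComputing

open Function

/-! ### Ordering all strings around a cluster -/

section insertion

variable (sp an la : Str → Bool) (N : Str → Str → Bool)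

/-- The relation between the strings `c :: t` in which the strings `0 :: t` with `sp t` are moved to
the place of an anchor. Here `N` is the successor relation of the moved strings (the first one of
them being the successor of the anchor), and `la` is satisfied by the last of them. -/
def insertion (y z : Str) : Bool :=
  bif y.head?.getD false then
    isSucc y.tail z.tail && (z.head?.getD false == sp z.tail)
  else bif z.head?.getD false then
    (la y.tail && an z.tail) || (decide (y.tail = z.tail) && !(sp y.tail || an y.tail))
  else N y.tail z.tail

variable {sp an la N}

theorem insertion_true (t t' : Str) (c : Bool) :
    insertion sp an la N (true :: t) (c :: t') = true ↔ isSucc t t' = true ∧ c = sp t' := by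
  simp [insertion]

theorem insertion_false_false (t t' : Str) :
    insertion sp an la N (false :: t) (false :: t') = true ↔ N t t' = true := by
  simp [insertion]

theorem insertion_false_true (t t' : Str) :
    insertion sp an la N (false :: t) (true :: t') = true ↔
      (la t = true ∧ an t' = true) ∨ (t = t' ∧ sp t = false ∧ an t = false) := by
  simp only [insertion, List.head?_cons, Option.getD_some, List.tail_cons, cond_false, cond_true,
    Bool.or_eq_true, Bool.and_eq_true, Bool.not_eq_true', Bool.or_eq_false_iff]
  exact or_congr_right (and_congr_left' decide_eq_true_iff)

/-- The strings `0 :: t` and `1 :: t` in their order, where `0 :: t` is left out if it has been moved,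
and is followed by the moved strings if `t` is the anchor. -/
def block (Z : List Str) (t : Str) : List Str :=
  if t ∈ Z.tail then [true :: t]
  else if Z.head? = some t then Z.map (false :: ·) ++ [true :: t]
  else [false :: t, true :: t]

theorem block_ne_nil (Z : List Str) (t : Str) : block Z t ≠ [] := by
  unfold block; split_ifs <;> simp

theorem getLast?_block (Z : List Str) (t : Str) : (block Z t).getLast? = some (true :: t) := by
  unfold block; split_ifs <;> simp

/-- A block begins with `1 :: t` exactly when `0 :: t` has been moved away. One test of `t` thus
determines the successor of the end of the preceding block. -/
theorem head?_block (Z : List Str) (t : Str) :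
    (block Z t).head? = some (decide (t ∈ Z.tail) :: t) := by
  unfold block
  split_ifs with h h'
  · simp [h]
  · rcases Z with _ | ⟨a, Z⟩ <;> simp_all
  · simp [h]

/-- Bijections that correspond to the relation `insertion`. -/
theorem exists_equiv_insertion {n : ℕ} {Z : List Str} (hZ : ∀ t ∈ Z, t.length = n) (hnd : Z.Nodup)
    (hsp : ∀ t, t.length = n → (sp t = true ↔ t ∈ Z.tail))
    (han : ∀ t, t.length = n → (an t = true ↔ Z.head? = some t))
    (hla : ∀ t, t.length = n → (la t = true ↔ Z.getLast? = some t))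
    (hN : Z.IsChain fun t t' => N t t' = true)
    (hNmem : ∀ t t', t.length = n → t'.length = n → N t t' = true →
      t ∈ Z ∧ Z.getLast? ≠ some t)
    (hNuniq : ∀ t t' t'', t.length = n → t'.length = n → t''.length = n → N t t' = true →
      N t t'' = true → t' = t'')
    (hzero : List.replicate n false ∉ Z.tail) :
    ∃ h : BitStr (n + 1) ≃ BitStr (n + 1),
      (∀ y : BitStr (n + 1), y.1 = List.replicate (n + 1) false →
        (h y).1 = List.replicate (n + 1) false) ∧
      (∀ y : BitStr (n + 1), y.1 = List.replicate (n + 1) true →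
        (h y).1 = List.replicate (n + 1) true) ∧
      (∀ y z : BitStr (n + 1), insertion sp an la N y.1 z.1 = true ↔ LexSucc (h y).1 (h z).1) ∧
      (Z.tail ≠ [] → ∃ l u : BitStr (n + 1), {w | ∃ t ∈ Z.tail, w = false :: t} =
        {w | ∃ hw : w.length = n + 1, LexLE (h l).1 (h ⟨w, hw⟩).1 ∧
          LexLE (h ⟨w, hw⟩).1 (h u).1}) := by
  have hmemZ : ∀ t, t ∈ Z ↔ t ∈ Z.tail ∨ Z.head? = some t := by
    rcases Z with _ | ⟨a, Z⟩ <;> simp [eq_comm, or_comm]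
  -- The enumeration to be transported to the lexicographical order. The list `Z` consists of the
  -- anchor followed by the moved strings, or is empty.
  set L := ((countList n).map (block Z)).flatten with hLdef
  have hmem : ∀ w, w ∈ L ↔ w.length = n + 1 := by
    intro w
    simp only [hLdef, List.mem_flatten, List.mem_map, mem_countList]
    constructor
    · rintro ⟨_, ⟨t, ht, rfl⟩, h⟩
      unfold block at h
      split_ifs at h
      · simp_all
      · simp only [List.mem_append, List.mem_map, List.mem_singleton] at h
        rcases h with ⟨t', ht', rfl⟩ | rfl
        · simp [hZ t' ht']
        · simp [ht]
      · simp only [List.mem_cons, List.not_mem_nil, or_false] at h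
        rcases h with rfl | rfl <;> simp [ht]
    · intro h
      rcases w with _ | ⟨c, t⟩
      · simp at h
      have ht : t.length = n := by simpa using h
      -- A moved string lies in the block of the anchor, every other string in its own block.
      by_cases hc : c = false ∧ t ∈ Z.tail
      · obtain ⟨rfl, h'⟩ := hc
        obtain ⟨a, Y, rfl⟩ : ∃ a Y, Z = a :: Y := by
          rcases Z with _ | ⟨a, Y⟩
          · simp at h'
          · exact ⟨a, Y, rfl⟩
        refine ⟨_, ⟨a, hZ a (by simp), rfl⟩, ?_⟩
        have ha : a ∉ Y := (List.nodup_cons.1 hnd).1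
        simp only [List.tail_cons] at h'
        simp [block, ha, h']
      · refine ⟨_, ⟨t, ht, rfl⟩, ?_⟩
        unfold block
        split_ifs with h1 h2
        · cases c <;> simp_all
        · cases c
          · simp [(hmemZ t).2 (.inr h2)]
          · simp
        · cases c <;> simp
  have hlen : ∀ w ∈ L, ∃ c t, w = c :: t ∧ t.length = n := by
    intro w hw
    rcases w with _ | ⟨c, t⟩
    · simpa using (hmem _).1 hw
    · exact ⟨c, t, rfl, by simpa using (hmem _).1 hw⟩
  -- Inside the block of the anchor, `N` links the members of `Z`, and the last of them leads to `1
  -- :: a`. Between blocks, counting leads from `1 :: t` to the head of the next block.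
  have hchain : L.IsChain fun y z => insertion sp an la N y z = true := by
    refine (List.isChain_flatten ?_).2 ⟨?_, ?_⟩
    · simp [block_ne_nil]
    · simp only [List.mem_map, mem_countList]
      rintro _ ⟨t, ht, rfl⟩
      unfold block
      split_ifs with h1 h2
      · simp
      · refine List.isChain_append.2 ⟨?_, by simp, ?_⟩
        · rw [List.isChain_map]
          exact hN.imp fun t t' h => (insertion_false_false _ _).2 h
        · simp only [List.getLast?_map, Option.mem_def, Option.map_eq_some_iff, List.head?_cons,
            Option.some.injEq]
          rintro _ ⟨t', ht', rfl⟩ _ rfl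
          exact (insertion_false_true _ _).2 (.inl ⟨(hla t' (hZ _ (List.mem_of_getLast? ht'))).2 ht',
            (han t ht).2 h2⟩)
      · simp only [List.isChain_cons_cons, List.isChain_singleton, and_true]
        refine (insertion_false_true _ _).2 (.inr ⟨rfl, ?_, ?_⟩)
        · simpa [h1] using hsp t ht
        · simpa [h2] using han t ht
    · rw [List.isChain_map]
      have : ∀ l : List Str, (∀ t ∈ l, t.length = n) → (l.IsChain fun u v => isSucc u v = true) →
          l.IsChain fun t t' => ∀ x ∈ (block Z t).getLast?, ∀ y ∈ (block Z t').head?,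
            insertion sp an la N x y = true := by
        intro l hl hc
        rw [List.isChain_iff_getElem] at hc ⊢
        intro i hi
        simp only [getLast?_block, head?_block, Option.mem_def, Option.some.injEq, forall_eq']
        refine (insertion_true _ _ _).2 ⟨hc i hi, ?_⟩
        rw [Bool.eq_iff_iff, decide_eq_true_iff, hsp _ (hl _ (List.getElem_mem _))]
      exact this _ (fun t => mem_countList.1) (countList_isChain n)
  have hlast : L.getLast? = some (List.replicate (n + 1) true) := by
    obtain ⟨l, hl⟩ := List.getLast?_eq_some_iff.1 (getLast?_countList n)
    simp [hLdef, hl, getLast?_block, List.replicate_succ]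
  have hhead : L.head? = some (List.replicate (n + 1) false) := by
    obtain ⟨l, hl⟩ : ∃ l, countList n = List.replicate n false :: l := by
      have := head?_countList n
      rcases h : countList n with _ | ⟨a, l⟩ <;> simp_all
    simp [hLdef, hl, head?_block, List.replicate_succ, hzero]
  obtain ⟨hLnd, hidx⟩ := chain_nodup hchain (by
    intro y hy z hz z' hz' h h'
    obtain ⟨c, t, rfl, ht⟩ := hlen y hy
    obtain ⟨c₁, t₁, rfl, ht₁⟩ := hlen z hz
    obtain ⟨c₂, t₂, rfl, ht₂⟩ := hlen z' hz'
    -- A member of `Z` is moved or the anchor, so the ordinary link from `0 :: t` to `1 :: t` does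
    -- not apply to it. Together with the fact that the last member has no `N`-successor, this makes
    -- the cases exclusive.
    have hZt : t ∈ Z → sp t = false → an t = false → False := by
      intro h h1 h2
      rcases (hmemZ t).1 h with h | h
      · simp [(hsp t ht).2 h] at h1
      · simp [(han t ht).2 h] at h2
    have hlaZ : la t = true → t ∈ Z := fun h => List.mem_of_getLast? ((hla t ht).1 h)
    have hNla : ∀ t', t'.length = n → N t t' = true → la t = true → False := fun t' ht' h h' =>
      (hNmem t t' ht ht' h).2 ((hla t ht).1 h')
    have hNZ : ∀ t', t'.length = n → N t t' = true → t ∈ Z := fun t' ht' h =>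
      (hNmem t t' ht ht' h).1
    rcases c with _ | _
    · rcases c₁ with _ | _ <;> rcases c₂ with _ | _ <;>
        simp only [insertion_false_true, insertion_false_false] at h h'
      · rw [hNuniq t _ _ ht ht₁ ht₂ h h']
      · rcases h' with h' | h'
        · exact (hNla _ ht₁ h h'.1).elim
        · exact (hZt (hNZ _ ht₁ h) h'.2.1 h'.2.2).elim
      · rcases h with h | h
        · exact (hNla _ ht₂ h' h.1).elim
        · exact (hZt (hNZ _ ht₂ h') h.2.1 h.2.2).elim
      · rcases h with h | h <;> rcases h' with h' | h'
        · have := ((han _ ht₁).1 h.2).symm.trans ((han _ ht₂).1 h'.2)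
          simp_all
        · exact (hZt (hlaZ h.1) h'.2.1 h'.2.2).elim
        · exact (hZt (hlaZ h'.1) h.2.1 h.2.2).elim
        · rw [← h.1, ← h'.1]
    · rw [insertion_true] at h h'
      have := isSucc_unique h.1 h'.1
      subst this
      rw [h.2, h'.2])
    (by
      rw [hlast]
      rintro _ ⟨⟩ z hz
      obtain ⟨c, t, rfl, ht⟩ := hlen z hz
      rw [List.replicate_succ, insertion_true, not_isSucc_ones]
      simp)
  obtain ⟨hcard, h, hh⟩ := exists_equiv_of_enumeration hLnd hmem
  have hval : ∀ y : BitStr (n + 1), ∃ (i : ℕ) (hi : i < L.length)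
      (hi' : i < (lexList (n + 1)).length), y.1 = L[i] ∧ (h y).1 = (lexList (n + 1))[i] := by
    intro y
    obtain ⟨i, hi, hy⟩ := List.getElem_of_mem ((hmem y.1).2 y.2)
    exact ⟨i, hi, hcard ▸ hi, hy.symm, hh i hi _ y hy.symm⟩
  refine ⟨h, fun y hy => ?_, fun y hy => ?_, fun y z => ?_, fun hne => ?_⟩
  · rw [List.head?_eq_getElem?, List.getElem?_eq_some_iff] at hhead
    obtain ⟨h0, hL0⟩ := hhead
    have := head?_lexList (n + 1)
    rw [List.head?_eq_getElem?, List.getElem?_eq_some_iff] at this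
    obtain ⟨h0', hE0⟩ := this
    rw [hh 0 h0 h0' y (hy.trans hL0.symm), hE0]
  · rw [List.getLast?_eq_getElem?, List.getElem?_eq_some_iff] at hlast
    obtain ⟨h0, hL0⟩ := hlast
    have := getLast?_lexList (n + 1)
    rw [List.getLast?_eq_getElem?, List.getElem?_eq_some_iff] at this
    obtain ⟨h0', hE0⟩ := this
    rw [hh _ h0 (hcard ▸ h0) y (hy.trans hL0.symm), ← hE0]
    simp only [hcard]
  · obtain ⟨i, hi, hi', hy, hy'⟩ := hval y
    obtain ⟨j, hj, hj', hz, hz'⟩ := hval z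
    rw [hy', hz', hy, hz, lexSucc_lexList, ← hidx i j hi hj]
  · obtain ⟨a, Y, rfl⟩ : ∃ a Y, Z = a :: Y := by
      rcases Z with _ | ⟨a, Y⟩
      · simp at hne
      · exact ⟨a, Y, rfl⟩
    simp only [List.tail_cons] at hne ⊢
    obtain ⟨s₁, s₂, hs⟩ := List.append_of_mem (mem_countList.2 (hZ a (by simp)))
    have ha : a ∉ Y := (List.nodup_cons.1 hnd).1
    -- The moved strings form one segment, directly behind `0 :: a`.
    obtain ⟨L₁, L₂, hL⟩ : ∃ L₁ L₂, L = L₁ ++ Y.map (false :: ·) ++ L₂ := by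
      refine ⟨(s₁.map (block (a :: Y))).flatten ++ [false :: a],
        (true :: a) :: (s₂.map (block (a :: Y))).flatten, ?_⟩
      simp [hLdef, hs, block, ha]
    have hY : 0 < Y.length := List.length_pos_iff.2 hne
    have hLlen : L.length = L₁.length + Y.length + L₂.length := by simp [hL, Nat.add_assoc]
    have hget : ∀ (i : ℕ) (hi : i < L.length), (∃ t ∈ Y, L[i] = false :: t) ↔
        L₁.length ≤ i ∧ i ≤ L₁.length + (Y.length - 1) := by
      have hYget : ∀ (j : ℕ) (hj : j < Y.length) (hi : L₁.length + j < L.length),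
          L[L₁.length + j] = false :: Y[j] := by
        intro j hj hi
        simp only [hL]
        rw [List.getElem_append_left (by simpa using hj), List.getElem_append_right (by simp)]
        simp
      intro i hi
      constructor
      · rintro ⟨t, ht, h⟩
        obtain ⟨j, hj, rfl⟩ := List.getElem_of_mem ht
        rw [← hYget j hj (by omega), hLnd.getElem_inj_iff] at h
        omega
      · rintro ⟨h1, h2⟩
        obtain ⟨j, rfl⟩ := Nat.exists_eq_add_of_le h1
        exact ⟨Y[j]'(by omega), List.getElem_mem _, hYget j (by omega) hi⟩
    have hlenget : ∀ (i : ℕ) (hi : i < L.length), L[i].length = n + 1 := fun i hi =>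
      (hmem _).1 (List.getElem_mem hi)
    refine ⟨⟨L[L₁.length], hlenget _ (by omega)⟩,
      ⟨L[L₁.length + (Y.length - 1)], hlenget _ (by omega)⟩, ?_⟩
    rw [hh L₁.length (by omega) (by omega) _ rfl,
      hh (L₁.length + (Y.length - 1)) (by omega) (by omega) _ rfl]
    ext w
    constructor
    · rintro ⟨t, ht, rfl⟩
      have hw : (false :: t).length = n + 1 := by simp [hZ t (by simp [ht])]
      obtain ⟨i, hi, hi', hy, hy'⟩ := hval ⟨_, hw⟩
      refine ⟨hw, ?_⟩
      rw [hy', lexLE_lexList, lexLE_lexList, ← hget i hi]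
      exact ⟨t, ht, hy.symm⟩
    · rintro ⟨hw, h1⟩
      obtain ⟨i, hi, hi', hy, hy'⟩ := hval ⟨w, hw⟩
      rw [hy', lexLE_lexList, lexLE_lexList, ← hget i hi] at h1
      obtain ⟨t, ht, h1⟩ := h1
      exact ⟨t, ht, hy.trans h1⟩

end insertion

end ClusterComputing

namespace ClusterComputing

open Function

/-! ### Clusters as lists -/

theorem mem_theUnique {P : Str → Prop} {z : Str} (hz : P z) (h : ∀ y, P y → y = z) :
    z ∈ theUnique P := by
  have hd : ∃! z, P z := ⟨z, hz, h⟩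
  exact ⟨hd, h _ hd.choose_spec.1⟩

/-- `A` lists the elements of `s` as a chain, which begins and ends with given values. -/
structure IsClusterList (s : Set Str) (r : Str → Str → Bool) (least greatest : Part Str)
    (A : List Str) : Prop where
  ne_nil : A ≠ []
  nodup : A.Nodup
  mem : ∀ w, w ∈ A ↔ w ∈ s
  chain : A.IsChain fun y z => r y z = true
  head_mem : ∀ w, A.head? = some w → w ∈ least
  getLast_mem : ∀ w, A.getLast? = some w → w ∈ greatest
  unique : ∀ y ∈ A, ∀ z ∈ A, ∀ z' ∈ A, A.getLast? ≠ some y → r y z = true → r y z' = true → z = z'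

/-- If the relation means exactly "next index", then only the first entry has no predecessor and
only the last one has no successor, so both unique descriptions denote. -/
theorem isClusterList_of_succ {s : Set Str} {r : Str → Str → Bool} {P Q : Str → Prop}
    {A : List Str} (hne : A ≠ []) (hnd : A.Nodup) (hs : ∀ w, w ∈ A ↔ w ∈ s)
    (hr : ∀ (a b : ℕ) (ha : a < A.length) (hb : b < A.length), r A[a] A[b] = true ↔ b = a + 1)
    (hP : ∀ z, P z ↔ z ∈ A ∧ ∀ w ∈ A, ¬ r w z = true)
    (hQ : ∀ z, Q z ↔ z ∈ A ∧ ∀ w ∈ A, ¬ r z w = true) :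
    IsClusterList s r (theUnique P) (theUnique Q) A where
  ne_nil := hne
  nodup := hnd
  mem := hs
  chain := List.isChain_iff_getElem.2 fun i hi => (hr _ _ _ _).2 rfl
  head_mem w hw := by
    rw [List.head?_eq_getElem?, List.getElem?_eq_some_iff] at hw
    obtain ⟨h0, rfl⟩ := hw
    refine mem_theUnique ((hP _).2 ⟨List.getElem_mem _, fun w hw => ?_⟩) fun y hy => ?_
    · obtain ⟨a, ha, rfl⟩ := List.getElem_of_mem hw
      rw [hr]
      omega
    · obtain ⟨hy, h⟩ := (hP _).1 hy
      obtain ⟨a, ha, rfl⟩ := List.getElem_of_mem hy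
      rcases a with _ | a
      · rfl
      · exact (h A[a] (List.getElem_mem _) ((hr _ _ _ _).2 rfl)).elim
  getLast_mem w hw := by
    rw [List.getLast?_eq_getElem?, List.getElem?_eq_some_iff] at hw
    obtain ⟨h0, rfl⟩ := hw
    refine mem_theUnique ((hQ _).2 ⟨List.getElem_mem _, fun w hw => ?_⟩) fun y hy => ?_
    · obtain ⟨a, ha, rfl⟩ := List.getElem_of_mem hw
      rw [hr]
      omega
    · obtain ⟨hy, h⟩ := (hQ _).1 hy
      obtain ⟨a, ha, rfl⟩ := List.getElem_of_mem hy
      by_cases h' : a + 1 < A.length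
      · exact (h A[a + 1] (List.getElem_mem _) ((hr _ _ _ _).2 rfl)).elim
      · have : a = A.length - 1 := by omega
        subst this
        rfl
  unique y hy z hz z' hz' _ h h' := by
    obtain ⟨a, ha, rfl⟩ := List.getElem_of_mem hy
    obtain ⟨b, hb, rfl⟩ := List.getElem_of_mem hz
    obtain ⟨c, hc, rfl⟩ := List.getElem_of_mem hz'
    rw [hr] at h h'
    subst h h'
    rfl

/-! ### Counting strings and enumerating them along a bijection -/

theorem setOf_length_eq (n : ℕ) : {w : Str | w.length = n} = ((lexList n).toFinset : Set Str) := by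
  ext w
  simp [mem_lexList]

theorem length_lexList (n : ℕ) : (lexList n).length = 2 ^ n := by
  induction n with
  | zero => rfl
  | succ n ih => simp [lexList, ih, pow_succ, mul_two]

theorem ncard_length_eq (n : ℕ) : {w : Str | w.length = n}.ncard = 2 ^ n := by
  rw [setOf_length_eq, Set.ncard_coe_finset, List.toFinset_card_of_nodup (lexList_nodup n),
    length_lexList]

theorem finite_length_eq (n : ℕ) : {w : Str | w.length = n}.Finite := by
  rw [setOf_length_eq]
  exact Finset.finite_toSet _

theorem NTM.Balanced.acc_subset {M : NTM} {p : ℕ → ℕ} (h : M.Balanced p) (x : Str) :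
    M.acc x ⊆ {w | w.length = p x.length} := by
  rintro w ⟨y, t, c, hr, hc, -⟩
  rw [← h x]
  exact ⟨t, c, hr, hc⟩

theorem NTM.Balanced.numAcc_eq_zero {M : NTM} {p : ℕ → ℕ} (h : M.Balanced p) (x : Str) :
    M.numAcc x = 0 ↔ M.acc x = ∅ :=
  Set.ncard_eq_zero ((finite_length_eq _).subset (h.acc_subset x))

/-- The strings of length `n` in the order given by a bijection. -/
theorem exists_enumeration {n : ℕ} (h : BitStr n ≃ BitStr n) : ∃ G : List Str, G.Nodup ∧
    (∀ w, w ∈ G ↔ w.length = n) ∧ G.length = (lexList n).length ∧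
    ∀ (y : BitStr n) (i : ℕ) (hi : i < G.length) (hi' : i < (lexList n).length), y.1 = G[i] →
      (h y).1 = (lexList n)[i] := by
  refine ⟨(lexList n).attach.map fun e => (h.symm ⟨e.1, mem_lexList.1 e.2⟩).1, ?_, fun w => ?_,
    by simp, fun y i hi hi' hy => ?_⟩
  · refine List.Nodup.map (fun a b hab => ?_) (List.nodup_attach.2 (lexList_nodup n))
    have := Subtype.ext_iff.1 (h.symm.injective (Subtype.ext hab))
    exact Subtype.ext this
  · simp only [List.mem_map, List.mem_attach, true_and, Subtype.exists]
    constructor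
    · rintro ⟨e, he, rfl⟩
      exact (h.symm _).2
    · intro hw
      exact ⟨(h ⟨w, hw⟩).1, mem_lexList.2 (h ⟨w, hw⟩).2, by simp⟩
  · rw [List.getElem_map, List.getElem_attach] at hy
    rw [Subtype.ext hy, Equiv.apply_symm_apply]

theorem lexList_getElem_eq_zeros {n i : ℕ} (hi : i < (lexList n).length) :
    (lexList n)[i] = List.replicate n false ↔ i = 0 := by
  have := head?_lexList n
  rw [List.head?_eq_getElem?, List.getElem?_eq_some_iff] at this
  obtain ⟨h0, h⟩ := this
  rw [← h, (lexList_nodup n).getElem_inj_iff]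

theorem lexList_getElem_eq_ones {n i : ℕ} (hi : i < (lexList n).length) :
    (lexList n)[i] = List.replicate n true ↔ i + 1 = (lexList n).length := by
  have := getLast?_lexList n
  rw [List.getLast?_eq_getElem?, List.getElem?_eq_some_iff] at this
  obtain ⟨h0, h⟩ := this
  rw [← h, (lexList_nodup n).getElem_inj_iff]
  omega

/-- A nonempty cluster is a segment of the enumeration. -/
theorem Clustered.exists_segment {M : NTM} {x : Str} {n : ℕ} {h : BitStr n ≃ BitStr n}
    (hM : Clustered M x h) (hne : M.acc x ≠ ∅) {G : List Str}
    (hmem : ∀ w, w ∈ G ↔ w.length = n) (hlen : G.length = (lexList n).length)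
    (hG : ∀ (y : BitStr n) (i : ℕ) (hi : i < G.length) (hi' : i < (lexList n).length), y.1 = G[i] →
      (h y).1 = (lexList n)[i]) :
    ∃ i k, i + k < G.length ∧ ∀ w, w ∈ (G.drop i).take (k + 1) ↔ w ∈ M.acc x := by
  obtain ⟨l, u, hlu⟩ := hM
  obtain ⟨i, hi, hl⟩ := List.getElem_of_mem ((hmem _).2 l.2)
  obtain ⟨j, hj, hu⟩ := List.getElem_of_mem ((hmem _).2 u.2)
  rw [hG l i hi (hlen ▸ hi) hl.symm, hG u j hj (hlen ▸ hj) hu.symm] at hlu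
  have hacc : ∀ (a : ℕ) (ha : a < G.length), G[a] ∈ M.acc x ↔ i ≤ a ∧ a ≤ j := by
    intro a ha
    have hw : G[a].length = n := (hmem _).1 (List.getElem_mem ha)
    rw [hlu]
    simp only [Set.mem_ofPred_eq, hw, exists_true_left]
    rw [hG _ a ha (hlen ▸ ha) rfl, lexLE_lexList, lexLE_lexList]
  have hsub : ∀ w ∈ M.acc x, w ∈ G := by
    intro w hw
    rw [hlu] at hw
    exact (hmem _).2 hw.1
  -- The endpoints are not assumed to be ordered; this follows from the cluster being nonempty.
  have hij : i ≤ j := by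
    obtain ⟨w, hw⟩ := Set.nonempty_iff_ne_empty.2 hne
    obtain ⟨a, ha, rfl⟩ := List.getElem_of_mem (hsub w hw)
    have := (hacc a ha).1 hw
    omega
  refine ⟨i, j - i, by omega, fun w => ⟨fun hw => ?_, fun hw => ?_⟩⟩
  · obtain ⟨a, ha, rfl⟩ := List.getElem_of_mem hw
    simp only [List.length_take, List.length_drop] at ha
    simp only [List.getElem_take, List.getElem_drop]
    rw [hacc]
    omega
  · obtain ⟨a, ha, rfl⟩ := List.getElem_of_mem (hsub w hw)
    have h1 := (hacc a ha).1 hw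
    refine List.mem_iff_getElem.2 ⟨a - i, by simp; omega, ?_⟩
    simp only [List.getElem_take, List.getElem_drop]
    congr 1
    omega

theorem noRight_iff {p : ℕ → ℕ} {M : NTM} (hM : M.Balanced p) (prec : Str → Str → Str → Bool)
    {x : Str} {A : List Str} (hA : ∀ w, w ∈ A ↔ w ∈ M.acc x) (z : Str) :
    NoRight p M prec x z ↔ z ∈ A ∧ ∀ w ∈ A, ¬ prec x z w = true := by
  simp only [NoRight, hA]
  exact ⟨fun h => ⟨h.2.1, fun w hw => h.2.2 w (hM.acc_subset x hw) hw⟩,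
    fun h => ⟨hM.acc_subset x h.1, h.1, fun w _ => h.2 w⟩⟩

theorem noLeft_iff {p : ℕ → ℕ} {M : NTM} (hM : M.Balanced p) (prec : Str → Str → Str → Bool)
    {x : Str} {A : List Str} (hA : ∀ w, w ∈ A ↔ w ∈ M.acc x) (z : Str) :
    NoLeft p M prec x z ↔ z ∈ A ∧ ∀ w ∈ A, ¬ prec x w z = true := by
  simp only [NoLeft, hA]
  exact ⟨fun h => ⟨h.2.1, fun w hw => h.2.2 w (hM.acc_subset x hw) hw⟩,
    fun h => ⟨hM.acc_subset x h.1, h.1, fun w _ => h.2 w⟩⟩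

/-- The successor condition is required only inside the segment, because in the circular model it
fails for the pair formed by the last and the first string of the whole enumeration. -/
theorem isClusterList_of_segment {p : ℕ → ℕ} {M : NTM} (hM : M.Balanced p)
    {prec : Str → Str → Str → Bool} {x : Str} {G : List Str} (hnd : G.Nodup) {i k : ℕ}
    (hik : i + k < G.length) (hacc : ∀ w, w ∈ (G.drop i).take (k + 1) ↔ w ∈ M.acc x)
    (hr : ∀ (a b : ℕ) (ha : a < G.length) (hb : b < G.length), i ≤ a → a ≤ i + k → i ≤ b →
      b ≤ i + k → (prec x G[a] G[b] = true ↔ b = a + 1)) :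
    IsClusterList (M.acc x) (prec x) (theUnique (NoLeft p M prec x))
      (theUnique (NoRight p M prec x)) ((G.drop i).take (k + 1)) := by
  refine isClusterList_of_succ ?_ (hnd.sublist ((List.take_sublist _ _).trans
    (List.drop_sublist _ _))) hacc ?_ (noLeft_iff hM prec hacc) (noRight_iff hM prec hacc)
  · rw [← List.length_pos_iff]
    simp
    omega
  · intro a b ha hb
    simp only [List.length_take, List.length_drop] at ha hb
    simp only [List.getElem_take, List.getElem_drop]
    rw [hr _ _ _ _ (by omega) (by omega) (by omega) (by omega)]
    omega

theorem not_theUnique_noRight_dom {p : ℕ → ℕ} {M : NTM} {prec : Str → Str → Str → Bool} {x : Str}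
    (h : M.acc x = ∅) : ¬ (theUnique (NoRight p M prec x)).Dom := by
  rintro ⟨z, hz, -⟩
  have := hz.2.1
  simp [h] at this

/-! ### The cluster in the free and in the circular model -/

theorem ComputesFree.cluster {p : ℕ → ℕ} {M : NTM} {prec : Str → Str → Str → Bool} {f : Str → ℕ}
    (hf : ComputesFree p M prec f) (x : Str) :
    f x = M.numAcc x ∧ (M.acc x = ∅ → ¬ (greatestFree p M prec x).Dom) ∧
      (M.acc x ≠ ∅ → ∃ A, IsClusterList (M.acc x) (prec x) (leastFree p M prec x)
        (greatestFree p M prec x) A) := by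
  obtain ⟨h, hord, hcl, hfx⟩ := hf.order x
  refine ⟨hfx, not_theUnique_noRight_dom, fun hne => ?_⟩
  obtain ⟨G, hnd, hmem, hlen, hG⟩ := exists_enumeration h
  obtain ⟨i, k, hik, hacc⟩ := (hcl (by rwa [hfx, Ne, hf.balanced.numAcc_eq_zero])).exists_segment
    hne hmem hlen hG
  refine ⟨_, isClusterList_of_segment hf.balanced hnd hik hacc fun a b ha hb _ _ _ _ => ?_⟩
  have h1 := hord ⟨G[a], (hmem _).1 (List.getElem_mem ha)⟩ ⟨G[b], (hmem _).1 (List.getElem_mem hb)⟩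
  rwa [hG _ a ha (hlen ▸ ha) rfl, hG _ b hb (hlen ▸ hb) rfl, lexSucc_lexList] at h1

/-- If all paths accept, the relation is a cycle, and the conventions for `greatestCircular` and
`leastCircular` say where to cut it: the enumeration is rotated so as to end with `1...1`. Otherwise
some string is outside the cluster, the wrap-around pair is not contained in it, and the situation
is that of the free model. -/
theorem ComputesCircular.cluster {p : ℕ → ℕ} {M : NTM} {prec : Str → Str → Str → Bool}
    {f : Str → ℕ} (hf : ComputesCircular p M prec f) (x : Str) :
    f x = M.numAcc x ∧ (M.acc x = ∅ → ¬ (greatestCircular p M prec x).Dom) ∧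
      (M.acc x ≠ ∅ → ∃ A, IsClusterList (M.acc x) (prec x) (leastCircular p M prec x)
        (greatestCircular p M prec x) A) := by
  obtain ⟨h, hord, hcl, hfx⟩ := hf.order x
  refine ⟨hfx, fun h0 => ?_, fun hne => ?_⟩
  · have : M.numAcc x ≠ 2 ^ p x.length := by
      rw [(hf.balanced.numAcc_eq_zero x).2 h0]
      positivity
    simp only [greatestCircular, this, if_false]
    exact not_theUnique_noRight_dom h0
  obtain ⟨G, hnd, hmem, hlen, hG⟩ := exists_enumeration h
  have hpos : 0 < G.length := by rw [hlen, length_lexList]; positivity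
  have hr : ∀ (a b : ℕ) (ha : a < G.length) (hb : b < G.length),
      prec x G[a] G[b] = true ↔ b = a + 1 ∨ (a + 1 = G.length ∧ b = 0) := by
    intro a b ha hb
    have h1 := hord ⟨G[a], (hmem _).1 (List.getElem_mem ha)⟩
      ⟨G[b], (hmem _).1 (List.getElem_mem hb)⟩
    rwa [hG _ a ha (hlen ▸ ha) rfl, hG _ b hb (hlen ▸ hb) rfl, lexSucc_lexList,
      lexList_getElem_eq_ones, lexList_getElem_eq_zeros, ← hlen] at h1
  by_cases hall : M.numAcc x = 2 ^ p x.length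
  · have hacc : M.acc x = {w | w.length = p x.length} :=
      Set.eq_of_subset_of_ncard_le (hf.balanced.acc_subset x)
        (by rw [ncard_length_eq, ← hall]; rfl) (finite_length_eq _)
    have hr' : ∀ (a b : ℕ) (ha : a < G.length) (hb : b < G.length),
        prec x G[a] G[b] = true ↔ b = (a + 1) % G.length := by
      intro a b ha hb
      rw [hr a b ha hb]
      rcases Nat.lt_or_ge (a + 1) G.length with h1 | h1
      · rw [Nat.mod_eq_of_lt h1]
        omega
      · have : a + 1 = G.length := by omega
        rw [this, Nat.mod_self]
        omega
    have huniq : ∀ y z z' : Str, y ∈ G → z ∈ G → z' ∈ G → prec x y z = true →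
        prec x y z' = true → z = z' := by
      intro y z z' hy hz hz' h1 h2
      obtain ⟨a, ha, rfl⟩ := List.getElem_of_mem hy
      obtain ⟨b, hb, rfl⟩ := List.getElem_of_mem hz
      obtain ⟨c, hc, rfl⟩ := List.getElem_of_mem hz'
      rw [hr'] at h1 h2
      subst h1 h2
      rfl
    -- Rotating by `e + 1`, where `e` is the index of `1...1`, moves this string to the end and its
    -- circular successor to the front.
    obtain ⟨e, he, hones⟩ := List.getElem_of_mem
      ((hmem (List.replicate (p x.length) true)).2 (by simp))
    have hrot : ∀ w, w ∈ G.rotate (e + 1) ↔ w ∈ G := fun w => List.mem_rotate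
    refine ⟨G.rotate (e + 1), ?_, List.nodup_rotate.2 hnd, fun w => ?_, ?_, ?_, ?_, ?_⟩
    · rw [← List.length_pos_iff, List.length_rotate]
      exact hpos
    · rw [hrot, hmem, hacc]
      rfl
    · refine List.isChain_iff_getElem.2 fun i hi => ?_
      rw [List.getElem_rotate, List.getElem_rotate, hr', Nat.mod_add_mod]
      congr 1
      omega
    · intro w hw
      rw [List.head?_eq_getElem?, List.getElem?_eq_some_iff] at hw
      obtain ⟨h0, rfl⟩ := hw
      simp only [leastCircular, hall, if_true]
      -- For `p |x| = 0` the only string is the empty one.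
      split_ifs with hp
      · have : (G.rotate (e + 1))[0].length = 0 :=
          ((hmem _).1 ((hrot _).1 (List.getElem_mem h0))).trans hp
        rw [List.length_eq_zero_iff.1 this]
        exact Part.mem_some _
      · have h1 : prec x (List.replicate (p x.length) true) (G.rotate (e + 1))[0] = true := by
          rw [← hones, List.getElem_rotate, hr', Nat.zero_add]
        have h2 := (hrot _).1 (List.getElem_mem h0)
        exact mem_theUnique ⟨(hmem _).1 h2, h1⟩ fun y hy =>
          huniq _ _ _ (hones ▸ List.getElem_mem he) ((hmem _).2 hy.1) h2 hy.2 h1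
    · intro w hw
      rw [List.getLast?_eq_getElem?, List.getElem?_eq_some_iff] at hw
      obtain ⟨h0, rfl⟩ := hw
      simp only [greatestCircular, hall, if_true, Part.mem_some_iff]
      rw [List.getElem_rotate, ← hones]
      congr 1
      rw [List.length_rotate, show G.length - 1 + (e + 1) = e + G.length by omega,
        Nat.add_mod_right, Nat.mod_eq_of_lt he]
    · intro y hy z hz z' hz' _ h1 h2
      rw [hrot] at hy hz hz'
      exact huniq y z z' hy hz hz' h1 h2
  · obtain ⟨i, k, hik, hacc⟩ := (hcl (by rwa [hfx, Ne, hf.balanced.numAcc_eq_zero])).exists_segment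
      hne hmem hlen hG
    simp only [leastCircular, greatestCircular, hall, if_false]
    refine ⟨_, isClusterList_of_segment hf.balanced hnd hik hacc fun a b ha hb _ _ _ _ => ?_⟩
    rw [hr a b ha hb, or_iff_left]
    -- If both ends of the enumeration belong to the segment, it is everything, contrary to the case
    -- assumption.
    rintro ⟨h1, rfl⟩
    obtain rfl : i = 0 := by omega
    obtain rfl : a = k := by omega
    apply hall
    rw [← ncard_length_eq, NTM.numAcc]
    congr 1
    ext w
    rw [← hacc, h1, List.drop_zero, List.take_length, hmem]
    rfl

end ClusterComputing

namespace ClusterComputing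

open Function

/-! ### Stages of computations on a string of guesses -/

/-- On guess strings no shorter than the time bound the simulation reads a prefix and returns the
unread remainder. So several machines can consume one guess string in succession, and the prefixes
can be recovered. -/
theorem NTM.IsNPTM.exists_stage {M : NTM} (hM : M.IsNPTM) :
    ∃ (rest path out : Str → Str → Str) (acc : Str → Str → Bool) (P : Polynomial ℕ),
      (PT fun S : Fin 2 → Str => rest (S 0) (S 1)) ∧
      (PT fun S : Fin 2 → Str => path (S 0) (S 1)) ∧
      (PT fun S : Fin 2 → Str => out (S 0) (S 1)) ∧
      (PTb fun S : Fin 2 → Str => acc (S 0) (S 1)) ∧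
      (∀ x r, P.eval x.length ≤ r.length → acc x r = true →
        M.AcceptsWith x (path x r) (out x r) ∧ path x r ++ rest x r = r) ∧
      ∀ x w y, M.AcceptsWith x w y → w.length ≤ P.eval x.length ∧
        ∀ s, P.eval x.length ≤ (w ++ s).length → acc x (w ++ s) = true ∧ path x (w ++ s) = w ∧
          rest x (w ++ s) = s ∧ out x (w ++ s) = y := by
  obtain ⟨rest, path, out, acc, h, h1, h2, h3, h4⟩ := hM.exists_simulation
  obtain ⟨P, hP⟩ := hM
  have happ : ∀ x r, P.eval x.length ≤ r.length → path x r ++ rest x r = r := by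
    intro x r hr
    obtain ⟨t, c, hrun, -, hf, -⟩ := h x r
    exact hf.append_eq ((hrun.length_le.trans (hP _ _ _ _ hrun)).trans hr)
  refine ⟨rest, path, out, acc, P, h1, h2, h3, h4, fun x r hr ha => ?_, ?_⟩
  · obtain ⟨t, c, hrun, hc, hf, ha', ho⟩ := h x r
    exact ⟨⟨t, c, hrun, hc, ha' ▸ ha, ho.symm⟩, happ x r hr⟩
  · rintro x w y ⟨t, c, hrun, hc, ha, ho⟩
    refine ⟨hrun.length_le.trans (hP _ _ _ _ hrun), fun s hs => ?_⟩
    obtain ⟨t', c', hrun', hc', hf, ha', ho'⟩ := h x (w ++ s)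
    have hp : path x (w ++ s) <+: w ++ s := ⟨_, happ x _ hs⟩
    obtain ⟨rfl, hpw⟩ := (hrun.determined hc hrun'
      (List.prefix_or_prefix_of_prefix (List.prefix_append w s) hp)).2.2 hc'
    refine ⟨ha'.trans ha, hpw, ?_, ho'.trans ho⟩
    have := happ x _ hs
    rw [hpw] at this
    exact List.append_cancel_left this

/-- Unambiguity turns acceptance into a prefix condition: a sufficiently long guess string is
accepted exactly if it begins with the unique accepting path `v`. -/
theorem UPSVp.exists_stage {g : Str →. Str} (hg : UPSVp g) :
    ∃ (rest out : Str → Str → Str) (acc : Str → Str → Bool) (P : Polynomial ℕ),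
      (PT fun S : Fin 2 → Str => rest (S 0) (S 1)) ∧
      (PT fun S : Fin 2 → Str => out (S 0) (S 1)) ∧
      (PTb fun S : Fin 2 → Str => acc (S 0) (S 1)) ∧
      (∀ x r, P.eval x.length ≤ r.length → acc x r = true → (g x).Dom) ∧
      ∀ x y, y ∈ g x → ∃ v : Str, v.length ≤ P.eval x.length ∧
        (∀ r, P.eval x.length ≤ r.length → (acc x r = true ↔ v <+: r)) ∧
        ∀ s, P.eval x.length ≤ (v ++ s).length → rest x (v ++ s) = s ∧ out x (v ++ s) = y := by
  obtain ⟨M, hM, h⟩ := hg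
  obtain ⟨rest, path, out, acc, P, h1, h2, h3, h4, h5, h6⟩ := hM.exists_stage
  refine ⟨rest, out, acc, P, h1, h3, h4, fun x r hr ha => ?_, fun x y hy => ?_⟩
  · obtain ⟨hd, -⟩ := (h x).2.1 _ _ (h5 x r hr ha).1
    exact hd
  · obtain ⟨v, y', hv⟩ : (M.acc x).Nonempty :=
      Set.nonempty_iff_ne_empty.2 fun h0 => (h x).2.2 h0 (Part.dom_iff_mem.2 ⟨y, hy⟩)
    obtain rfl : y' = y := Part.mem_unique ((h x).2.1 _ _ hv) hy
    obtain ⟨hlen, hv'⟩ := h6 x v y' hv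
    refine ⟨v, hlen, fun r hr => ⟨fun ha => ?_, ?_⟩, fun s hs => (hv' s hs).2.2⟩
    · obtain ⟨ha', hr'⟩ := h5 x r hr ha
      rw [(h x).1 ⟨y', hv⟩ ⟨_, ha'⟩]
      exact ⟨_, hr'⟩
    · rintro ⟨s, rfl⟩
      exact (hv' s hr).1

/-- Functions that describe three successive computations on a string of guesses. -/
structure Stages where
  (rest₁ out₁ rest₂ out₂ rest₃ path₃ : Str → Str → Str)
  (acc₁ acc₂ acc₃ : Str → Str → Bool)

namespace Stages

variable (T : Stages) (prec : Str → Str → Str → Bool)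

/-- The guesses left after the first two computations. -/
def rest (x t : Str) : Str := T.rest₂ x (T.rest₁ x t)

/-- The path of the third computation. -/
def path (x t : Str) : Str := T.path₃ x (T.rest x t)

/-- The output of the second computation. -/
def out (x t : Str) : Str := T.out₂ x (T.rest₁ x t)

/-- The first two computations accept. -/
def good (x t : Str) : Bool := T.acc₁ x t && T.acc₂ x (T.rest₁ x t)

/-- All three computations accept, and the remaining guesses are ones. -/
def special (x t : Str) : Bool :=
  T.good x t && (T.acc₃ x (T.rest x t) && (T.rest₃ x (T.rest x t)).all (· == true))

/-- The first two computations accept, and the remaining guesses are zeros. -/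
def anchor (x t : Str) : Bool := T.good x t && (T.rest x t).all (· == false)

/-- All three computations accept, the path of the third one being the output of the first one. -/
def last (x t : Str) : Bool := T.special x t && decide (T.path x t = T.out₁ x t)

/-- The successor relation of special strings. -/
def next (x t t' : Str) : Bool :=
  T.special x t' &&
    ((T.special x t && (prec x (T.path x t) (T.path x t') &&
      !decide (T.path x t = T.out₁ x t))) ||
    (T.anchor x t && decide (T.path x t' = T.out x t')))

/-- The new order. -/
def order (x : Str) : Str → Str → Bool :=
  insertion (T.special x) (T.anchor x) (T.last x) (T.next prec x)

/-- The new set of accepting paths. -/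
def accepting (x w : Str) : Bool := !(w.head?.getD false) && T.special x w.tail

variable {T prec}

/-- The stages are computable in polynomial time. -/
structure Poly (T : Stages) : Prop where
  rest₁ : PT fun S : Fin 2 → Str => T.rest₁ (S 0) (S 1)
  out₁ : PT fun S : Fin 2 → Str => T.out₁ (S 0) (S 1)
  rest₂ : PT fun S : Fin 2 → Str => T.rest₂ (S 0) (S 1)
  out₂ : PT fun S : Fin 2 → Str => T.out₂ (S 0) (S 1)
  rest₃ : PT fun S : Fin 2 → Str => T.rest₃ (S 0) (S 1)
  path₃ : PT fun S : Fin 2 → Str => T.path₃ (S 0) (S 1)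
  acc₁ : PTb fun S : Fin 2 → Str => T.acc₁ (S 0) (S 1)
  acc₂ : PTb fun S : Fin 2 → Str => T.acc₂ (S 0) (S 1)
  acc₃ : PTb fun S : Fin 2 → Str => T.acc₃ (S 0) (S 1)

section poly

variable {ι : Type} {f g k : (ι → Str) → Str}

theorem _root_.ClusterComputing.PTb.comp₂ {P : Str → Str → Bool}
    (hP : PTb fun S : Fin 2 → Str => P (S 0) (S 1)) (hf : PT f) (hg : PT g) :
    PTb fun S => P (f S) (g S) :=
  PT.comp₂ (g := fun u v => [P u v]) hP hf hg

namespace Poly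

theorem rest (hT : T.Poly) (hf : PT f) (hg : PT g) : PT fun S => T.rest (f S) (g S) :=
  hT.rest₂.comp₂ hf (hT.rest₁.comp₂ hf hg)

theorem path (hT : T.Poly) (hf : PT f) (hg : PT g) : PT fun S => T.path (f S) (g S) :=
  hT.path₃.comp₂ hf (hT.rest hf hg)

theorem out (hT : T.Poly) (hf : PT f) (hg : PT g) : PT fun S => T.out (f S) (g S) :=
  hT.out₂.comp₂ hf (hT.rest₁.comp₂ hf hg)

theorem good (hT : T.Poly) (hf : PT f) (hg : PT g) : PTb fun S => T.good (f S) (g S) :=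
  (hT.acc₁.comp₂ hf hg).and (hT.acc₂.comp₂ hf (hT.rest₁.comp₂ hf hg))

theorem special (hT : T.Poly) (hf : PT f) (hg : PT g) : PTb fun S => T.special (f S) (g S) :=
  (hT.good hf hg).and ((hT.acc₃.comp₂ hf (hT.rest hf hg)).and
    ((hT.rest₃.comp₂ hf (hT.rest hf hg)).all true))

theorem anchor (hT : T.Poly) (hf : PT f) (hg : PT g) : PTb fun S => T.anchor (f S) (g S) :=
  (hT.good hf hg).and ((hT.rest hf hg).all false)

theorem last (hT : T.Poly) (hf : PT f) (hg : PT g) : PTb fun S => T.last (f S) (g S) :=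
  (hT.special hf hg).and ((hT.path hf hg).eq (hT.out₁.comp₂ hf hg))

theorem next (hT : T.Poly) (hp : PolyTimePred prec) (hf : PT f) (hg : PT g) (hk : PT k) :
    PTb fun S => T.next prec (f S) (g S) (k S) :=
  (hT.special hf hk).and (((hT.special hf hg).and
    ((hp.ptb hf (hT.path hf hg) (hT.path hf hk)).and
      ((hT.path hf hg).eq (hT.out₁.comp₂ hf hg)).not)).or
    ((hT.anchor hf hg).and ((hT.path hf hk).eq (hT.out hf hk))))

theorem order (hT : T.Poly) (hp : PolyTimePred prec) :
    PolyTimePred fun x y z => T.order prec x y z := by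
  have hx : PT fun S : Fin 3 → Str => S 0 := PT.var 0
  have hy : PT fun S : Fin 3 → Str => S 1 := PT.var 1
  have hz : PT fun S : Fin 3 → Str => S 2 := PT.var 2
  exact PTb.polyTimePred (hy.head.cond
    ((PT.of_isSucc hy.tail hz.tail).and
      (hz.head.bool (hT.special hx hz.tail) fun a b => a == b))
    (hz.head.cond (((hT.last hx hy.tail).and (hT.anchor hx hz.tail)).or
      ((hy.tail.eq hz.tail).and ((hT.special hx hy.tail).or (hT.anchor hx hy.tail)).not))
      (hT.next hp hx hy.tail hz.tail)))

theorem accepting (hT : T.Poly) : PTb fun S : Fin 2 → Str => T.accepting (S 0) (S 1) :=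
  (PT.var 1).head.not.and (hT.special (PT.var 0) (PT.var 1).tail)

end Poly

end poly

theorem ncard_setOf_mem {α : Type} [DecidableEq α] {A : List α} (hA : A.Nodup) :
    {w | w ∈ A}.ncard = A.length := by
  have : {w | w ∈ A} = (A.toFinset : Set α) := by ext; simp
  rw [this, Set.ncard_coe_finset, List.toFinset_card_of_nodup hA]

/-- The new order has the cluster of the special strings in the same order as the cluster of the
accepting paths of the third computation. -/
theorem exists_equiv {m n : ℕ} (hm : m = n + 1) {x : Str} {s : Set Str}
    {least greatest : Part Str}
    (hempty : s = ∅ → ∀ t : Str, t.length = n → T.good x t = false)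
    (hcluster : s ≠ ∅ → ∃ A, IsClusterList s (prec x) least greatest A)
    (hstages : ∀ l g, l ∈ least → g ∈ greatest → ∃ v : Str, v.length < n ∧
      (∀ t, t.length = n → (T.good x t = true ↔ v <+: t)) ∧
      (∀ r, (v ++ r).length = n → T.rest x (v ++ r) = r ∧ T.out₁ x (v ++ r) = g ∧
        T.out x (v ++ r) = l) ∧
      (∀ r, (v ++ r).length = n → T.acc₃ x r = true →
        T.path₃ x r ∈ s ∧ T.path₃ x r ++ T.rest₃ x r = r) ∧
      ∀ w ∈ s, v.length + w.length < n ∧ ∀ r, (v ++ (w ++ r)).length = n →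
        T.acc₃ x (w ++ r) = true ∧ T.path₃ x (w ++ r) = w ∧ T.rest₃ x (w ++ r) = r) :
    {w | w.length = m ∧ T.accepting x w = true}.ncard = s.ncard ∧
    ∃ h : BitStr m ≃ BitStr m,
      (∀ y : BitStr m, y.1 = List.replicate m false → (h y).1 = List.replicate m false) ∧
      (∀ y : BitStr m, y.1 = List.replicate m true → (h y).1 = List.replicate m true) ∧
      (∀ y z : BitStr m, T.order prec x y.1 z.1 = true ↔ LexSucc (h y).1 (h z).1) ∧
      (s ≠ ∅ → ∃ l u : BitStr m, {w | w.length = m ∧ T.accepting x w = true} =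
        {w | ∃ hw : w.length = m, LexLE (h l).1 (h ⟨w, hw⟩).1 ∧
          LexLE (h ⟨w, hw⟩).1 (h u).1}) := by
  subst hm
  by_cases hs : s = ∅
  -- Without accepting paths there are no good strings. Nothing is moved, and the order is plain
  -- binary counting, with `Z = []`.
  · have hg := hempty hs
    have hsp : ∀ t, t.length = n → T.special x t = false := fun t ht => by
      simp [special, hg t ht]
    have han : ∀ t, t.length = n → T.anchor x t = false := fun t ht => by
      simp [anchor, hg t ht]
    have hla : ∀ t, t.length = n → T.last x t = false := fun t ht => by
      simp [last, hsp t ht]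
    have hne : ∀ t t', t.length = n → t'.length = n → T.next prec x t t' = false :=
      fun t t' _ ht' => by simp [next, hsp t' ht']
    refine ⟨?_, ?_⟩
    · rw [hs, Set.ncard_empty, Set.ncard_eq_zero
        ((finite_length_eq (n + 1)).subset fun w hw => hw.1)]
      ext w
      rcases w with _ | ⟨c, t⟩
      · simp
      · simp only [accepting, Set.mem_ofPred_eq, List.tail_cons, List.length_cons,
          Nat.add_right_cancel_iff, Set.mem_empty_iff_false, iff_false, not_and]
        intro ht
        simp [hsp t ht]
    · obtain ⟨h, h1, h2, h3, -⟩ := exists_equiv_insertion (n := n) (Z := []) (sp := T.special x)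
        (an := T.anchor x) (la := T.last x) (N := T.next prec x) (by simp) (by simp)
        (fun t ht => by simp [hsp t ht]) (fun t ht => by simp [han t ht])
        (fun t ht => by simp [hla t ht]) (by simp)
        (fun t t' ht ht' h => by simp [hne t t' ht ht'] at h)
        (fun t t' _ ht ht' _ h => by simp [hne t t' ht ht'] at h) (by simp)
      exact ⟨h, h1, h2, h3, fun h => (h hs).elim⟩
  · obtain ⟨A, hA⟩ := hcluster hs
    obtain ⟨l, A', rfl⟩ : ∃ l A', A = l :: A' := List.exists_cons_of_ne_nil hA.ne_nil
    set A := l :: A' with hAdef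
    obtain ⟨g, hg⟩ : ∃ g, A.getLast? = some g := ⟨_, List.getLast?_cons⟩
    have hgA : g ∈ A := List.mem_of_getLast? hg
    obtain ⟨v, hv, hgood, hrest, hacc, hpath⟩ := hstages l g (hA.head_mem l rfl)
      (hA.getLast_mem g hg)
    -- Here `v` consists of the accepting paths of the first two computations; `a` is the anchor and
    -- `enc w` is the special string that encodes the accepting path `w`.
    set a : Str := v ++ List.replicate (n - v.length) false with ha
    set enc : Str → Str := fun w => v ++ (w ++ List.replicate (n - v.length - w.length) true)
      with henc
    have hwlen : ∀ w ∈ A, v.length + w.length < n := fun w hw => (hpath w ((hA.mem w).1 hw)).1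
    have halen : a.length = n := by simp [ha]; omega
    have henclen : ∀ w ∈ A, (enc w).length = n := by
      intro w hw
      have := hwlen w hw
      simp [henc]; omega
    have hencspec : ∀ w ∈ A, T.path x (enc w) = w ∧ T.special x (enc w) = true := by
      intro w hw
      obtain ⟨h1, h2, h3⟩ := (hpath w ((hA.mem w).1 hw)).2 _ (henclen w hw)
      have h4 := (hrest _ (henclen w hw)).1
      have h5 := (hgood _ (henclen w hw)).2 (List.prefix_append _ _)
      have h4' : T.rest x (enc w) = w ++ List.replicate (n - v.length - w.length) true := h4
      have h5' : T.good x (enc w) = true := h5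
      refine ⟨by rw [path, h4', h2], ?_⟩
      rw [special, h5', h4', h1, h3]
      simp
    -- Decoding: the prefix `v` is forced, the third computation splits the remainder into its path
    -- and unread guesses, and the length determines the number of padding ones.
    have hspec : ∀ t, t.length = n → T.special x t = true → T.path x t ∈ A ∧ enc (T.path x t) = t := by
      intro t ht h
      simp only [special, Bool.and_eq_true] at h
      obtain ⟨h1, h2, h3⟩ := h
      obtain ⟨r, rfl⟩ := (hgood t ht).1 h1
      rw [(hrest r ht).1] at h2 h3
      obtain ⟨h4, h5⟩ := hacc r ht h2
      have h6 : T.rest₃ x r = List.replicate (T.rest₃ x r).length true :=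
        List.eq_replicate_iff.2 ⟨rfl, by simpa using h3⟩
      rw [path, (hrest r ht).1]
      refine ⟨(hA.mem _).2 h4, ?_⟩
      have h7 : (T.rest₃ x r).length = n - v.length - (T.path₃ x r).length := by
        have := congrArg List.length h5
        simp only [List.length_append] at this ht
        omega
      simp only [henc]
      rw [← h7, ← h6, h5]
    have hspiff : ∀ t, t.length = n → (T.special x t = true ↔ t ∈ A.map enc) := by
      intro t ht
      rw [List.mem_map]
      constructor
      · intro h
        exact ⟨_, hspec t ht h⟩
      · rintro ⟨w, hw, rfl⟩
        exact (hencspec w hw).2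
    have haniff : ∀ t, t.length = n → (T.anchor x t = true ↔ t = a) := by
      intro t ht
      simp only [anchor, Bool.and_eq_true]
      constructor
      · rintro ⟨h1, h2⟩
        obtain ⟨r, rfl⟩ := (hgood t ht).1 h1
        rw [(hrest r ht).1] at h2
        have h3 : r = List.replicate r.length false :=
          List.eq_replicate_iff.2 ⟨rfl, by simpa using h2⟩
        have h4 : r.length = n - v.length := by
          simp only [List.length_append] at ht
          omega
        rw [ha, ← h4, ← h3]
      · rintro rfl
        have h4 : T.rest x a = List.replicate (n - v.length) false := (hrest _ halen).1
        refine ⟨(hgood _ halen).2 (List.prefix_append _ _), ?_⟩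
        rw [h4]
        simp
    -- Every special string carries, in its prefix `v`, computations that yield the greatest and the
    -- least element.
    have hout : ∀ t, t.length = n → T.special x t = true → T.out₁ x t = g ∧ T.out x t = l := by
      intro t ht h
      simp only [special, Bool.and_eq_true] at h
      obtain ⟨r, rfl⟩ := (hgood t ht).1 h.1
      exact (hrest r ht).2
    have hencinj : ∀ w ∈ A, ∀ w' ∈ A, enc w = enc w' → w = w' := by
      intro w hw w' hw' h
      rw [← (hencspec w hw).1, h, (hencspec w' hw').1]
    -- The strict length bound leaves room for at least one padding symbol. Hence no code coincides
    -- with the anchor or with `0...0`.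
    have htrue : ∀ w ∈ A, true ∈ w ++ List.replicate (n - v.length - w.length) true := by
      intro w hw
      have := hwlen w hw
      refine List.mem_append_right _ (List.mem_replicate.2 ⟨?_, rfl⟩)
      omega
    have ha_notin : a ∉ A.map enc := by
      intro h
      obtain ⟨w, hw, h⟩ := List.mem_map.1 h
      have := htrue w hw
      rw [List.append_cancel_left h] at this
      simp at this
    have hmap_nodup : (A.map enc).Nodup :=
      List.Nodup.map_on (fun w hw w' hw' => hencinj w hw w' hw') hA.nodup
    have hlaiff : ∀ t, t.length = n → (T.last x t = true ↔ t = enc g) := by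
      intro t ht
      simp only [last, Bool.and_eq_true, decide_eq_true_iff]
      constructor
      · rintro ⟨h1, h2⟩
        rw [← (hspec t ht h1).2, h2, (hout t ht h1).1]
      · rintro rfl
        have h := hencspec g hgA
        exact ⟨h.2, h.1.trans (hout _ ht h.2).1.symm⟩
    have hgetLast : (a :: A.map enc).getLast? = some (enc g) := by
      rw [List.getLast?_cons, List.getLast?_map, hg]
      rfl
    -- On codes, `next` is `prec` with the arrows out of the greatest element deleted, together with
    -- an arrow from the anchor to the code of the least element.
    have hnext : ∀ t t', t.length = n → t'.length = n → (T.next prec x t t' = true ↔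
        ∃ w' ∈ A, t' = enc w' ∧ ((∃ w ∈ A, t = enc w ∧ prec x w w' = true ∧ w ≠ g) ∨
          (t = a ∧ w' = l))) := by
      intro t t' ht ht'
      simp only [next, Bool.and_eq_true, Bool.or_eq_true, Bool.not_eq_true', decide_eq_true_iff,
        decide_eq_false_iff_not, haniff t ht]
      constructor
      · rintro ⟨h1, h2⟩
        refine ⟨_, (hspec t' ht' h1).1, (hspec t' ht' h1).2.symm, ?_⟩
        rcases h2 with ⟨h2, h3, h4⟩ | ⟨h2, h3⟩
        · exact .inl ⟨_, (hspec t ht h2).1, (hspec t ht h2).2.symm, h3, (hout t ht h2).1 ▸ h4⟩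
        · exact .inr ⟨h2, h3.trans (hout t' ht' h1).2⟩
      · rintro ⟨w', hw', rfl, h⟩
        have h1 := hencspec w' hw'
        refine ⟨h1.2, ?_⟩
        rcases h with ⟨w, hw, rfl, h2, h3⟩ | ⟨h2, rfl⟩
        · have h4 := hencspec w hw
          refine .inl ⟨h4.2, by rwa [h4.1, h1.1], ?_⟩
          rwa [h4.1, (hout _ ht h4.2).1]
        · exact .inr ⟨h2, h1.1.trans (hout _ ht' h1.2).2.symm⟩
    have hset : {w | w.length = n + 1 ∧ T.accepting x w = true} =
        {w | ∃ t ∈ A.map enc, w = false :: t} := by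
      ext w
      rcases w with _ | ⟨c, t⟩
      · simp
      · simp only [accepting, Set.mem_ofPred_eq, List.length_cons, Nat.add_right_cancel_iff,
          List.head?_cons, Option.getD_some, List.tail_cons, Bool.and_eq_true, Bool.not_eq_true']
        constructor
        · rintro ⟨h1, rfl, h2⟩
          exact ⟨t, (hspiff t h1).1 h2, rfl⟩
        · rintro ⟨t', ht', h⟩
          obtain ⟨rfl, rfl⟩ := List.cons.inj h
          have : t.length = n := by
            obtain ⟨w, hw, rfl⟩ := List.mem_map.1 ht'
            exact henclen w hw
          exact ⟨this, rfl, (hspiff t this).2 ht'⟩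
    refine ⟨?_, ?_⟩
    · have h1 : {w | ∃ t ∈ A.map enc, w = false :: t} =
          {w | w ∈ (A.map enc).map (false :: ·)} := by
        ext w
        simp only [Set.mem_ofPred_eq, List.mem_map (f := fun t : Str => false :: t), eq_comm]
      have h2 : s = {w | w ∈ A} := by
        ext w
        exact (hA.mem w).symm
      rw [hset, h1, h2, ncard_setOf_mem hA.nodup,
        ncard_setOf_mem (hmap_nodup.map fun _ _ h => (List.cons.inj h).2)]
      simp
    · obtain ⟨h, h1, h2, h3, h4⟩ := exists_equiv_insertion (n := n) (Z := a :: A.map enc)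
        (sp := T.special x) (an := T.anchor x) (la := T.last x) (N := T.next prec x)
        (by
          intro t ht
          rcases List.mem_cons.1 ht with rfl | ht
          · exact halen
          · obtain ⟨w, hw, rfl⟩ := List.mem_map.1 ht
            exact henclen w hw)
        (List.nodup_cons.2 ⟨ha_notin, hmap_nodup⟩)
        (fun t ht => hspiff t ht)
        (fun t ht => by rw [haniff t ht, List.head?_cons, Option.some.injEq, eq_comm])
        (fun t ht => by rw [hlaiff t ht, hgetLast, Option.some.injEq, eq_comm])
        (by
          refine List.isChain_cons.2 ⟨?_, ?_⟩
          · rintro _ ⟨⟩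
            exact (hnext _ _ halen (henclen l (by simp [hAdef]))).2
              ⟨l, by simp [hAdef], rfl, .inr ⟨rfl, rfl⟩⟩
          · rw [List.isChain_map]
            have hc := List.isChain_iff_getElem.1 hA.chain
            refine List.isChain_iff_getElem.2 fun i hi => ?_
            refine (hnext _ _ (henclen _ (List.getElem_mem _)) (henclen _ (List.getElem_mem _))).2
              ⟨_, List.getElem_mem _, rfl, .inl ⟨_, List.getElem_mem _, rfl, hc i hi, ?_⟩⟩
            -- An entry followed by another one is not the greatest element, so its arrow has not
            -- been deleted.
            intro h
            have hg' := hg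
            rw [List.getLast?_eq_getElem?, List.getElem?_eq_some_iff] at hg'
            obtain ⟨h0, hg'⟩ := hg'
            rw [← hg', hA.nodup.getElem_inj_iff] at h
            omega)
        (by
          intro t t' ht ht' h
          rw [hgetLast]
          obtain ⟨w', hw', rfl, ⟨w, hw, rfl, -, h⟩ | ⟨rfl, rfl⟩⟩ := (hnext t t' ht ht').1 h
          · refine ⟨List.mem_cons_of_mem _ (List.mem_map_of_mem hw), fun h' => h ?_⟩
            exact (hencinj _ hgA _ hw (Option.some.inj h')).symm
          · refine ⟨List.mem_cons_self, fun h' => ha_notin ?_⟩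
            rw [← Option.some.inj h']
            exact List.mem_map_of_mem hgA)
        (by
          intro t t' t'' ht ht' ht'' h₀ h₀'
          obtain ⟨w', hw', rfl, h⟩ := (hnext t t' ht ht').1 h₀
          obtain ⟨w'', hw'', rfl, h'⟩ := (hnext t t'' ht ht'').1 h₀'
          rcases h with ⟨w, hw, rfl, h, hwg⟩ | ⟨rfl, rfl⟩ <;>
            rcases h' with ⟨w₁, hw₁, h₁, h', hwg'⟩ | ⟨h₁, rfl⟩
          · obtain rfl := hencinj w hw w₁ hw₁ h₁
            rw [hA.unique w hw w' hw' w'' hw'' (by rw [hg]; simpa using hwg.symm) h h']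
          · exact (ha_notin (h₁ ▸ List.mem_map_of_mem hw)).elim
          · exact (ha_notin (h₁ ▸ List.mem_map_of_mem hw₁)).elim
          · rfl)
        (by
          simp only [List.tail_cons, List.mem_map, not_exists, not_and]
          intro w hw h
          have := List.mem_append_right v (htrue w hw)
          change true ∈ enc w at this
          rw [h] at this
          simp at this)
      refine ⟨h, h1, h2, h3, fun _ => ?_⟩
      rw [hset]
      exact h4 (by simp [hAdef])

end Stages

end ClusterComputing

/-! ### The new machine and the conclusion -/

namespace ClusterComputing

open Function

/-- The base `n + 2` is at least `2` for all `n`. Therefore one more factor absorbs the sum of two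
bounds, and a coefficient `c` is absorbed by `(n + 2) ^ c`. -/
theorem exists_eval_lt_pow (P : Polynomial ℕ) : ∃ d, ∀ n, P.eval n < (n + 2) ^ d := by
  induction P using Polynomial.induction_on' with
  | add P Q hP hQ =>
    obtain ⟨a, ha⟩ := hP
    obtain ⟨b, hb⟩ := hQ
    refine ⟨max a b + 1, fun n => ?_⟩
    have h1 := (ha n).trans_le (Nat.pow_le_pow_right (show 0 < n + 2 by omega) (le_max_left a b))
    have h2 := (hb n).trans_le (Nat.pow_le_pow_right (show 0 < n + 2 by omega) (le_max_right a b))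
    rw [Polynomial.eval_add, pow_succ]
    nlinarith
  | monomial k c =>
    refine ⟨c + k, fun n => ?_⟩
    rw [Polynomial.eval_monomial, pow_add]
    have h1 : c < (n + 2) ^ c := c.lt_pow_self (by omega)
    have h2 : n ^ k ≤ (n + 2) ^ k := Nat.pow_le_pow_left (by omega) k
    exact Nat.mul_lt_mul_of_lt_of_le h1 h2 (by positivity)

/-- A function that counts the elements of clusters is in `CLU#P` if the greatest and the least
element of the cluster can be computed by unambiguous machines. -/
theorem cluSharpP_of_clusters {M : NTM} {prec : Str → Str → Str → Bool} {f : Str → ℕ}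
    {greatest least : Str →. Str} (hM : M.IsNPTM) (hp : PolyTimePred prec)
    (hgr : UPSVp greatest) (hle : UPSVp least)
    (hf : ∀ x, f x = M.numAcc x ∧ (M.acc x = ∅ → ¬ (greatest x).Dom) ∧
      (M.acc x ≠ ∅ → ∃ A, IsClusterList (M.acc x) (prec x) (least x) (greatest x) A)) :
    CLUSharpP f := by
  obtain ⟨rest₁, out₁, acc₁, P₁, r1, o1, a1, hdom, h1⟩ := hgr.exists_stage
  obtain ⟨rest₂, out₂, acc₂, P₂, r2, o2, a2, -, h2⟩ := hle.exists_stage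
  obtain ⟨rest₃, path₃, out₃, acc₃, P₃, r3, p3, -, a3, h3, h3'⟩ := hM.exists_stage
  let T : Stages := ⟨rest₁, out₁, rest₂, out₂, rest₃, path₃, acc₁, acc₂, acc₃⟩
  have hT : T.Poly := ⟨r1, o1, r2, o2, r3, p3, a1, a2, a3⟩
  -- One bit precedes `t`. The extra `1` together with the strict inequality makes `|t|` larger than
  -- the sum of the three time bounds, which leaves a nonempty padding.
  obtain ⟨d, hd⟩ := exists_eval_lt_pow (P₁ + P₂ + P₃ + 1)
  simp only [Polynomial.eval_add, Polynomial.eval_one] at hd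
  let q : ℕ → ℕ := fun n => (n + 2) ^ d
  obtain ⟨N, hN, hbal, hacc⟩ := exists_balanced (q := q) (a := T.accepting)
    ((PT.var (0 : Fin 1)).clock d true) hT.accepting
  refine ⟨q, N, fun x => List.replicate (q x.length) false,
    fun x => List.replicate (q x.length) true, fun x y z => T.order prec x y z,
    ⟨(Polynomial.X + 2) ^ d, fun n => by simp [q]⟩, hN, hbal,
    ((PT.var (0 : Fin 1)).clock d false).fpt, ((PT.var (0 : Fin 1)).clock d true).fpt,
    hT.order hp, fun x => ?_⟩
  obtain ⟨hfx, hempty, hcluster⟩ := hf x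
  have hx : P₁.eval x.length + P₂.eval x.length + P₃.eval x.length + 1 < q x.length := hd x.length
  obtain ⟨n, hn⟩ : ∃ n, q x.length = n + 1 := Nat.exists_eq_add_one.2 (by omega)
  obtain ⟨hcard, h, hb, ht, hord, hcl⟩ := Stages.exists_equiv (T := T) hn
    (fun h0 t ht => by
      by_contra h
      simp only [Stages.good, Bool.not_eq_false, Bool.and_eq_true] at h
      exact hempty h0 (hdom x t (by omega) h.1)) hcluster
    (fun l g hl hg => by
      obtain ⟨v₁, hv₁, hacc₁, hrest₁⟩ := h1 x g hg
      obtain ⟨v₂, hv₂, hacc₂, hrest₂⟩ := h2 x l hl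
      -- Even after the two witness paths enough guesses are left for the third computation not to
      -- run out of them.
      have hlen : ∀ r : Str, (v₁ ++ v₂ ++ r).length = n → P₃.eval x.length < r.length := by
        intro r hr
        simp only [List.length_append] at hr
        omega
      have hs : ∀ r : Str, (v₁ ++ v₂ ++ r).length = n →
          (rest₁ x (v₁ ++ v₂ ++ r) = v₂ ++ r ∧ out₁ x (v₁ ++ v₂ ++ r) = g) ∧
          rest₂ x (v₂ ++ r) = r ∧ out₂ x (v₂ ++ r) = l := by
        intro r hr
        rw [List.append_assoc] at hr ⊢
        refine ⟨hrest₁ _ (by omega), hrest₂ _ ?_⟩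
        simp only [List.length_append] at hr ⊢
        omega
      refine ⟨v₁ ++ v₂, ?_, fun t ht => ?_, fun r hr => ?_, fun r hr ha => ?_,
        fun w ⟨y, hw⟩ => ⟨?_, fun r hr => ?_⟩⟩
      · simp only [List.length_append]
        omega
      · simp only [Stages.good, Bool.and_eq_true, T]
        rw [hacc₁ t (by omega)]
        constructor
        · rintro ⟨⟨s, rfl⟩, h⟩
          rw [(hrest₁ s (by omega)).1, hacc₂ s (by simp only [List.length_append] at ht; omega)] at h
          obtain ⟨r, rfl⟩ := h
          exact ⟨r, by simp⟩
        · rintro ⟨r, rfl⟩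
          rw [(hs r ht).1.1]
          refine ⟨⟨v₂ ++ r, by simp⟩, (hacc₂ _ ?_).2 (List.prefix_append _ _)⟩
          simp only [List.length_append] at ht ⊢
          omega
      · obtain ⟨⟨e1, e2⟩, e3, e4⟩ := hs r hr
        simp only [Stages.rest, Stages.out, T]
        rw [e1]
        exact ⟨e3, e2, e4⟩
      · obtain ⟨e1, e2⟩ := h3 x r (hlen r hr).le ha
        exact ⟨⟨_, e1⟩, e2⟩
      · have := (h3' x w y hw).1
        simp only [List.length_append]
        omega
      · obtain ⟨e1, e2, e3, -⟩ := (h3' x w y hw).2 r (hlen _ hr).le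
        exact ⟨e1, e2, e3⟩)
  refine ⟨h, ⟨by simp, by simp, hb _ rfl, ht _ rfl⟩, hord, fun h0 => ?_, ?_⟩
  · obtain ⟨l, u, hlu⟩ := hcl fun h' => h0 (by rw [hfx, NTM.numAcc, h', Set.ncard_empty])
    exact ⟨l, u, (hacc x).trans hlu⟩
  · rw [hfx, NTM.numAcc, NTM.numAcc, hacc, hcard]

end ClusterComputing

/-- Both models enter the construction only through the description of clusters as lists. -/
theorem theoremt (p : ℕ → ℕ) (M : ClusterComputing.NTM) (prec : List Bool → List Bool → List Bool → Bool)
    (f : List Bool → ℕ) :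
    (ClusterComputing.ComputesFree p M prec f →
      ClusterComputing.UPSVp (ClusterComputing.greatestFree p M prec) →
      ClusterComputing.UPSVp (ClusterComputing.leastFree p M prec) →
      ClusterComputing.CLUSharpP f) ∧
    (ClusterComputing.ComputesCircular p M prec f →
      ClusterComputing.UPSVp (ClusterComputing.greatestCircular p M prec) →
      ClusterComputing.UPSVp (ClusterComputing.leastCircular p M prec) →
      ClusterComputing.CLUSharpP f) :=
  ⟨fun hf hg hl => ClusterComputing.cluSharpP_of_clusters hf.nptm hf.prec_poly hg hl hf.cluster,
    fun hf hg hl => ClusterComputing.cluSharpP_of_clusters hf.nptm hf.prec_poly hg hl hf.cluster⟩
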